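/- **Definitions.** A walk on $\mathbb Z^2$ starts at the origin and takes unit north, east, south or west steps. It is *prudent* if it never takes a step towards an already visited node (that is, no visited node lies on the open half-line issuing from the current position in the direction of the next step); such a walk is self-avoiding. It is *3-sided* if after every number of steps its endpoint lies on the north, east or west side of the bounding box (smallest lattice rectangle) of the part walked so far, and moreover, whenever this box has non-zero width, a south step is never followed by a west step from the east side of the box, nor by an east step from the west side of the box. A *3-sided prudent polygon* is a 3-sided prudent walk with at least two steps that ends at a node adjacent to the origin; its *area* is the area enclosed by the walk together with the closing edge. Let $PA_n$ be the number of 3-sided prudent polygons of area $n$ (it is finite) and let $PA(q)=\sum_{n}PA_nq^n$. Put $(x;q)_\infty=\prod_{j\ge 0}(1-xq^j)$ and $$u=\frac{q}{1-q},\quad v=\frac{1-q+q^2}{1-q},\quad C(q)=\frac{2q(3-10q+9q^2-q^3)}{(1-q)(1-2q)^2},\quad A(q)=\frac{2q(1-q)^2}{(1-2q)^2},$$ $$Q(z;q)=\frac{(vz;q)_\infty}{(quz;q)_\infty},\qquad d_\nu(q)=[z^\nu]\frac1{Q(z;q)}.$$ For $k\ge 2$ let $\overline z_k$ be the root of $1-2x+x^{k+2}$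 in $(0,1)$; this root is unique. **Lemma.** (i) The power series $PA(q)$ converges for $|q|<\frac12$ and its sum extends to a function, still denoted $PA(q)$, that is analytic at all points of the slit disc $\mathcal D_0=\{q\in\mathbb C: |q|<\frac{55}{100},\ q\notin[\frac12,\frac{55}{100}]\}$. For every $q\in\mathcal D_0$ the denominators below do not vanish, the series converges, and $$PA(q)=C(q)-A(q)\frac{(v;q)_\infty}{(qu;q)_\infty}\left[\frac{q^2}{(1-q)^2}+\sum_{\nu\ge1}d_\nu(q)\frac{q^{\nu+2}}{1-2q+q^{\nu+2}}\right].$$ (ii) One has $\frac12<\overline z_k<\frac{55}{100}$ for all $k\ge2$, and $\overline z_k\to\frac12$ as $k\to\infty$. The function $PA(q)$ extends further to a meromorphic function in the disc $|q|<\frac{55}{100}$ punctured at $\frac12$; it has a simple pole at each $\overline z_k$, $k\ge2$, and is analytic at every other point of the punctured disc. (iii) Consequently $PA(q)$ is non-holonomic: it satisfies no linear differential equation with polynomial coefficients in $\mathbb C[q]$, not all zero. In particular, $PA(q)$ is transcendental over $\mathbb C(q)$. -/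

import Mathlib

open scoped Polynomial PowerSeries Topology

namespace Prudent

/-- The unit steps of the square lattice. -/
inductive Step
  | north
  | east
  | south
  | west

/-- The displacement of a step. -/
def Step.vec : Step → ℤ × ℤ
  | .north => (0, 1)
  | .east => (1, 0)
  | .south => (0, -1)
  | .west => (-1, 0)

/-- A walk on `ℤ²` starting at the origin, given by its sequence of steps. -/
abbrev Walk := List Step

/-- The position of the walk after its first `i` steps. -/
def Walk.pos (w : Walk) (i : ℕ) : ℤ × ℤ := ((w.take i).map Step.vec).sum

/-- A walk is prudent if it never takes a step towards an already occupied node: no node visited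
so far lies on the open half-line that starts at the current position and points in the direction
of the next step. (Taking `t = 1`, such a walk is self-avoiding.) -/
def Walk.IsPrudent (w : Walk) : Prop :=
  ∀ (i : ℕ) (hi : i < w.length), ∀ j ≤ i, ∀ t : ℕ, 1 ≤ t →
    w.pos j ≠ w.pos i + (t : ℤ) • (w[i]).vec

/-- After `i` steps, the walk is on the north side of its current bounding box. -/
def Walk.OnNorth (w : Walk) (i : ℕ) : Prop := ∀ j ≤ i, (w.pos j).2 ≤ (w.pos i).2

/-- After `i` steps, the walk is on the east side of its current bounding box. -/
def Walk.OnEast (w : Walk) (i : ℕ) : Prop := ∀ j ≤ i, (w.pos j).1 ≤ (w.pos i).1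

/-- After `i` steps, the walk is on the west side of its current bounding box. -/
def Walk.OnWest (w : Walk) (i : ℕ) : Prop := ∀ j ≤ i, (w.pos i).1 ≤ (w.pos j).1

/-- After `i` steps, the bounding box of the walk has non-zero width. -/
def Walk.WideBox (w : Walk) (i : ℕ) : Prop := ∃ j ≤ i, ∃ k ≤ i, (w.pos j).1 ≠ (w.pos k).1

/-- A walk is 3-sided if it is always on the north, east or west side of its current bounding box,
where moreover, when the box has non-zero width, a south step must not be followed by a west step
on the east side of the box, nor by an east step on the west side of the box. -/
def Walk.IsThreeSided (w : Walk) : Prop :=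
  (∀ i ≤ w.length, w.OnNorth i ∨ w.OnEast i ∨ w.OnWest i) ∧
  ∀ (i : ℕ) (hi : i + 1 < w.length), w[i] = Step.south → w.WideBox (i + 1) →
    (w.OnEast (i + 1) → w[i + 1] ≠ Step.west) ∧ (w.OnWest (i + 1) → w[i + 1] ≠ Step.east)

/-- The walk has at least two steps and ends at a node adjacent to its starting point; closing it
up by one more edge gives a polygon. -/
def Walk.IsAlmostClosed (w : Walk) : Prop :=
  2 ≤ w.length ∧ |(w.pos w.length).1| + |(w.pos w.length).2| = 1

/-- The area enclosed by the closed walk obtained by joining the last node to the origin: the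
absolute value of `∮ x dy`, the last summand being the contribution of the closing edge. -/
def Walk.area (w : Walk) : ℕ :=
  (∑ i ∈ Finset.range w.length, (w.pos i).1 * ((w.pos (i + 1)).2 - (w.pos i).2)
    + (w.pos w.length).1 * (0 - (w.pos w.length).2)).natAbs

/-- The 3-sided prudent polygons of area `n`. -/
def polygons (n : ℕ) : Set Walk :=
  {w | w.IsPrudent ∧ w.IsThreeSided ∧ w.IsAlmostClosed ∧ w.area = n}

/-- The area generating function of 3-sided prudent polygons. -/
noncomputable def PA : ℂ⟦X⟧ := PowerSeries.mk fun n => ((polygons n).ncard : ℂ)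

/-- The infinite `q`-Pochhammer symbol `(x; q)_∞`. -/
noncomputable def qPoch (x q : ℂ) : ℂ := ∏' j : ℕ, (1 - x * q ^ j)

noncomputable def u (q : ℂ) : ℂ := q / (1 - q)

noncomputable def v (q : ℂ) : ℂ := (1 - q + q ^ 2) / (1 - q)

noncomputable def C (q : ℂ) : ℂ :=
  2 * q * (3 - 10 * q + 9 * q ^ 2 - q ^ 3) / ((1 - q) * (1 - 2 * q) ^ 2)

noncomputable def A (q : ℂ) : ℂ := 2 * q * (1 - q) ^ 2 / (1 - 2 * q) ^ 2

/-- `Q(z; q) = (v z; q)_∞ / (q u z; q)_∞`. -/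
noncomputable def Q (z q : ℂ) : ℂ := qPoch (v q * z) q / qPoch (q * u q * z) q

/-- The coefficient of `z ^ ν` in the Taylor expansion of `1 / Q(z; q)` at `z = 0`. -/
noncomputable def d (ν : ℕ) (q : ℂ) : ℂ :=
  iteratedDeriv ν (fun z : ℂ => 1 / Q z q) 0 / (ν.factorial : ℂ)

/-- The smallest root in `[0, 1]` of `1 - 2 x + x ^ (k + 2)` (the number `1` is always a root). -/
noncomputable def zbar (k : ℕ) : ℝ :=
  sInf {x : ℝ | x ∈ Set.Icc 0 1 ∧ 1 - 2 * x + x ^ (k + 2) = 0}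

/-- The disc `|q| < 55/100` slit along the real interval `[1/2, 55/100]`. -/
def slitDisc : Set ℂ :=
  {q : ℂ | ‖q‖ < 55 / 100 ∧ ∀ x : ℝ, x ∈ Set.Icc (1 / 2) (55 / 100) → q ≠ (x : ℂ)}

/-- The disc `|q| < 55/100` punctured at `1/2`. -/
def puncturedDisc : Set ℂ := {q : ℂ | ‖q‖ < 55 / 100 ∧ q ≠ 1 / 2}

/-- A power series is holonomic (D-finite) if it satisfies a non-trivial linear differential
equation with polynomial coefficients. -/
def IsHolonomic (F : ℂ⟦X⟧) : Prop :=
  ∃ (r : ℕ) (p : ℕ → ℂ[X]), p r ≠ 0 ∧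
    ∑ i ∈ Finset.range (r + 1), (p i : ℂ⟦X⟧) * (PowerSeries.derivative ℂ)^[i] F = 0

end Prudent

namespace Prudent

/-! ### Walks, their endpoints and visited sets -/

/-! Combinatorics. Inside the half-plane `x ≥ 0`, a prudent 3-sided walk is determined, up to a
straight tail, by the steps that enlarge its bounding box. From the top row it slides to some
abscissa and goes north, or runs east out of the box; from the east column it goes north out of the
box, or slides up or down and goes east. A `Code` records these choices; `coded_of_good` shows that
there are no others, and the automaton `run` reads the code back (`run_word`). Up to reflection,
which reverses the sign of the area, a polygon is a hook ending at (1,0), a bar graph ending at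
(0,1), or a walk that ends with a new row and is then closed along the line `x = -1` down to (-1,0)
(`ccw_or_mirror`). For area `n ≥ 1` there are 1 hook and 2^(n-1) bar graphs, so the substance lies
in the third family.

Generating functions. Deleting the last letter of a code gives a first-order recurrence in the width
`M` (`aFun_succ`). Summed against `t ^ M` it becomes a q-difference equation relating G(t) and G(qt)
(`gFun_funEq`). The q-binomial theorem gives the Taylor coefficients of 1/Q, and dividing the ν-th
one by 1 - 2q + q^(ν+2) produces a series that solves this equation (`sFun_funEq`). The difference
of G and the explicit solution satisfies a homogeneous, contracting equation, hence vanishes at t =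
1 (`defect_one`). All this is done for |q| ≤ 1/40 only; the formula then provides the continuation.

Analysis. For |q| ≤ 0.55 the coefficients of 1/Q grow at most like (7/4)^ν, and 0.55 · 7/4 < 1, so
the series converges away from 1/2. Near any other point only finitely many denominators can vanish.
A denominator of exponent at least 4 has exactly one zero in the disc, `zbar k`, and this zero is
simple (`cofactor_ne_zero`). Distinct `k` give distinct zeros and the remaining factors do not
vanish there, so each `zbar k` is a simple pole (`exists_pole`).

Non-holonomicity. In a relation Σ p_i G_i = 0 with p_r ≠ 0, choose k with p_r(`zbar k`) ≠ 0. If the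
pole order of G_i at `zbar k` strictly increases with i, the last term cannot be cancelled
(`sum_mul_ne_zero`). Derivatives of `PA` give non-holonomicity, powers of `PA` give transcendence.
-/

/-- The endpoint of a walk. -/
def endPt (w : Walk) : ℤ × ℤ := (w.map Step.vec).sum

/-- The set of nodes visited by a walk. -/
def visited (w : Walk) : Set (ℤ × ℤ) := {p | ∃ j ≤ w.length, w.pos j = p}

lemma pos_length (w : Walk) : w.pos w.length = endPt w := by
  simp [Walk.pos, endPt]

lemma pos_zero (w : Walk) : w.pos 0 = 0 := by simp [Walk.pos]

lemma pos_append_of_le (w r : Walk) {i : ℕ} (h : i ≤ w.length) :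
    Walk.pos (w ++ r) i = w.pos i := by
  simp [Walk.pos, List.take_append_of_le_length h]

lemma endPt_append (w r : Walk) : endPt (w ++ r) = endPt w + endPt r := by
  simp [endPt]

lemma endPt_snoc (w : Walk) (s : Step) : endPt (w ++ [s]) = endPt w + s.vec := by
  simp [endPt]

lemma endPt_singleton (s : Step) : endPt [s] = s.vec := by simp [endPt]

lemma endPt_replicate (k : ℕ) (s : Step) : endPt (List.replicate k s) = (k : ℤ) • s.vec := by
  simp [endPt]

lemma endPt_mem_visited (w : Walk) : endPt w ∈ visited w := ⟨_, le_rfl, pos_length w⟩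

lemma zero_mem_visited (w : Walk) : (0 : ℤ × ℤ) ∈ visited w := ⟨0, Nat.zero_le _, pos_zero w⟩

lemma visited_nil : visited [] = {0} := by
  ext p
  simp [visited, Walk.pos, eq_comm]

lemma visited_subset_append (w r : Walk) : visited w ⊆ visited (w ++ r) := by
  rintro _ ⟨j, hj, rfl⟩
  exact ⟨j, by simp; omega, pos_append_of_le w r hj⟩

lemma mem_visited_snoc {w : Walk} {s : Step} {p : ℤ × ℤ} :
    p ∈ visited (w ++ [s]) ↔ p ∈ visited w ∨ p = endPt w + s.vec := by
  constructor
  · rintro ⟨j, hj, rfl⟩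
    rcases Nat.lt_or_ge w.length j with h | h
    · right
      have : j = (w ++ [s]).length := by simp at hj ⊢; omega
      rw [this, pos_length, endPt_snoc]
    · exact Or.inl ⟨j, h, (pos_append_of_le w [s] h).symm⟩
  · rintro (h | rfl)
    · exact visited_subset_append _ _ h
    · rw [← endPt_snoc]
      exact endPt_mem_visited _

lemma mem_visited_append_replicate {w : Walk} {s : Step} {k : ℕ} {p : ℤ × ℤ} :
    p ∈ visited (w ++ List.replicate k s) ↔
      p ∈ visited w ∨ ∃ j : ℕ, 1 ≤ j ∧ j ≤ k ∧ p = endPt w + (j : ℤ) • s.vec := by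
  induction k with
  | zero => simp
  | succ k ih =>
    rw [List.replicate_succ', ← List.append_assoc, mem_visited_snoc, ih, endPt_append,
      endPt_replicate]
    constructor
    · rintro ((h | ⟨j, h1, h2, h3⟩) | h)
      · exact Or.inl h
      · exact Or.inr ⟨j, h1, by omega, h3⟩
      · refine Or.inr ⟨k + 1, by omega, le_rfl, ?_⟩
        rw [h]; push_cast; rw [add_smul, one_smul, add_assoc]
    · rintro (h | ⟨j, h1, h2, h3⟩)
      · exact Or.inl (Or.inl h)
      · rcases Nat.lt_or_ge k j with h | h
        · right
          have : j = k + 1 := by omega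
          subst this
          rw [h3]; push_cast; rw [add_smul, one_smul, add_assoc]
        · exact Or.inl (Or.inr ⟨j, h1, h, h3⟩)

/-- The endpoint lies on the north, east or west side of the bounding box. -/
def OnSide (w : Walk) : Prop :=
  (∀ p ∈ visited w, p.2 ≤ (endPt w).2) ∨ (∀ p ∈ visited w, p.1 ≤ (endPt w).1) ∨
    (∀ p ∈ visited w, (endPt w).1 ≤ p.1)

/-- The step `s` may follow the walk `w` in a 3-sided walk. -/
def TurnOK (w : Walk) (s : Step) : Prop :=
  w.getLast? = some Step.south → (∃ p ∈ visited w, ∃ p' ∈ visited w, p.1 ≠ p'.1) →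
    ((∀ p ∈ visited w, p.1 ≤ (endPt w).1) → s ≠ Step.west) ∧
    ((∀ p ∈ visited w, (endPt w).1 ≤ p.1) → s ≠ Step.east)

/-- No visited node lies ahead of the endpoint in the direction `s`. -/
def Clear (w : Walk) (s : Step) : Prop :=
  ∀ p ∈ visited w, ∀ t : ℕ, 1 ≤ t → p ≠ endPt w + (t : ℤ) • s.vec

/-- Prudent 3-sided walks. -/
def Good (w : Walk) : Prop := w.IsPrudent ∧ w.IsThreeSided

/-! ### Appending steps to prudent 3-sided walks -/

lemma clear_north {w : Walk} :
    Clear w Step.north ↔ ∀ p ∈ visited w, p.1 = (endPt w).1 → p.2 ≤ (endPt w).2 := by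
  refine forall₂_congr fun p _ => ⟨fun h h1 => ?_, fun h t ht he => ?_⟩
  · by_contra hlt
    refine h (p.2 - (endPt w).2).toNat (by omega) ?_
    ext <;> simp [Step.vec] <;> omega
  · have h1 := congrArg Prod.fst he
    have h2 := congrArg Prod.snd he
    simp [Step.vec] at h1 h2
    have := h h1
    omega

lemma clear_south {w : Walk} :
    Clear w Step.south ↔ ∀ p ∈ visited w, p.1 = (endPt w).1 → (endPt w).2 ≤ p.2 := by
  refine forall₂_congr fun p _ => ⟨fun h h1 => ?_, fun h t ht he => ?_⟩
  · by_contra hlt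
    refine h ((endPt w).2 - p.2).toNat (by omega) ?_
    ext <;> simp [Step.vec] <;> omega
  · have h1 := congrArg Prod.fst he
    have h2 := congrArg Prod.snd he
    simp [Step.vec] at h1 h2
    have := h h1
    omega

lemma clear_east {w : Walk} :
    Clear w Step.east ↔ ∀ p ∈ visited w, p.2 = (endPt w).2 → p.1 ≤ (endPt w).1 := by
  refine forall₂_congr fun p _ => ⟨fun h h1 => ?_, fun h t ht he => ?_⟩
  · by_contra hlt
    refine h (p.1 - (endPt w).1).toNat (by omega) ?_
    ext <;> simp [Step.vec] <;> omega
  · have h1 := congrArg Prod.fst he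
    have h2 := congrArg Prod.snd he
    simp [Step.vec] at h1 h2
    have := h h2
    omega

lemma clear_west {w : Walk} :
    Clear w Step.west ↔ ∀ p ∈ visited w, p.2 = (endPt w).2 → (endPt w).1 ≤ p.1 := by
  refine forall₂_congr fun p _ => ⟨fun h h1 => ?_, fun h t ht he => ?_⟩
  · by_contra hlt
    refine h ((endPt w).1 - p.1).toNat (by omega) ?_
    ext <;> simp [Step.vec] <;> omega
  · have h1 := congrArg Prod.fst he
    have h2 := congrArg Prod.snd he
    simp [Step.vec] at h1 h2
    have := h h2
    omega

lemma turnOK_of_getLast {w : Walk} {s : Step} (h : w.getLast? ≠ some Step.south) : TurnOK w s :=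
  fun h' => absurd h' h

lemma turnOK_north {w : Walk} : TurnOK w Step.north := by simp [TurnOK]

lemma turnOK_south {w : Walk} : TurnOK w Step.south := by simp [TurnOK]

/-- A walk on both the east and the west side has a box of width zero, where turns are unrestricted.
-/
lemma turnOK_east {w : Walk} (h : ∀ p ∈ visited w, p.1 ≤ (endPt w).1) : TurnOK w Step.east := by
  rintro _ ⟨p, hp, p', hp', hne⟩
  refine ⟨fun _ => by simp, fun h' => ?_⟩
  have := h p hp
  have := h p' hp'
  have := h' p hp
  have := h' p' hp'
  omega

lemma isPrudent_snoc {w : Walk} {s : Step} :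
    Walk.IsPrudent (w ++ [s]) ↔ w.IsPrudent ∧ Clear w s := by
  constructor
  · intro h
    refine ⟨fun i hi j hj t ht => ?_, ?_⟩
    · have := h i (by simp; omega) j hj t ht
      rw [pos_append_of_le w [s] hi.le, pos_append_of_le w [s] (hj.trans hi.le)] at this
      simpa [List.getElem_append_left hi] using this
    · rintro _ ⟨j, hj, rfl⟩ t ht
      have := h w.length (by simp) j hj t ht
      rw [pos_append_of_le w [s] le_rfl, pos_append_of_le w [s] hj, pos_length] at this
      simpa using this
  · rintro ⟨h, hc⟩ i hi j hj t ht
    rcases Nat.lt_or_ge i w.length with hl | hl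
    · rw [pos_append_of_le w [s] hl.le, pos_append_of_le w [s] (hj.trans hl.le)]
      simpa [List.getElem_append_left hl] using h i hl j hj t ht
    · have hil : i = w.length := by simp at hi; omega
      subst hil
      rw [pos_append_of_le w [s] le_rfl, pos_append_of_le w [s] hj, pos_length]
      simpa using hc _ ⟨j, hj, rfl⟩ t ht

lemma onNorth_append {w r : Walk} {i : ℕ} (h : i ≤ w.length) :
    Walk.OnNorth (w ++ r) i ↔ w.OnNorth i := by
  simp only [Walk.OnNorth]
  refine forall₂_congr fun j hj => ?_
  rw [pos_append_of_le w r h, pos_append_of_le w r (hj.trans h)]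

lemma onEast_append {w r : Walk} {i : ℕ} (h : i ≤ w.length) :
    Walk.OnEast (w ++ r) i ↔ w.OnEast i := by
  simp only [Walk.OnEast]
  refine forall₂_congr fun j hj => ?_
  rw [pos_append_of_le w r h, pos_append_of_le w r (hj.trans h)]

lemma onWest_append {w r : Walk} {i : ℕ} (h : i ≤ w.length) :
    Walk.OnWest (w ++ r) i ↔ w.OnWest i := by
  simp only [Walk.OnWest]
  refine forall₂_congr fun j hj => ?_
  rw [pos_append_of_le w r h, pos_append_of_le w r (hj.trans h)]

lemma wideBox_append {w r : Walk} {i : ℕ} (h : i ≤ w.length) :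
    Walk.WideBox (w ++ r) i ↔ w.WideBox i := by
  simp only [Walk.WideBox]
  refine exists_congr fun j => and_congr_right fun hj => exists_congr fun k =>
    and_congr_right fun hk => ?_
  rw [pos_append_of_le w r (hj.trans h), pos_append_of_le w r (hk.trans h)]

lemma onNorth_length {w : Walk} :
    w.OnNorth w.length ↔ ∀ p ∈ visited w, p.2 ≤ (endPt w).2 := by
  simp only [Walk.OnNorth, visited, Set.mem_ofPred_eq, pos_length]
  constructor
  · rintro h _ ⟨j, hj, rfl⟩; exact h j hj
  · intro h j hj; exact h _ ⟨j, hj, rfl⟩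

lemma onEast_length {w : Walk} :
    w.OnEast w.length ↔ ∀ p ∈ visited w, p.1 ≤ (endPt w).1 := by
  simp only [Walk.OnEast, visited, Set.mem_ofPred_eq, pos_length]
  constructor
  · rintro h _ ⟨j, hj, rfl⟩; exact h j hj
  · intro h j hj; exact h _ ⟨j, hj, rfl⟩

lemma onWest_length {w : Walk} :
    w.OnWest w.length ↔ ∀ p ∈ visited w, (endPt w).1 ≤ p.1 := by
  simp only [Walk.OnWest, visited, Set.mem_ofPred_eq, pos_length]
  constructor
  · rintro h _ ⟨j, hj, rfl⟩; exact h j hj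
  · intro h j hj; exact h _ ⟨j, hj, rfl⟩

lemma wideBox_length {w : Walk} :
    w.WideBox w.length ↔ ∃ p ∈ visited w, ∃ p' ∈ visited w, p.1 ≠ p'.1 := by
  constructor
  · rintro ⟨j, hj, k, hk, h⟩; exact ⟨_, ⟨j, hj, rfl⟩, _, ⟨k, hk, rfl⟩, h⟩
  · rintro ⟨_, ⟨j, hj, rfl⟩, _, ⟨k, hk, rfl⟩, h⟩; exact ⟨j, hj, k, hk, h⟩

lemma isThreeSided_snoc {w : Walk} {s : Step} :
    Walk.IsThreeSided (w ++ [s]) ↔ w.IsThreeSided ∧ OnSide (w ++ [s]) ∧ TurnOK w s := by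
  constructor
  · rintro ⟨h1, h2⟩
    refine ⟨⟨fun i hi => ?_, fun i hi hs hw => ?_⟩, ?_, ?_⟩
    · have := h1 i (by simp; omega)
      rwa [onNorth_append hi, onEast_append hi, onWest_append hi] at this
    · have := h2 i (by simp; omega)
      rw [wideBox_append hi.le, onEast_append hi.le, onWest_append hi.le,
        List.getElem_append_left (by omega), List.getElem_append_left (by omega)] at this
      exact this hs hw
    · have := h1 _ le_rfl
      rwa [onNorth_length, onEast_length, onWest_length] at this
    · intro hl hw
      obtain ⟨w', rfl⟩ := List.getLast?_eq_some_iff.1 hl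
      have := h2 w'.length (by simp) (by simp)
      have hle : w'.length + 1 = (w' ++ [Step.south]).length := by simp
      have hg : (w' ++ [Step.south] ++ [s])[w'.length + 1]'(by simp) = s := by simp
      rw [wideBox_append (by simp), onEast_append (by simp), onWest_append (by simp), hg, hle,
        wideBox_length, onEast_length, onWest_length] at this
      exact this hw
  · rintro ⟨⟨h1, h2⟩, h3, h4⟩
    refine ⟨fun i hi => ?_, fun i hi hs hw => ?_⟩
    · rcases Nat.lt_or_ge w.length i with hl | hl
      · have : i = (w ++ [s]).length := by simp at hi ⊢; omega
        rw [this, onNorth_length, onEast_length, onWest_length]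
        exact h3
      · rw [onNorth_append hl, onEast_append hl, onWest_append hl]
        exact h1 i hl
    · have hi' : i + 1 ≤ w.length := by simp at hi; omega
      rw [wideBox_append hi'] at hw
      rw [onEast_append hi', onWest_append hi']
      rw [List.getElem_append_left (by omega)] at hs
      rcases Nat.lt_or_ge (i + 1) w.length with hl | hl
      · rw [List.getElem_append_left hl]
        exact h2 i hl hs hw
      · have hil : i + 1 = w.length := by omega
        have hlast : w.getLast? = some Step.south := by
          rw [List.getLast?_eq_getElem?, ← hil]
          simp [List.getElem?_eq_getElem (show i < w.length by omega), hs]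
        have := h4 hlast
        rw [← wideBox_length, ← onEast_length, ← onWest_length, ← hil] at this
        simpa [hil] using this hw

lemma good_nil : Good [] := by
  refine ⟨fun i hi => by simp at hi, fun i hi => ?_, fun i hi => by simp at hi⟩
  left
  intro j _
  simp [Walk.pos]

/-- All conditions concern prefixes, so one more step adds only conditions at the end of the walk.
Every later induction on walks removes the last step in this way. -/
lemma good_snoc {w : Walk} {s : Step} :
    Good (w ++ [s]) ↔ Good w ∧ Clear w s ∧ OnSide (w ++ [s]) ∧ TurnOK w s := by
  rw [Good, isPrudent_snoc, isThreeSided_snoc, Good]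
  tauto

lemma Good.of_append {w r : Walk} (h : Good (w ++ r)) : Good w := by
  induction r using List.reverseRecOn with
  | nil => simpa using h
  | append_singleton r s ih =>
    rw [← List.append_assoc, good_snoc] at h
    exact ih h.1

lemma Good.onSide {w : Walk} (h : Good w) : OnSide w := by
  have := h.2.1 _ le_rfl
  rwa [onNorth_length, onEast_length, onWest_length] at this

/-- The next node of a prudent walk is new. -/
lemma Clear.notMem {w : Walk} {s : Step} (h : Clear w s) : endPt w + s.vec ∉ visited w := by
  intro hm
  exact h _ hm 1 le_rfl (by simp)

/-- The nodes added by a straight run lie behind its endpoint, so a clear half-line stays clear. The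
turn condition matters for the first step only: afterwards the last step is `s` itself, and a south
step is never constrained. -/
lemma good_append_replicate {w : Walk} {s : Step} {k : ℕ} (h : Good w) (hk : k ≠ 0 → Clear w s)
    (hside : ∀ j : ℕ, 1 ≤ j → j ≤ k → OnSide (w ++ List.replicate j s))
    (hturn : k ≠ 0 → TurnOK w s) : Good (w ++ List.replicate k s) := by
  induction k with
  | zero => simpa using h
  | succ k ih =>
    have hs := hside (k + 1) (by omega) le_rfl
    have hk := hk (by omega)
    have hturn := hturn (by omega)
    specialize ih (fun _ => hk) (fun j h1 h2 => hside j h1 (by omega)) (fun _ => hturn)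
    rw [List.replicate_succ', ← List.append_assoc] at hs ⊢
    refine good_snoc.2 ⟨ih, ?_, hs, ?_⟩
    · intro p hp t ht
      rw [endPt_append, endPt_replicate]
      rcases mem_visited_append_replicate.1 hp with hp | ⟨j, h1, h2, rfl⟩
      · have := hk p hp (k + t) (by omega)
        push_cast at this
        rwa [add_smul, ← add_assoc] at this
      · intro he
        rw [add_assoc, ← add_smul] at he
        have he := add_left_cancel he
        have h1 := congrArg Prod.fst he
        have h2 := congrArg Prod.snd he
        cases s <;> simp [Step.vec] at h1 h2 <;> omega
    · rcases Nat.eq_zero_or_pos k with rfl | hpos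
      · simpa using hturn
      · obtain ⟨k, rfl⟩ := Nat.exists_eq_add_of_le' hpos
        intro hl
        rw [List.replicate_succ', ← List.append_assoc, List.getLast?_append] at hl
        simp at hl
        subst hl
        simp

/-! ### Codes for prudent walks in the right half-plane -/

/-- Codes for the 3-sided prudent walks in the half-plane `x ≥ 0` that end with a step enlarging
the bounding box. The codes `row` and `up` end with a north step to a new row, the codes `ext`
and `col` with an east step to a new column. -/
inductive Code
  | start
  | row (p : Code) (x : ℕ)
  | up (p : Code)
  | ext (p : Code)
  | col (p : Code) (c : ℕ)

namespace Code

/-- The width of the bounding box. -/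
def width : Code → ℕ
  | start => 0
  | row p _ => p.width
  | up p => p.width
  | ext p => p.width + 1
  | col p _ => p.width + 1

/-- The abscissa of the endpoint. -/
def xpos : Code → ℕ
  | start => 0
  | row _ x => x
  | up p => p.width
  | ext p => p.width + 1
  | col p _ => p.width + 1

/-- The ordinate of the north side of the bounding box. -/
def height : Code → ℕ
  | start => 0
  | row p _ => p.height + 1
  | up p => p.height + 1
  | ext p => p.height
  | col p _ => p.height

/-- The distance of the endpoint to the north side of the bounding box. -/
def depth : Code → ℕ
  | start => 0
  | row _ _ => 0
  | up _ => 0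
  | ext _ => 0
  | col _ c => c

/-- The area between the walk, the line `x = -1` and the north side of the bounding box. -/
def acc : Code → ℕ
  | start => 0
  | row p x => p.acc + x + 1
  | up p => p.acc + p.width + 1
  | ext p => p.acc
  | col p c => p.acc + c

/-- The code ends with a north step to a new row. -/
def IsRow : Code → Prop
  | start => False
  | row _ _ => True
  | up _ => True
  | ext _ => False
  | col _ _ => False

/-- Well-formed codes. -/
def Valid : Code → Prop
  | start => True
  | row p x => p.Valid ∧ p.IsRow ∧ x ≤ p.width
  | up p => p.Valid ∧ ¬ p.IsRow
  | ext p => p.Valid ∧ p.IsRow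
  | col p _ => p.Valid ∧ ¬ p.IsRow

/-- The walk described by a code. -/
def word : Code → Walk
  | start => []
  | row p x => p.word ++ List.replicate (p.xpos - x) Step.west ++
      List.replicate (x - p.xpos) Step.east ++ [Step.north]
  | up p => p.word ++ List.replicate (p.depth + 1) Step.north
  | ext p => p.word ++ List.replicate (p.width - p.xpos + 1) Step.east
  | col p c => p.word ++ List.replicate (p.depth - c) Step.north ++
      List.replicate (c - p.depth) Step.south ++ [Step.east]

lemma xpos_le_width {p : Code} (h : p.Valid) : p.xpos ≤ p.width := by
  cases p <;> simp_all [xpos, width, Valid]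

lemma xpos_eq_width {p : Code} (h : ¬ p.IsRow) : p.xpos = p.width := by
  cases p <;> simp_all [xpos, width, IsRow]

lemma depth_eq_zero {p : Code} (h : p.IsRow) : p.depth = 0 := by
  cases p <;> simp_all [depth, IsRow]

lemma height_pos {p : Code} (h : p.IsRow) : 0 < p.height := by
  cases p <;> simp_all [height, IsRow]

lemma endPt_word {p : Code} (h : p.Valid) :
    endPt p.word = ((p.xpos : ℤ), (p.height : ℤ) - p.depth) := by
  induction p with
  | start => rfl
  | row p x ih =>
    have hd := depth_eq_zero h.2.1
    have hx : (row p x).xpos = x := rfl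
    have hd' : (row p x).depth = 0 := rfl
    simp only [word, endPt_singleton, endPt_append, endPt_replicate, ih h.1, Step.vec, height, hx, hd',
      hd]
    ext <;> simp
    omega
  | up p ih =>
    have hx : (up p).xpos = p.width := rfl
    have hd' : (up p).depth = 0 := rfl
    simp only [word, endPt_append, endPt_replicate, ih h.1, Step.vec, height, hx, hd',
      xpos_eq_width h.2]
    ext <;> simp
    omega
  | ext p ih =>
    have hd := depth_eq_zero h.2
    have hx : (ext p).xpos = p.width + 1 := rfl
    have hd' : (ext p).depth = 0 := rfl
    have := xpos_le_width h.1
    simp only [word, endPt_append, endPt_replicate, ih h.1, Step.vec, height, hx, hd', hd]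
    ext <;> simp
    omega
  | col p c ih =>
    have hx : (col p c).xpos = p.width + 1 := rfl
    have hd' : (col p c).depth = c := rfl
    simp only [word, endPt_singleton, endPt_append, endPt_replicate, ih h.1, Step.vec, height, hx, hd',
      xpos_eq_width h.2]
    ext <;> simp
    omega

lemma getLast_word_of_isRow {p : Code} (h : p.IsRow) : p.word.getLast? = some Step.north := by
  cases p <;> simp_all [word, IsRow, List.replicate_succ', ← List.append_assoc]

lemma getLast_word_ne {p : Code} : p.word.getLast? ≠ some Step.south := by
  cases p <;> simp [word, List.replicate_succ', ← List.append_assoc]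

/-- Where the walk described by a code has been. -/
structure Inv (p : Code) : Prop where
  bounds : ∀ v ∈ visited p.word, 0 ≤ v.1 ∧ v.1 ≤ p.width ∧ v.2 ≤ p.height
  row_only : p.IsRow → ∀ v ∈ visited p.word, v.2 = p.height → v.1 = p.xpos
  row_wit : p.IsRow → ∃ v ∈ visited p.word, v.1 = p.width ∧ v.2 < p.height
  col_only : ¬ p.IsRow → ∀ v ∈ visited p.word, v.1 = p.width → v.2 = p.height - p.depth
  col_wit : ¬ p.IsRow → 0 < p.width → ∀ b : ℤ, (p.height : ℤ) - p.depth ≤ b → b ≤ p.height →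
    ∃ v ∈ visited p.word, v.2 = b ∧ v.1 < p.width

/-! ### The nodes visited by a coded walk -/

lemma inv_start : Inv start := by
  constructor <;> simp [word, visited_nil, width, height, depth, IsRow]

lemma mem_visited_row {p : Code} (h : p.Valid) (hr : p.IsRow) {x : ℕ} {v : ℤ × ℤ} :
    v ∈ visited (row p x).word ↔ v ∈ visited p.word ∨
      (v.2 = p.height ∧ ((x : ℤ) ≤ v.1 ∧ v.1 < p.xpos ∨ (p.xpos : ℤ) < v.1 ∧ v.1 ≤ x)) ∨
      v = ((x : ℤ), (p.height : ℤ) + 1) := by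
  have hd := depth_eq_zero hr
  have he := endPt_word h
  simp only [word, mem_visited_snoc, mem_visited_append_replicate, endPt_append, endPt_replicate,
    he, hd, Step.vec, Prod.ext_iff]
  simp only [Prod.fst_add, Prod.snd_add, Prod.smul_mk, smul_eq_mul]
  constructor
  · rintro ((( h | ⟨j, h1, h2, h3, h4⟩) | ⟨j, h1, h2, h3, h4⟩) | ⟨h3, h4⟩)
    · exact Or.inl h
    · right; left; omega
    · right; left; omega
    · right; right; omega
  · rintro (h | ⟨h1, ⟨h2, h3⟩ | ⟨h2, h3⟩⟩ | ⟨h1, h2⟩)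
    · exact Or.inl (Or.inl (Or.inl h))
    · refine Or.inl (Or.inl (Or.inr ⟨(p.xpos - v.1).toNat, ?_, ?_, ?_, ?_⟩)) <;> omega
    · refine Or.inl (Or.inr ⟨(v.1 - p.xpos).toNat, ?_, ?_, ?_, ?_⟩) <;> omega
    · refine Or.inr ⟨?_, ?_⟩ <;> omega

lemma mem_visited_up {p : Code} (h : p.Valid) (hr : ¬ p.IsRow) {v : ℤ × ℤ} :
    v ∈ visited (up p).word ↔ v ∈ visited p.word ∨
      (v.1 = p.width ∧ (p.height : ℤ) - p.depth < v.2 ∧ v.2 ≤ p.height + 1) := by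
  have hd := xpos_eq_width hr
  have he := endPt_word h
  simp only [word, mem_visited_append_replicate, he, hd, Step.vec, Prod.ext_iff]
  simp only [Prod.fst_add, Prod.snd_add, Prod.smul_mk, smul_eq_mul]
  refine or_congr_right ⟨?_, ?_⟩
  · rintro ⟨j, h1, h2, h3, h4⟩; omega
  · rintro ⟨h1, h2, h3⟩
    refine ⟨(v.2 - (p.height - p.depth)).toNat, ?_, ?_, ?_, ?_⟩ <;> omega

lemma mem_visited_ext {p : Code} (h : p.Valid) (hr : p.IsRow) {v : ℤ × ℤ} :
    v ∈ visited (ext p).word ↔ v ∈ visited p.word ∨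
      (v.2 = p.height ∧ (p.xpos : ℤ) < v.1 ∧ v.1 ≤ p.width + 1) := by
  have hd := depth_eq_zero hr
  have hx := xpos_le_width h
  have he := endPt_word h
  simp only [word, mem_visited_append_replicate, he, hd, Step.vec, Prod.ext_iff]
  simp only [Prod.fst_add, Prod.snd_add, Prod.smul_mk, smul_eq_mul]
  refine or_congr_right ⟨?_, ?_⟩
  · rintro ⟨j, h1, h2, h3, h4⟩; omega
  · rintro ⟨h1, h2, h3⟩
    refine ⟨(v.1 - p.xpos).toNat, ?_, ?_, ?_, ?_⟩ <;> omega

lemma mem_visited_col {p : Code} (h : p.Valid) (hr : ¬ p.IsRow) {c : ℕ} {v : ℤ × ℤ} :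
    v ∈ visited (col p c).word ↔ v ∈ visited p.word ∨
      (v.1 = p.width ∧ ((p.height : ℤ) - p.depth < v.2 ∧ v.2 ≤ p.height - c ∨
        (p.height : ℤ) - c ≤ v.2 ∧ v.2 < p.height - p.depth)) ∨
      v = ((p.width : ℤ) + 1, (p.height : ℤ) - c) := by
  have hd := xpos_eq_width hr
  have he := endPt_word h
  simp only [word, mem_visited_snoc, mem_visited_append_replicate, endPt_append, endPt_replicate,
    he, hd, Step.vec, Prod.ext_iff]
  simp only [Prod.fst_add, Prod.snd_add, Prod.smul_mk, smul_eq_mul]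
  constructor
  · rintro ((( h | ⟨j, h1, h2, h3, h4⟩) | ⟨j, h1, h2, h3, h4⟩) | ⟨h3, h4⟩)
    · exact Or.inl h
    · right; left; omega
    · right; left; omega
    · right; right; omega
  · rintro (h | ⟨h1, ⟨h2, h3⟩ | ⟨h2, h3⟩⟩ | ⟨h1, h2⟩)
    · exact Or.inl (Or.inl (Or.inl h))
    · refine Or.inl (Or.inl (Or.inr ⟨(v.2 - (p.height - p.depth)).toNat, ?_, ?_, ?_, ?_⟩)) <;> omega
    · refine Or.inl (Or.inr ⟨(p.height - p.depth - v.2).toNat, ?_, ?_, ?_, ?_⟩) <;> omega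
    · refine Or.inr ⟨?_, ?_⟩ <;> omega

lemma inv_row {p : Code} {x : ℕ} (h : (row p x).Valid) (hi : Inv p) : Inv (row p x) := by
  obtain ⟨h, hr, hx⟩ := h
  have hx' := xpos_le_width h
  constructor
  · intro v hv
    have := hi.bounds v
    simp only [width, height]
    rcases (mem_visited_row h hr).1 hv with hv | hv | rfl
    · have := this hv; omega
    · omega
    · simp; omega
  · intro _ v hv hv2
    have := hi.bounds v
    simp only [height, xpos] at *
    rcases (mem_visited_row h hr).1 hv with hv | hv | rfl
    · have := this hv; omega
    · omega
    · rfl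
  · intro _
    obtain ⟨v, hv, h1, h2⟩ := hi.row_wit hr
    exact ⟨v, (mem_visited_row h hr).2 (Or.inl hv), h1, by simp [height]; omega⟩
  · simp [IsRow]
  · simp [IsRow]

lemma inv_up {p : Code} (h : (up p).Valid) (hi : Inv p) : Inv (up p) := by
  obtain ⟨h, hr⟩ := h
  constructor
  · intro v hv
    have := hi.bounds v
    simp only [width, height]
    rcases (mem_visited_up h hr).1 hv with hv | hv
    · have := this hv; omega
    · omega
  · intro _ v hv hv2
    have := hi.bounds v
    simp only [height, xpos] at *
    rcases (mem_visited_up h hr).1 hv with hv | hv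
    · have := this hv; omega
    · omega
  · intro _
    refine ⟨((p.width : ℤ), (p.height : ℤ)), (mem_visited_up h hr).2 ?_, rfl, by simp [height]⟩
    by_cases hd : p.depth = 0
    · left
      have := endPt_mem_visited p.word
      rwa [endPt_word h, hd, xpos_eq_width hr, Nat.cast_zero, sub_zero] at this
    · right; simp; omega
  · simp [IsRow]
  · simp [IsRow]

lemma inv_ext {p : Code} (h : (ext p).Valid) (hi : Inv p) : Inv (ext p) := by
  obtain ⟨h, hr⟩ := h
  have hx' := xpos_le_width h
  constructor
  · intro v hv
    have := hi.bounds v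
    simp only [width, height]
    rcases (mem_visited_ext h hr).1 hv with hv | hv
    · have := this hv; omega
    · omega
  · simp [IsRow]
  · simp [IsRow]
  · intro _ v hv hv2
    have := hi.bounds v
    simp only [width, height, depth] at *
    rcases (mem_visited_ext h hr).1 hv with hv | hv
    · have := this hv; omega
    · omega
  · intro _ _ b hb1 hb2
    simp only [width, height, depth] at *
    refine ⟨endPt p.word, (mem_visited_ext h hr).2 (Or.inl (endPt_mem_visited _)), ?_⟩
    rw [endPt_word h, depth_eq_zero hr]
    simp; omega

lemma inv_col {p : Code} {c : ℕ} (h : (col p c).Valid) (hi : Inv p) : Inv (col p c) := by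
  obtain ⟨h, hr⟩ := h
  constructor
  · intro v hv
    have := hi.bounds v
    simp only [width, height]
    rcases (mem_visited_col h hr).1 hv with hv | hv | rfl
    · have := this hv; omega
    · omega
    · simp; omega
  · simp [IsRow]
  · simp [IsRow]
  · intro _ v hv hv2
    have := hi.bounds v
    simp only [width, height, depth] at *
    rcases (mem_visited_col h hr).1 hv with hv | hv | rfl
    · have := this hv; omega
    · omega
    · rfl
  · intro _ _ b hb1 hb2
    simp only [width, height, depth] at *
    by_cases hb : (p.height : ℤ) - p.depth ≤ b
    -- In width zero the induction hypothesis provides no witness. There `p` is `start`, the only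
    -- level to serve is 0, and the endpoint of `p` serves it.
    · by_cases hw : p.width = 0
      · have hmem := endPt_mem_visited p.word
        rw [endPt_word h, xpos_eq_width hr] at hmem
        by_cases hb' : b = (p.height : ℤ) - p.depth
        · exact ⟨_, (mem_visited_col h hr).2 (Or.inl hmem), hb'.symm, by simp⟩
        · have hz := hi.col_only hr 0 (zero_mem_visited _) (by simp [hw])
          have hh : p.height = 0 ∧ p.depth = 0 := by
            clear hb hb' hb1 hb2 hmem
            cases p with
            | start => simp [height, depth]
            | row p x => simp [IsRow] at hr
            | up p => simp [IsRow] at hr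
            | ext p => simp [width] at hw
            | col p c => simp [width] at hw
          omega
      · obtain ⟨v, hv, h1, h2⟩ := hi.col_wit hr (by omega) b hb hb2
        exact ⟨v, (mem_visited_col h hr).2 (Or.inl hv), h1, by push_cast; omega⟩
    · refine ⟨((p.width : ℤ), b), (mem_visited_col h hr).2 (Or.inr (Or.inl ?_)), rfl, by simp⟩
      simp; omega

/-- The "only" fields say that the current row or column is fresh, which permits sliding along it.
The "wit" fields supply obstacles: `row_wit` blocks going down along the east side, and `col_wit`
blocks every step west from the east column at the levels between the endpoint and the north side.
-/
lemma Valid.inv {p : Code} (h : p.Valid) : Inv p := by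
  induction p with
  | start => exact inv_start
  | row p x ih => exact inv_row h (ih h.1)
  | up p ih => exact inv_up h (ih h.1)
  | ext p ih => exact inv_ext h (ih h.1)
  | col p c ih => exact inv_col h (ih h.1)

/-! ### Coded walks with a straight tail -/

lemma endPt_word_west {p : Code} (h : p.Valid) (hr : p.IsRow) (k : ℕ) :
    endPt (p.word ++ List.replicate k Step.west) = ((p.xpos : ℤ) - k, (p.height : ℤ)) := by
  rw [endPt_append, endPt_word h, endPt_replicate, depth_eq_zero hr]
  ext <;> simp [Step.vec]; omega

lemma endPt_word_east {p : Code} (h : p.Valid) (hr : p.IsRow) (k : ℕ) :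
    endPt (p.word ++ List.replicate k Step.east) = ((p.xpos : ℤ) + k, (p.height : ℤ)) := by
  rw [endPt_append, endPt_word h, endPt_replicate, depth_eq_zero hr]
  ext <;> simp [Step.vec]

lemma endPt_word_south {p : Code} (h : p.Valid) (hr : ¬ p.IsRow) (k : ℕ) :
    endPt (p.word ++ List.replicate k Step.south) =
      ((p.width : ℤ), (p.height : ℤ) - p.depth - k) := by
  rw [endPt_append, endPt_word h, endPt_replicate, xpos_eq_width hr]
  ext <;> simp [Step.vec]; omega

lemma endPt_word_north {p : Code} (h : p.Valid) (hr : ¬ p.IsRow) (k : ℕ) :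
    endPt (p.word ++ List.replicate k Step.north) =
      ((p.width : ℤ), (p.height : ℤ) - p.depth + k) := by
  rw [endPt_append, endPt_word h, endPt_replicate, xpos_eq_width hr]
  ext <;> simp [Step.vec]

lemma mem_visited_west {p : Code} (h : p.Valid) (hr : p.IsRow) {k : ℕ} {v : ℤ × ℤ} :
    v ∈ visited (p.word ++ List.replicate k Step.west) ↔ v ∈ visited p.word ∨
      v.2 = p.height ∧ (p.xpos : ℤ) - k ≤ v.1 ∧ v.1 < p.xpos := by
  rw [mem_visited_append_replicate, endPt_word h, depth_eq_zero hr]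
  simp only [Step.vec, Prod.ext_iff, Prod.fst_add, Prod.snd_add, Prod.smul_mk, smul_eq_mul]
  refine or_congr_right ⟨?_, ?_⟩
  · rintro ⟨j, h1, h2, h3, h4⟩; omega
  · rintro ⟨h1, h2, h3⟩
    refine ⟨(p.xpos - v.1).toNat, ?_, ?_, ?_, ?_⟩ <;> omega

lemma mem_visited_east {p : Code} (h : p.Valid) (hr : p.IsRow) {k : ℕ} {v : ℤ × ℤ} :
    v ∈ visited (p.word ++ List.replicate k Step.east) ↔ v ∈ visited p.word ∨
      v.2 = p.height ∧ (p.xpos : ℤ) < v.1 ∧ v.1 ≤ p.xpos + k := by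
  rw [mem_visited_append_replicate, endPt_word h, depth_eq_zero hr]
  simp only [Step.vec, Prod.ext_iff, Prod.fst_add, Prod.snd_add, Prod.smul_mk, smul_eq_mul]
  refine or_congr_right ⟨?_, ?_⟩
  · rintro ⟨j, h1, h2, h3, h4⟩; omega
  · rintro ⟨h1, h2, h3⟩
    refine ⟨(v.1 - p.xpos).toNat, ?_, ?_, ?_, ?_⟩ <;> omega

lemma mem_visited_south {p : Code} (h : p.Valid) (hr : ¬ p.IsRow) {k : ℕ} {v : ℤ × ℤ} :
    v ∈ visited (p.word ++ List.replicate k Step.south) ↔ v ∈ visited p.word ∨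
      v.1 = p.width ∧ (p.height : ℤ) - p.depth - k ≤ v.2 ∧ v.2 < p.height - p.depth := by
  rw [mem_visited_append_replicate, endPt_word h, xpos_eq_width hr]
  simp only [Step.vec, Prod.ext_iff, Prod.fst_add, Prod.snd_add, Prod.smul_mk, smul_eq_mul]
  refine or_congr_right ⟨?_, ?_⟩
  · rintro ⟨j, h1, h2, h3, h4⟩; omega
  · rintro ⟨h1, h2, h3⟩
    refine ⟨(p.height - p.depth - v.2).toNat, ?_, ?_, ?_, ?_⟩ <;> omega

lemma mem_visited_north {p : Code} (h : p.Valid) (hr : ¬ p.IsRow) {k : ℕ} {v : ℤ × ℤ} :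
    v ∈ visited (p.word ++ List.replicate k Step.north) ↔ v ∈ visited p.word ∨
      v.1 = p.width ∧ (p.height : ℤ) - p.depth < v.2 ∧ v.2 ≤ p.height - p.depth + k := by
  rw [mem_visited_append_replicate, endPt_word h, xpos_eq_width hr]
  simp only [Step.vec, Prod.ext_iff, Prod.fst_add, Prod.snd_add, Prod.smul_mk, smul_eq_mul]
  refine or_congr_right ⟨?_, ?_⟩
  · rintro ⟨j, h1, h2, h3, h4⟩; omega
  · rintro ⟨h1, h2, h3⟩
    refine ⟨(v.2 - (p.height - p.depth)).toNat, ?_, ?_, ?_, ?_⟩ <;> omega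

/-! ### Codes describe prudent 3-sided walks -/

lemma good_word_west {p : Code} (h : p.Valid) (hr : p.IsRow) (hg : Good p.word) (k : ℕ) :
    Good (p.word ++ List.replicate k Step.west) := by
  refine good_append_replicate hg (fun _ => clear_west.2 fun v hv hv2 => ?_) (fun j _ _ => Or.inl ?_)
    (fun _ => turnOK_of_getLast getLast_word_ne)
  · rw [endPt_word h, depth_eq_zero hr] at *
    have := h.inv.row_only hr v hv (by simpa using hv2)
    simp [this]
  · intro v hv
    rw [endPt_word_west h hr]
    rcases (mem_visited_west h hr).1 hv with hv | hv
    · exact (h.inv.bounds v hv).2.2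
    · exact hv.1.le

lemma good_word_east {p : Code} (h : p.Valid) (hr : p.IsRow) (hg : Good p.word) (k : ℕ) :
    Good (p.word ++ List.replicate k Step.east) := by
  refine good_append_replicate hg (fun _ => clear_east.2 fun v hv hv2 => ?_) (fun j _ _ => Or.inl ?_)
    (fun _ => turnOK_of_getLast getLast_word_ne)
  · rw [endPt_word h, depth_eq_zero hr] at *
    have := h.inv.row_only hr v hv (by simpa using hv2)
    simp [this]
  · intro v hv
    rw [endPt_word_east h hr]
    rcases (mem_visited_east h hr).1 hv with hv | hv
    · exact (h.inv.bounds v hv).2.2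
    · exact hv.1.le

lemma le_endPt_south {p : Code} (h : p.Valid) (hr : ¬ p.IsRow) (k : ℕ) :
    ∀ v ∈ visited (p.word ++ List.replicate k Step.south),
      v.1 ≤ (endPt (p.word ++ List.replicate k Step.south)).1 := by
  intro v hv
  rw [endPt_word_south h hr]
  rcases (mem_visited_south h hr).1 hv with hv | hv
  · exact (h.inv.bounds v hv).2.1
  · exact hv.1.le

lemma le_endPt_north {p : Code} (h : p.Valid) (hr : ¬ p.IsRow) (k : ℕ) :
    ∀ v ∈ visited (p.word ++ List.replicate k Step.north),
      v.1 ≤ (endPt (p.word ++ List.replicate k Step.north)).1 := by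
  intro v hv
  rw [endPt_word_north h hr]
  rcases (mem_visited_north h hr).1 hv with hv | hv
  · exact (h.inv.bounds v hv).2.1
  · exact hv.1.le

lemma good_word_south {p : Code} (h : p.Valid) (hr : ¬ p.IsRow) (hg : Good p.word) (k : ℕ) :
    Good (p.word ++ List.replicate k Step.south) := by
  refine good_append_replicate hg (fun _ => clear_south.2 fun v hv hv2 => ?_)
    (fun j _ _ => Or.inr (Or.inl (le_endPt_south h hr j))) (fun _ => turnOK_south)
  rw [endPt_word h, xpos_eq_width hr] at *
  exact (h.inv.col_only hr v hv hv2).ge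

lemma good_word_north {p : Code} (h : p.Valid) (hr : ¬ p.IsRow) (hg : Good p.word) (k : ℕ) :
    Good (p.word ++ List.replicate k Step.north) := by
  refine good_append_replicate hg (fun _ => clear_north.2 fun v hv hv2 => ?_)
    (fun j _ _ => Or.inr (Or.inl (le_endPt_north h hr j))) (fun _ => turnOK_north)
  rw [endPt_word h, xpos_eq_width hr] at *
  exact (h.inv.col_only hr v hv hv2).le

end Code

lemma good_snoc_north {w : Walk} (h : Good w) (hn : ∀ p ∈ visited w, p.2 ≤ (endPt w).2) :
    Good (w ++ [Step.north]) := by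
  refine good_snoc.2 ⟨h, clear_north.2 fun v hv _ => hn v hv, Or.inl fun v hv => ?_, turnOK_north⟩
  rw [endPt_snoc]
  rcases mem_visited_snoc.1 hv with hv | rfl
  · have := hn v hv
    simp [Step.vec]; omega
  · exact le_rfl

lemma good_snoc_east {w : Walk} (h : Good w) (hn : ∀ p ∈ visited w, p.1 ≤ (endPt w).1) :
    Good (w ++ [Step.east]) := by
  refine good_snoc.2 ⟨h, clear_east.2 fun v hv _ => hn v hv, Or.inr (Or.inl fun v hv => ?_),
    turnOK_east hn⟩
  rw [endPt_snoc]
  rcases mem_visited_snoc.1 hv with hv | rfl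
  · have := hn v hv
    simp [Step.vec]; omega
  · exact le_rfl

namespace Code

lemma word_row_of_le {p : Code} {x : ℕ} (h : x ≤ p.xpos) :
    (row p x).word = p.word ++ List.replicate (p.xpos - x) Step.west ++ [Step.north] := by
  simp [word, Nat.sub_eq_zero_of_le h]

lemma word_row_of_ge {p : Code} {x : ℕ} (h : p.xpos ≤ x) :
    (row p x).word = p.word ++ List.replicate (x - p.xpos) Step.east ++ [Step.north] := by
  simp [word, Nat.sub_eq_zero_of_le h]

lemma word_col_of_le {p : Code} {c : ℕ} (h : c ≤ p.depth) :
    (col p c).word = p.word ++ List.replicate (p.depth - c) Step.north ++ [Step.east] := by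
  simp [word, Nat.sub_eq_zero_of_le h]

lemma word_col_of_ge {p : Code} {c : ℕ} (h : p.depth ≤ c) :
    (col p c).word = p.word ++ List.replicate (c - p.depth) Step.south ++ [Step.east] := by
  simp [word, Nat.sub_eq_zero_of_le h]

lemma good_word {p : Code} (h : p.Valid) : Good p.word := by
  induction p with
  | start => exact good_nil
  | row p x ih =>
    obtain ⟨h, hr, hx⟩ := h
    rcases le_total x p.xpos with hle | hle
    · rw [word_row_of_le hle]
      refine good_snoc_north (good_word_west h hr (ih h) _) fun v hv => ?_
      rw [endPt_word_west h hr]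
      rcases (mem_visited_west h hr).1 hv with hv | hv
      · exact (h.inv.bounds v hv).2.2
      · exact hv.1.le
    · rw [word_row_of_ge hle]
      refine good_snoc_north (good_word_east h hr (ih h) _) fun v hv => ?_
      rw [endPt_word_east h hr]
      rcases (mem_visited_east h hr).1 hv with hv | hv
      · exact (h.inv.bounds v hv).2.2
      · exact hv.1.le
  | up p ih => exact good_word_north h.1 h.2 (ih h.1) _
  | ext p ih => exact good_word_east h.1 h.2 (ih h.1) _
  | col p c ih =>
    obtain ⟨h, hr⟩ := h
    rcases le_total c p.depth with hle | hle
    · rw [word_col_of_le hle]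
      exact good_snoc_east (good_word_north h hr (ih h) _) (le_endPt_north h hr _)
    · rw [word_col_of_ge hle]
      exact good_snoc_east (good_word_south h hr (ih h) _) (le_endPt_south h hr _)

/-! ### Every prudent 3-sided walk in the right half-plane has a code -/

/-- The walk consists of the walk of a valid code and a straight tail. -/
def Coded (w : Walk) : Prop :=
  ∃ p : Code, p.Valid ∧ ∃ k : ℕ,
    (p.IsRow ∧ ((k ≤ p.xpos ∧ w = p.word ++ List.replicate k Step.west) ∨
      (p.xpos + k ≤ p.width ∧ w = p.word ++ List.replicate k Step.east))) ∨
    (¬ p.IsRow ∧ (w = p.word ++ List.replicate k Step.south ∨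
      (k ≤ p.depth ∧ w = p.word ++ List.replicate k Step.north)))

lemma coded_word {p : Code} (h : p.Valid) : Coded p.word := by
  by_cases hr : p.IsRow
  · exact ⟨p, h, 0, Or.inl ⟨hr, Or.inl ⟨Nat.zero_le _, by simp⟩⟩⟩
  · exact ⟨p, h, 0, Or.inr ⟨hr, Or.inl (by simp)⟩⟩

/-- The last step of a row code is north. The node below the endpoint therefore blocks an immediate
step south. -/
lemma below_mem_visited {p : Code} (h : p.Valid) (hr : p.IsRow) :
    ((p.xpos : ℤ), (p.height : ℤ) - 1) ∈ visited p.word := by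
  obtain ⟨w, hw⟩ := List.getLast?_eq_some_iff.1 (getLast_word_of_isRow hr)
  have he := endPt_word h
  rw [hw, endPt_snoc, depth_eq_zero hr] at he
  rw [hw]
  refine visited_subset_append _ _ ?_
  have hm := endPt_mem_visited w
  have h1 := congrArg Prod.fst he
  have h2 := congrArg Prod.snd he
  simp [Step.vec] at h1 h2
  have : endPt w = ((p.xpos : ℤ), (p.height : ℤ) - 1) := by ext <;> simp <;> omega
  rwa [this] at hm

lemma Coded.snoc_west_tail {p : Code} (h : p.Valid) (hr : p.IsRow) {k : ℕ} (hk : k ≤ p.xpos)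
    {s : Step} (hg : Good (p.word ++ List.replicate k Step.west ++ [s]))
    (hx : 0 ≤ (endPt (p.word ++ List.replicate k Step.west ++ [s])).1) :
    Coded (p.word ++ List.replicate k Step.west ++ [s]) := by
  obtain ⟨-, hc, hs, -⟩ := good_snoc.1 hg
  have he := endPt_word_west h hr k
  have hxw := xpos_le_width h
  cases s with
  | north =>
    have : (row p (p.xpos - k)).word = p.word ++ List.replicate k Step.west ++ [Step.north] := by
      rw [word_row_of_le (Nat.sub_le _ _), Nat.sub_sub_self hk]
    rw [← this]
    exact coded_word ⟨h, hr, by omega⟩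
  | west =>
    rw [endPt_snoc, he] at hx
    simp [Step.vec] at hx
    refine ⟨p, h, k + 1, Or.inl ⟨hr, Or.inl ⟨by omega, ?_⟩⟩⟩
    simp [List.replicate_succ']
  | east =>
    rcases Nat.eq_zero_or_pos k with rfl | hpos
    · by_cases hw : p.xpos < p.width
      · exact ⟨p, h, 1, Or.inl ⟨hr, Or.inr ⟨by omega, by simp⟩⟩⟩
      · have : (ext p).word = p.word ++ [Step.east] := by
          simp [word, Nat.sub_eq_zero_of_le (not_lt.1 hw)]
        simp only [List.replicate_zero, List.append_nil, ← this]
        exact coded_word ⟨h, hr⟩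
    · exfalso
      have := clear_east.1 hc ((p.xpos : ℤ), (p.height : ℤ)) (visited_subset_append _ _ (by
        have := endPt_mem_visited p.word
        rwa [endPt_word h, depth_eq_zero hr, Nat.cast_zero, sub_zero] at this)) (by simp [he])
      simp [he] at this
      omega
  -- With an empty tail the node just below is occupied. Otherwise the new endpoint is neither on
  -- the north side nor, by `row_wit`, on the east side; it is on the west side only at `x = 0`, and
  -- there the origin lies below.
  | south =>
    exfalso
    simp only [clear_south, he] at hc
    simp only [OnSide, endPt_snoc, he, Step.vec] at hs
    rcases Nat.eq_zero_or_pos k with rfl | hpos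
    · have := hc _ (visited_subset_append _ _ (below_mem_visited h hr)) (by simp)
      simp at this
    · have hsub : visited p.word ⊆
          visited (p.word ++ List.replicate k Step.west ++ [Step.south]) :=
        (visited_subset_append _ _).trans (visited_subset_append _ _)
      have hen := endPt_mem_visited p.word
      rw [endPt_word h, depth_eq_zero hr] at hen
      obtain ⟨v, hv, hv1, -⟩ := h.inv.row_wit hr
      have hpos := height_pos hr
      rcases hs with hs | hs | hs
      · have := hs _ (hsub hen)
        simp at this
      · have := hs _ (hsub hv)
        simp at this
        omega
      · have := hs _ (hsub (zero_mem_visited _))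
        simp at this
        have := hc 0 (zero_mem_visited _) (by simp; omega)
        simp at this
        omega

/-- With a non-empty tail, a step south could only end on the east side of the box, where the node
from `row_wit` lies straight below. -/
lemma Coded.snoc_east_tail {p : Code} (h : p.Valid) (hr : p.IsRow) {k : ℕ}
    (hk : p.xpos + k ≤ p.width) {s : Step}
    (hg : Good (p.word ++ List.replicate k Step.east ++ [s]))
    (hx : 0 ≤ (endPt (p.word ++ List.replicate k Step.east ++ [s])).1) :
    Coded (p.word ++ List.replicate k Step.east ++ [s]) := by
  rcases Nat.eq_zero_or_pos k with rfl | hpos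
  · exact Coded.snoc_west_tail (k := 0) h hr (Nat.zero_le _) hg hx
  obtain ⟨-, hc, hs, -⟩ := good_snoc.1 hg
  have he := endPt_word_east h hr k
  have hen := endPt_mem_visited p.word
  rw [endPt_word h, depth_eq_zero hr] at hen
  cases s with
  | north =>
    have : (row p (p.xpos + k)).word = p.word ++ List.replicate k Step.east ++ [Step.north] := by
      rw [word_row_of_ge (Nat.le_add_right _ _), Nat.add_sub_cancel_left]
    rw [← this]
    exact coded_word ⟨h, hr, hk⟩
  | east =>
    by_cases hw : p.xpos + k < p.width
    · exact ⟨p, h, k + 1, Or.inl ⟨hr, Or.inr ⟨by omega, by simp [List.replicate_succ']⟩⟩⟩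
    · have : (ext p).word = p.word ++ List.replicate k Step.east ++ [Step.east] := by
        have : p.width - p.xpos + 1 = k + 1 := by omega
        simp [word, this, List.replicate_succ']
      rw [← this]
      exact coded_word ⟨h, hr⟩
  | west =>
    exfalso
    have := clear_west.1 hc _ (visited_subset_append _ _ hen) (by simp [he])
    simp [he] at this
    omega
  | south =>
    exfalso
    simp only [clear_south, he] at hc
    simp only [OnSide, endPt_snoc, he, Step.vec] at hs
    have hsub : visited p.word ⊆
        visited (p.word ++ List.replicate k Step.east ++ [Step.south]) :=
      (visited_subset_append _ _).trans (visited_subset_append _ _)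
    obtain ⟨v, hv, hv1, hv2⟩ := h.inv.row_wit hr
    rcases hs with hs | hs | hs
    · have := hs _ (hsub hen)
      simp at this
    · have := hs _ (hsub hv)
      simp at this
      have := hc v (visited_subset_append _ _ hv) (by omega)
      omega
    · have := hs _ (hsub (zero_mem_visited _))
      simp at this
      omega

lemma Coded.snoc_south_tail {p : Code} (h : p.Valid) (hr : ¬ p.IsRow) {k : ℕ} {s : Step}
    (hg : Good (p.word ++ List.replicate k Step.south ++ [s]))
    (hx : 0 ≤ (endPt (p.word ++ List.replicate k Step.south ++ [s])).1) :
    Coded (p.word ++ List.replicate k Step.south ++ [s]) := by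
  obtain ⟨-, hc, hs, ht⟩ := good_snoc.1 hg
  have he := endPt_word_south h hr k
  have hen := endPt_mem_visited p.word
  rw [endPt_word h, xpos_eq_width hr] at hen
  cases s with
  | north =>
    rcases Nat.eq_zero_or_pos k with rfl | hpos
    · by_cases hd : 0 < p.depth
      · exact ⟨p, h, 1, Or.inr ⟨hr, Or.inr ⟨hd, by simp⟩⟩⟩
      · have : (up p).word = p.word ++ List.replicate 0 Step.south ++ [Step.north] := by
          simp [word, Nat.eq_zero_of_not_pos hd]
        rw [← this]
        exact coded_word ⟨h, hr⟩
    · exfalso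
      have := clear_north.1 hc _ (visited_subset_append _ _ hen) (by simp [he])
      simp [he] at this
      omega
  | south => exact ⟨p, h, k + 1, Or.inr ⟨hr, Or.inl (by simp [List.replicate_succ'])⟩⟩
  | east =>
    have : (col p (p.depth + k)).word =
        p.word ++ List.replicate k Step.south ++ [Step.east] := by
      rw [word_col_of_ge (Nat.le_add_right _ _), Nat.add_sub_cancel_left]
    rw [← this]
    exact coded_word ⟨h, hr⟩
  -- With an empty tail `col_wit` puts a visited node ahead. After at least one south step the turn
  -- rule forbids going west from the east side.
  | west =>
    exfalso
    rw [endPt_snoc, he] at hx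
    simp [Step.vec] at hx
    rcases Nat.eq_zero_or_pos k with rfl | hpos
    · obtain ⟨v, hv, h1, h2⟩ := h.inv.col_wit hr (by omega) _ le_rfl (by omega)
      simp only [clear_west, he] at hc
      have := hc v (visited_subset_append _ _ hv) (by simp [h1])
      omega
    · obtain ⟨k, rfl⟩ := Nat.exists_eq_add_of_le' hpos
      refine (ht (by rw [List.getLast?_append]; simp [List.replicate_succ'])
        ⟨_, visited_subset_append _ _ hen, 0, zero_mem_visited _, by simp; omega⟩).1
        (le_endPt_south h hr _) rfl

lemma Coded.snoc_north_tail {p : Code} (h : p.Valid) (hr : ¬ p.IsRow) {k : ℕ} (hk : k ≤ p.depth)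
    {s : Step} (hg : Good (p.word ++ List.replicate k Step.north ++ [s]))
    (hx : 0 ≤ (endPt (p.word ++ List.replicate k Step.north ++ [s])).1) :
    Coded (p.word ++ List.replicate k Step.north ++ [s]) := by
  rcases Nat.eq_zero_or_pos k with rfl | hpos
  · exact Coded.snoc_south_tail (k := 0) h hr hg hx
  obtain ⟨-, hc, hs, ht⟩ := good_snoc.1 hg
  have he := endPt_word_north h hr k
  have hen := endPt_mem_visited p.word
  rw [endPt_word h, xpos_eq_width hr] at hen
  cases s with
  | north =>
    by_cases hd : k < p.depth
    · exact ⟨p, h, k + 1, Or.inr ⟨hr, Or.inr ⟨hd, by simp [List.replicate_succ']⟩⟩⟩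
    · have : (up p).word = p.word ++ List.replicate k Step.north ++ [Step.north] := by
        have : p.depth = k := by omega
        simp [word, this, List.replicate_succ']
      rw [← this]
      exact coded_word ⟨h, hr⟩
  | south =>
    exfalso
    have := clear_south.1 hc _ (visited_subset_append _ _ hen) (by simp [he])
    simp [he] at this
    omega
  | east =>
    have : (col p (p.depth - k)).word =
        p.word ++ List.replicate k Step.north ++ [Step.east] := by
      rw [word_col_of_le (Nat.sub_le _ _), Nat.sub_sub_self hk]
    rw [← this]
    exact coded_word ⟨h, hr⟩
  | west =>
    exfalso
    rw [endPt_snoc, he] at hx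
    simp [Step.vec] at hx
    obtain ⟨v, hv, h1, h2⟩ := h.inv.col_wit hr (by omega)
      ((p.height : ℤ) - p.depth + k) (by omega) (by omega)
    have := clear_west.1 hc v (visited_subset_append _ _ hv) (by simp [he, h1])
    simp [he] at this
    omega

lemma coded_of_good {w : Walk} (hg : Good w) (hx : ∀ v ∈ visited w, 0 ≤ v.1) : Coded w := by
  induction w using List.reverseRecOn with
  | nil => exact coded_word (p := start) trivial
  | append_singleton w s ih =>
    have hxe := hx _ (endPt_mem_visited _)
    obtain ⟨p, h, k, ⟨hr, ⟨hk, rfl⟩ | ⟨hk, rfl⟩⟩ | ⟨hr, rfl | ⟨hk, rfl⟩⟩⟩ :=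
      ih hg.of_append fun v hv => hx v (visited_subset_append _ _ hv)
    · exact Coded.snoc_west_tail h hr hk hg hxe
    · exact Coded.snoc_east_tail h hr hk hg hxe
    · exact Coded.snoc_south_tail h hr hg hxe
    · exact Coded.snoc_north_tail h hr hk hg hxe

end Code

/-! ### A code can be read off from its walk -/

namespace Code

/-- The abscissa reached from `x` by `k` steps in a horizontal direction. -/
def shift : Step → ℕ → ℕ → ℕ
  | Step.west, x, k => x - k
  | _, x, k => x + k

/-- The depth reached from `d` by `k` steps in a vertical direction. -/
def sink : Step → ℕ → ℕ → ℕ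
  | Step.south, d, k => d + k
  | _, d, k => d - k

open Classical in
/-- One step of the automaton that reads the code of a walk. A state consists of a code and of the
direction and length of the straight tail that follows its walk. -/
noncomputable def next (σ : Code × Step × ℕ) (s : Step) : Code × Step × ℕ :=
  if σ.1.IsRow then
    match s with
    | Step.north => (row σ.1 (shift σ.2.1 σ.1.xpos σ.2.2), Step.north, 0)
    | Step.west => (σ.1, Step.west, σ.2.2 + 1)
    | Step.east =>
      if σ.1.xpos + σ.2.2 < σ.1.width then (σ.1, Step.east, σ.2.2 + 1)
      else (ext σ.1, Step.north, 0)
    | Step.south => σ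
  else
    match s with
    | Step.north =>
      if σ.2.2 < σ.1.depth then (σ.1, Step.north, σ.2.2 + 1) else (up σ.1, Step.north, 0)
    | Step.south => (σ.1, Step.south, σ.2.2 + 1)
    | Step.east => (col σ.1 (sink σ.2.1 σ.1.depth σ.2.2), Step.north, 0)
    | Step.west => σ

/-- The state of the automaton after reading a walk. -/
noncomputable def run (w : Walk) : Code × Step × ℕ := w.foldl next (start, Step.north, 0)

lemma run_snoc (w : Walk) (s : Step) : run (w ++ [s]) = next (run w) s := by
  simp [run]

lemma run_west {p : Code} (hr : p.IsRow) {w : Walk} (h : run w = (p, Step.north, 0)) (k : ℕ) :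
    run (w ++ List.replicate (k + 1) Step.west) = (p, Step.west, k + 1) := by
  induction k with
  | zero => simp [run_snoc, h, next, hr]
  | succ k ih =>
    rw [List.replicate_succ', ← List.append_assoc, run_snoc, ih]
    simp [next, hr]

lemma run_east {p : Code} (hr : p.IsRow) {w : Walk} (h : run w = (p, Step.north, 0)) (k : ℕ)
    (hk : p.xpos + (k + 1) ≤ p.width) :
    run (w ++ List.replicate (k + 1) Step.east) = (p, Step.east, k + 1) := by
  induction k with
  | zero =>
    have : p.xpos < p.width := by omega
    simp [run_snoc, h, next, hr, this]
  | succ k ih =>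
    rw [List.replicate_succ', ← List.append_assoc, run_snoc, ih (by omega)]
    have : p.xpos + (k + 1) < p.width := by omega
    simp [next, hr, this]

lemma run_south {p : Code} (hr : ¬ p.IsRow) {w : Walk} (h : run w = (p, Step.north, 0)) (k : ℕ) :
    run (w ++ List.replicate (k + 1) Step.south) = (p, Step.south, k + 1) := by
  induction k with
  | zero => simp [run_snoc, h, next, hr]
  | succ k ih =>
    rw [List.replicate_succ', ← List.append_assoc, run_snoc, ih]
    simp [next, hr]

lemma run_north {p : Code} (hr : ¬ p.IsRow) {w : Walk} (h : run w = (p, Step.north, 0)) (k : ℕ)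
    (hk : k ≤ p.depth) : run (w ++ List.replicate k Step.north) = (p, Step.north, k) := by
  induction k with
  | zero => simpa using h
  | succ k ih =>
    rw [List.replicate_succ', ← List.append_assoc, run_snoc, ih (by omega)]
    have : k < p.depth := by omega
    simp [next, hr, this]

/-- Uniqueness of the code: it makes `word` injective on valid codes, so that counting walks becomes
counting codes. -/
lemma run_word {p : Code} (h : p.Valid) : run p.word = (p, Step.north, 0) := by
  induction p with
  | start => rfl
  | row p x ih =>
    obtain ⟨h, hr, hx⟩ := h
    specialize ih h
    rcases lt_trichotomy x p.xpos with hlt | heq | hlt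
    · rw [word_row_of_le hlt.le, run_snoc]
      obtain ⟨k, hk⟩ : ∃ k, p.xpos - x = k + 1 := ⟨p.xpos - x - 1, by omega⟩
      rw [hk, run_west hr ih, next]
      have : p.xpos - (k + 1) = x := by omega
      simp [hr, shift, this]
    · rw [word_row_of_le heq.le, run_snoc, heq]
      simp [ih, next, hr, shift]
    · rw [word_row_of_ge hlt.le, run_snoc]
      obtain ⟨k, hk⟩ : ∃ k, x - p.xpos = k + 1 := ⟨x - p.xpos - 1, by omega⟩
      rw [hk, run_east hr ih _ (by omega), next]
      have : p.xpos + (k + 1) = x := by omega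
      simp [hr, shift, this]
  | up p ih =>
    obtain ⟨h, hr⟩ := h
    rw [word, List.replicate_succ', ← List.append_assoc, run_snoc, run_north hr (ih h) _ le_rfl]
    simp [next, hr]
  | ext p ih =>
    obtain ⟨h, hr⟩ := h
    have hx := xpos_le_width h
    rw [word, List.replicate_succ', ← List.append_assoc, run_snoc]
    rcases Nat.eq_zero_or_pos (p.width - p.xpos) with h0 | hpos
    · have : ¬ p.xpos < p.width := by omega
      simp [h0, ih h, next, hr, this]
    · obtain ⟨k, hk⟩ : ∃ k, p.width - p.xpos = k + 1 := ⟨p.width - p.xpos - 1, by omega⟩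
      rw [hk, run_east hr (ih h) _ (by omega)]
      have : ¬ p.xpos + (k + 1) < p.width := by omega
      simp [next, hr, this]
  | col p c ih =>
    obtain ⟨h, hr⟩ := h
    rcases le_or_gt c p.depth with hle | hlt
    · rw [word_col_of_le hle, run_snoc, run_north hr (ih h) _ (Nat.sub_le _ _)]
      have : p.depth - (p.depth - c) = c := by omega
      simp [next, hr, sink, this]
    · obtain ⟨k, hk⟩ : ∃ k, c - p.depth = k + 1 := ⟨c - p.depth - 1, by omega⟩
      rw [word_col_of_ge hlt.le, run_snoc, hk, run_south hr (ih h)]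
      have : p.depth + (k + 1) = c := by omega
      simp [next, hr, sink, this]

/-- The automaton ignores south steps while its code ends with a new row, so the final descent of
`wrap p` does not disturb the reading of `p`. -/
lemma run_append_south {w : Walk} (hr : (run w).1.IsRow) (k : ℕ) :
    run (w ++ List.replicate k Step.south) = run w := by
  induction k with
  | zero => simp
  | succ k ih =>
    rw [List.replicate_succ', ← List.append_assoc, run_snoc, ih]
    simp [next, hr]

end Code

/-! ### Signed area -/

/-- The line integral of `x dy` along a walk. -/
def sarea (w : Walk) : ℤ :=
  ∑ i ∈ Finset.range w.length, (w.pos i).1 * ((w.pos (i + 1)).2 - (w.pos i).2)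

lemma sarea_nil : sarea [] = 0 := by simp [sarea]

lemma area_eq (w : Walk) : w.area = (sarea w - (endPt w).1 * (endPt w).2).natAbs := by
  rw [Walk.area, sarea, pos_length]
  congr 1
  ring

lemma sarea_snoc (w : Walk) (s : Step) :
    sarea (w ++ [s]) = sarea w + (endPt w).1 * s.vec.2 := by
  rw [sarea, List.length_append, List.length_singleton, Finset.sum_range_succ]
  congr 1
  · refine Finset.sum_congr rfl fun i hi => ?_
    have hi := Finset.mem_range.1 hi
    rw [pos_append_of_le w [s] hi.le, pos_append_of_le w [s] hi]
  · have : w.length + 1 = (w ++ [s]).length := by simp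
    rw [pos_append_of_le w [s] le_rfl, this, pos_length, pos_length, endPt_snoc]
    simp

lemma sarea_append_replicate (w : Walk) (s : Step) (k : ℕ) :
    sarea (w ++ List.replicate k s) = sarea w + k * ((endPt w).1 * s.vec.2) := by
  induction k with
  | zero => simp
  | succ k ih =>
    rw [List.replicate_succ', ← List.append_assoc, sarea_snoc, ih, endPt_append, endPt_replicate]
    cases s <;> simp [Step.vec] <;> ring

/-- `acc` counts two pieces that the integral of `x dy` misses: the strip between `x = -1` and `x =
0`, of area `height`, and the rectangle `width * depth` that would be swept by going north from the
endpoint to the top of the box. -/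
lemma Code.sarea_word {p : Code} (h : p.Valid) :
    sarea p.word = (p.acc : ℤ) - p.height - p.width * p.depth := by
  induction p with
  | start => simp [word, sarea_nil, acc, height, depth]
  | row p x ih =>
    obtain ⟨h, hr, hx⟩ := h
    have hd := depth_eq_zero hr
    have hd' : (row p x).depth = 0 := rfl
    have hs : sarea (row p x).word = sarea p.word + x := by
      rcases le_total x p.xpos with hle | hle
      · rw [word_row_of_le hle, sarea_snoc, sarea_append_replicate, endPt_word_west h hr]
        simp [Step.vec]; omega
      · rw [word_row_of_ge hle, sarea_snoc, sarea_append_replicate, endPt_word_east h hr]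
        simp [Step.vec]; omega
    rw [hs, ih h, hd, hd', acc, height, width]
    push_cast
    ring
  | up p ih =>
    obtain ⟨h, hr⟩ := h
    have hd' : (up p).depth = 0 := rfl
    rw [word, sarea_append_replicate, ih h, endPt_word h, xpos_eq_width hr, hd', acc, height, width]
    simp [Step.vec]
    ring
  | ext p ih =>
    obtain ⟨h, hr⟩ := h
    have hd' : (ext p).depth = 0 := rfl
    rw [word, sarea_append_replicate, ih h, depth_eq_zero hr, hd', acc, height, width]
    simp [Step.vec]
  | col p c ih =>
    obtain ⟨h, hr⟩ := h
    have hd' : (col p c).depth = c := rfl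
    have hs : sarea (col p c).word = sarea p.word + p.width * ((p.depth : ℤ) - c) := by
      rcases le_total c p.depth with hle | hle
      · rw [word_col_of_le hle, sarea_snoc, sarea_append_replicate, endPt_word h, xpos_eq_width hr]
        simp [Step.vec, Nat.cast_sub hle]; ring
      · rw [word_col_of_ge hle, sarea_snoc, sarea_append_replicate, endPt_word h, xpos_eq_width hr]
        simp [Step.vec, Nat.cast_sub hle]; ring
    rw [hs, ih h, hd', acc, height, width]
    push_cast
    ring

/-! ### Reflection in the vertical axis -/

/-- The reflection of a step in the vertical axis. -/
def Step.flip : Step → Step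
  | .north => .north
  | .east => .west
  | .south => .south
  | .west => .east

/-- The reflection of a walk in the vertical axis. -/
def mirror (w : Walk) : Walk := w.map Step.flip

lemma Step.flip_flip (s : Step) : s.flip.flip = s := by cases s <;> rfl

lemma mirror_mirror (w : Walk) : mirror (mirror w) = w := by
  have : Step.flip ∘ Step.flip = id := funext Step.flip_flip
  simp [mirror, this]

lemma mirror_injective : Function.Injective mirror :=
  Function.LeftInverse.injective mirror_mirror

lemma length_mirror (w : Walk) : (mirror w).length = w.length := by simp [mirror]

lemma mirror_append (w r : Walk) : mirror (w ++ r) = mirror w ++ mirror r := by simp [mirror]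

lemma endPt_mirror (w : Walk) : endPt (mirror w) = (-(endPt w).1, (endPt w).2) := by
  induction w using List.reverseRecOn with
  | nil => rfl
  | append_singleton w s ih =>
    rw [mirror_append, endPt_append, ih, endPt_snoc]
    cases s <;> ext <;> simp [mirror, endPt, Step.flip, Step.vec] <;> ring

lemma mem_visited_mirror {w : Walk} {p : ℤ × ℤ} :
    p ∈ visited (mirror w) ↔ (-p.1, p.2) ∈ visited w := by
  induction w using List.reverseRecOn with
  | nil => simp [mirror, visited_nil, Prod.ext_iff]
  | append_singleton w s ih =>
    have : mirror [s] = [s.flip] := rfl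
    rw [mirror_append, this, mem_visited_snoc, mem_visited_snoc, ih, endPt_mirror]
    refine or_congr_right ?_
    rw [Prod.ext_iff, Prod.ext_iff]
    cases s <;> simp [Step.flip, Step.vec] <;> omega

lemma visited_mirror_forall {w : Walk} {P : ℤ × ℤ → Prop} :
    (∀ p ∈ visited (mirror w), P p) ↔ ∀ p ∈ visited w, P (-p.1, p.2) := by
  constructor
  · intro h p hp
    exact h _ (mem_visited_mirror.2 (by simpa using hp))
  · intro h p hp
    simpa using h _ (mem_visited_mirror.1 hp)

lemma visited_mirror_exists {w : Walk} {P : ℤ × ℤ → Prop} :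
    (∃ p ∈ visited (mirror w), P p) ↔ ∃ p ∈ visited w, P (-p.1, p.2) := by
  constructor
  · rintro ⟨p, hp, h⟩
    exact ⟨_, mem_visited_mirror.1 hp, by simpa using h⟩
  · rintro ⟨p, hp, h⟩
    exact ⟨_, mem_visited_mirror.2 (by simpa using hp), h⟩

lemma onSide_mirror {w : Walk} : OnSide (mirror w) ↔ OnSide w := by
  simp only [OnSide, visited_mirror_forall, endPt_mirror, neg_le_neg_iff]
  tauto

lemma clear_mirror {w : Walk} {s : Step} : Clear (mirror w) s.flip ↔ Clear w s := by
  cases s <;> simp only [Step.flip, clear_north, clear_south, clear_east, clear_west,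
    visited_mirror_forall, endPt_mirror, neg_le_neg_iff, neg_inj]

lemma turnOK_mirror {w : Walk} {s : Step} : TurnOK (mirror w) s.flip ↔ TurnOK w s := by
  have h1 : (mirror w).getLast? = some Step.south ↔ w.getLast? = some Step.south := by
    rw [mirror, List.getLast?_map]
    cases w.getLast? with
    | none => simp
    | some t => cases t <;> simp [Step.flip]
  have h2 : s.flip ≠ Step.west ↔ s ≠ Step.east := by cases s <;> simp [Step.flip]
  have h3 : s.flip ≠ Step.east ↔ s ≠ Step.west := by cases s <;> simp [Step.flip]
  simp only [TurnOK, h1, h2, h3, visited_mirror_forall, visited_mirror_exists, endPt_mirror,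
    neg_le_neg_iff, ne_eq, neg_inj]
  exact forall₂_congr fun _ _ => and_comm

lemma good_mirror {w : Walk} : Good (mirror w) ↔ Good w := by
  induction w using List.reverseRecOn with
  | nil => rfl
  | append_singleton w s ih =>
    have : mirror [s] = [s.flip] := rfl
    rw [good_snoc (w := w) (s := s)]
    rw [mirror_append, this, good_snoc, ih, clear_mirror, turnOK_mirror, ← this, ← mirror_append,
      onSide_mirror]

lemma sarea_mirror (w : Walk) : sarea (mirror w) = - sarea w := by
  induction w using List.reverseRecOn with
  | nil => simp [mirror, sarea_nil]
  | append_singleton w s ih =>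
    have : mirror [s] = [s.flip] := rfl
    rw [mirror_append, this, sarea_snoc, sarea_snoc, ih, endPt_mirror]
    cases s <;> simp [Step.flip, Step.vec] <;> ring

open Code

/-! ### The three families of polygons -/

/-- The walk around a single column below the origin. -/
def hook (n : ℕ) : Walk :=
  List.replicate n Step.south ++ [Step.east] ++ List.replicate n Step.north

/-- The walk around a bar graph hanging from the row above the origin. -/
def bar (b : Code) : Walk := (up b).word ++ List.replicate b.width Step.west

/-- The walk of a code, closed up along the line `x = -1`. -/
def wrap (p : Code) : Walk :=
  p.word ++ List.replicate (p.xpos + 1) Step.west ++ List.replicate p.height Step.south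

/-- The codes of bar graphs. -/
def IsBar (b : Code) : Prop := b.Valid ∧ ¬ b.IsRow ∧ b.height = 0

/-- The counterclockwise 3-sided prudent polygons. -/
def Ccw (w : Walk) : Prop :=
  (∃ n, 1 ≤ n ∧ w = hook n) ∨ (∃ b, IsBar b ∧ 1 ≤ b.width ∧ w = bar b) ∨
    ∃ p : Code, p.Valid ∧ p.IsRow ∧ w = wrap p

lemma hook_eq (n : ℕ) : hook n = (col start n).word ++ List.replicate n Step.north := by
  simp [hook, word, depth]

lemma valid_col_start (n : ℕ) : (col start n).Valid := ⟨trivial, id⟩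

lemma endPt_hook (n : ℕ) : endPt (hook n) = (1, 0) := by
  rw [hook_eq, endPt_word_north (valid_col_start n) id]
  simp [width, height, depth]

lemma sarea_hook (n : ℕ) : sarea (hook n) = n := by
  rw [hook_eq, sarea_append_replicate, sarea_word (valid_col_start n),
    endPt_word (valid_col_start n)]
  simp [width, height, depth, acc, xpos, Step.vec]

lemma good_hook (n : ℕ) : Good (hook n) := by
  rw [hook_eq]
  exact good_word_north (valid_col_start n) id (good_word (valid_col_start n)) n

lemma IsBar.valid_up {b : Code} (h : IsBar b) : (up b).Valid := ⟨h.1, h.2.1⟩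

lemma endPt_bar {b : Code} (h : IsBar b) : endPt (bar b) = (0, 1) := by
  rw [bar, endPt_word_west h.valid_up trivial, height, h.2.2]
  simp [xpos]

lemma sarea_bar {b : Code} (h : IsBar b) : sarea (bar b) = b.acc + b.width := by
  rw [bar, sarea_append_replicate, sarea_word h.valid_up, height, h.2.2]
  simp [acc, depth, Step.vec]

lemma good_bar {b : Code} (h : IsBar b) : Good (bar b) :=
  good_word_west h.valid_up trivial (good_word h.valid_up) _

lemma endPt_wrap {p : Code} (h : p.Valid) (hr : p.IsRow) : endPt (wrap p) = (-1, 0) := by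
  rw [wrap, endPt_append, endPt_word_west h hr, endPt_replicate]
  simp [Step.vec]

lemma sarea_wrap {p : Code} (h : p.Valid) (hr : p.IsRow) : sarea (wrap p) = p.acc := by
  rw [wrap, sarea_append_replicate, sarea_append_replicate, sarea_word h, endPt_word_west h hr,
    depth_eq_zero hr]
  simp [Step.vec]

/-- The walk of `p` stays in `x ≥ 0`, so the descent along `x = -1` is on the west side and meets
nothing. -/
lemma good_wrap {p : Code} (h : p.Valid) (hr : p.IsRow) : Good (wrap p) := by
  refine good_append_replicate (good_word_west h hr (good_word h) _)
    (fun _ => clear_south.2 fun v hv hv1 => ?_) (fun j _ _ => Or.inr (Or.inr fun v hv => ?_))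
    (fun _ => turnOK_south)
  · rw [endPt_word_west h hr] at *
    rcases (mem_visited_west h hr).1 hv with hv | hv
    · have := h.inv.bounds v hv
      simp at hv1
      omega
    · exact hv.1.ge
  · rw [endPt_append, endPt_replicate, endPt_word_west h hr]
    rw [mem_visited_append_replicate, mem_visited_west h hr, endPt_word_west h hr] at hv
    simp only [Step.vec]
    rcases hv with (hv | hv) | ⟨j, -, -, rfl⟩
    · have := h.inv.bounds v hv
      simp
      omega
    · simp
      have := hv.2.1
      push_cast at this
      omega
    · simp [Step.vec]

lemma Ccw.good {w : Walk} (h : Ccw w) : Good w := by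
  rcases h with ⟨n, -, rfl⟩ | ⟨b, hb, -, rfl⟩ | ⟨p, h, hr, rfl⟩
  · exact good_hook n
  · exact good_bar hb
  · exact good_wrap h hr

lemma acc_pos {p : Code} (hr : p.IsRow) : 0 < p.acc := by
  cases p <;> simp_all [acc, IsRow]

lemma Ccw.mul_endPt {w : Walk} (h : Ccw w) : (endPt w).1 * (endPt w).2 = 0 := by
  rcases h with ⟨n, -, rfl⟩ | ⟨b, hb, -, rfl⟩ | ⟨p, h, hr, rfl⟩
  · simp [endPt_hook]
  · simp [endPt_bar hb]
  · simp [endPt_wrap h hr]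

/-- Reflection negates the signed area, so its sign keeps these polygons apart from their mirror
images. -/
lemma Ccw.sarea_pos {w : Walk} (h : Ccw w) : 0 < sarea w := by
  rcases h with ⟨n, hn, rfl⟩ | ⟨b, hb, hw, rfl⟩ | ⟨p, h, hr, rfl⟩
  · rw [sarea_hook]; omega
  · rw [sarea_bar hb]; omega
  · rw [sarea_wrap h hr]
    have := acc_pos hr
    omega

lemma Ccw.area {w : Walk} (h : Ccw w) : (w.area : ℤ) = sarea w := by
  rw [area_eq, h.mul_endPt, sub_zero]
  have := h.sarea_pos
  omega

lemma area_mirror (w : Walk) : (mirror w).area = w.area := by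
  rw [area_eq, area_eq, sarea_mirror, endPt_mirror]
  simp only [neg_mul]
  rw [← Int.natAbs_neg]
  congr 1
  ring

lemma isAlmostClosed_iff {w : Walk} :
    w.IsAlmostClosed ↔ 2 ≤ w.length ∧ |(endPt w).1| + |(endPt w).2| = 1 := by
  rw [Walk.IsAlmostClosed, pos_length]

lemma isAlmostClosed_mirror {w : Walk} : (mirror w).IsAlmostClosed ↔ w.IsAlmostClosed := by
  rw [isAlmostClosed_iff, isAlmostClosed_iff, length_mirror, endPt_mirror]
  simp

lemma Ccw.isAlmostClosed {w : Walk} (h : Ccw w) : w.IsAlmostClosed := by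
  rw [isAlmostClosed_iff]
  rcases h with ⟨n, hn, rfl⟩ | ⟨b, hb, hw, rfl⟩ | ⟨p, h, hr, rfl⟩
  · refine ⟨?_, by simp [endPt_hook]⟩
    simp [hook]; omega
  · refine ⟨?_, by simp [endPt_bar hb]⟩
    simp [bar, word]; omega
  · have := height_pos hr
    refine ⟨?_, by simp [endPt_wrap h hr]⟩
    simp [wrap]; omega

/-! ### Classification of the polygons -/

lemma eq_start_of_width {p : Code} (h : ¬ p.IsRow) (hw : p.width = 0) : p = start := by
  cases p <;> simp_all [IsRow, width]

lemma word_of_width_eq_zero {p : Code} (h : p.Valid) (hr : p.IsRow) (hw : p.width = 0) :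
    p.word = List.replicate p.height Step.north := by
  induction p with
  | start => exact hr.elim
  | row p x ih =>
    obtain ⟨h, hr', hx⟩ := h
    have hw' : p.width = 0 := hw
    have := xpos_le_width h
    have h1 : p.xpos = 0 := by omega
    have h2 : x = 0 := by omega
    subst h2
    simp [word, ih h hr' hw', h1, height, List.replicate_succ']
  | up p ih =>
    have := eq_start_of_width h.2 hw
    subst this
    simp [word, height, depth]
  | ext p ih => exact hr.elim
  | col p c ih => exact hr.elim

/-- A `row` letter sits on a code that already has positive height. -/
lemma eq_up_of_height_eq_one {p : Code} (h : p.Valid) (hr : p.IsRow) (hh : p.height = 1) :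
    ∃ b, IsBar b ∧ p = up b := by
  cases p with
  | start => exact hr.elim
  | row p x =>
    have := height_pos h.2.1
    simp [height] at hh
    omega
  | up p => exact ⟨p, ⟨h.1, h.2, by simpa [height] using hh⟩, rfl⟩
  | ext p => exact hr.elim
  | col p c => exact hr.elim

/-- A walk whose code ends with a new row is at positive height, hence can only close from (0,1),
and its box has one row above the origin: a bar graph. Otherwise the endpoint is on the east side,
so the width is at most 1, which leaves a hook or a single column above the origin. -/
lemma ccw_or_mirror_of_nonneg {w : Walk} (hg : Good w) (hc : w.IsAlmostClosed)
    (hx : ∀ v ∈ visited w, 0 ≤ v.1) : Ccw w ∨ Ccw (mirror w) := by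
  rw [isAlmostClosed_iff] at hc
  obtain ⟨hlen, he⟩ := hc
  obtain ⟨p, h, k, ⟨hr, hw⟩ | ⟨hr, hw⟩⟩ := coded_of_good hg hx
  · have key : k ≤ p.xpos ∧ w = p.word ++ List.replicate k Step.west ∧ p.xpos = k ∧
        p.height = 1 := by
      have := height_pos hr
      rcases hw with ⟨hk, rfl⟩ | ⟨hk, rfl⟩
      · rw [endPt_word_west h hr] at he
        simp only [Nat.abs_cast] at he
        have := abs_nonneg ((p.xpos : ℤ) - k)
        have h0 : |(p.xpos : ℤ) - k| = 0 := by omega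
        have := abs_eq_zero.1 h0
        exact ⟨hk, rfl, by omega, by omega⟩
      · rw [endPt_word_east h hr] at he
        simp only [Nat.abs_cast] at he
        have := abs_nonneg ((p.xpos : ℤ) + k)
        have h0 : |(p.xpos : ℤ) + k| = 0 := by omega
        have := abs_eq_zero.1 h0
        have hk0 : k = 0 := by omega
        subst hk0
        exact ⟨by omega, rfl, by omega, by omega⟩
    obtain ⟨-, rfl, hk, hh⟩ := key
    obtain ⟨b, hb, rfl⟩ := eq_up_of_height_eq_one h hr hh
    have hk' : b.width = k := hk
    rcases Nat.eq_zero_or_pos b.width with h0 | hpos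
    · have := eq_start_of_width hb.2.1 h0
      subst this
      simp [word, depth, ← hk', width] at hlen
    · exact Or.inl (Or.inr (Or.inl ⟨b, hb, hpos, by rw [bar, hk']⟩))
  · have hxp := xpos_eq_width hr
    have hw1 : p.width ≤ 1 := by
      have := abs_nonneg (endPt w).2
      have : (endPt w).1 = p.width := by
        rcases hw with rfl | ⟨hk, rfl⟩
        · rw [endPt_word_south h hr]
        · rw [endPt_word_north h hr]
      rw [this, Nat.abs_cast] at he
      omega
    cases p with
    | start =>
      rcases hw with rfl | ⟨hk, rfl⟩
      · rw [endPt_word_south h hr] at he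
        simp [width, height, depth] at he
        simp [word, he] at hlen
      · simp [depth] at hk
        simp [word, hk] at hlen
    | row p x => exact (hr trivial).elim
    | up p => exact (hr trivial).elim
    | ext p =>
      have hp := h.1
      have hpr := h.2
      have hw0 : p.width = 0 := by simp [width] at hw1; exact hw1
      have hx0 : p.xpos = 0 := by have := xpos_le_width hp; omega
      have hpos := height_pos hpr
      have hword := word_of_width_eq_zero hp hpr hw0
      rcases hw with rfl | ⟨hk, rfl⟩
      · rw [endPt_word_south h hr] at he
        simp [width, height, depth, hw0] at he
        have hk : p.height = k := by omega
        -- The walk goes north, one step east, and back south. Its mirror image wraps a code of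
        -- width 0.
        right; right; right
        refine ⟨p, hp, hpr, ?_⟩
        simp [wrap, mirror, word, hword, hx0, hw0, hk, Step.flip]
      · simp [depth] at hk
        subst hk
        rw [endPt_word_north h hr] at he
        simp [width, height, depth, hw0] at he
        omega
    | col p c =>
      have hp := h.1
      have hpr := h.2
      have hw0 : p.width = 0 := by simp [width] at hw1; exact hw1
      have := eq_start_of_width hpr hw0
      subst this
      rcases hw with rfl | ⟨hk, rfl⟩
      · rw [endPt_word_south h hr] at he
        simp [width, height, depth] at he
        have : -(c : ℤ) - k = 0 := he
        have hc0 : c = 0 := by omega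
        have hk0 : k = 0 := by omega
        simp [word, hc0, hk0, depth] at hlen
      · rw [endPt_word_north h hr] at he
        simp [width, height, depth] at he
        have hck : c = k := by omega
        subst hck
        rcases Nat.eq_zero_or_pos c with rfl | hpos
        · simp [word, depth] at hlen
        · exact Or.inl (Or.inl ⟨c, hpos, (hook_eq c).symm⟩)

lemma exists_split_west {w : Walk} (h : ∃ v ∈ visited w, v.1 < 0) :
    ∃ w₁ w₂, w = w₁ ++ [Step.west] ++ w₂ ∧ (∀ v ∈ visited w₁, 0 ≤ v.1) ∧ (endPt w₁).1 = 0 := by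
  induction w using List.reverseRecOn with
  | nil =>
    obtain ⟨v, hv, h⟩ := h
    simp [visited_nil] at hv
    simp [hv] at h
  | append_singleton w s ih =>
    by_cases hw : ∃ v ∈ visited w, v.1 < 0
    · obtain ⟨w₁, w₂, rfl, h1, h2⟩ := ih hw
      exact ⟨w₁, w₂ ++ [s], by simp, h1, h2⟩
    · push Not at hw
      obtain ⟨v, hv, h⟩ := h
      rcases mem_visited_snoc.1 hv with hv | rfl
      · have := hw v hv; omega
      · have := hw _ (endPt_mem_visited w)
        cases s <;> simp [Step.vec] at h
        · omega
        · omega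
        · omega
        · exact ⟨w, [], by simp, hw, by omega⟩

/-- After the first visit to the line `x = -1`, a polygon that has already been to the right of the
origin cannot be closed from the east. -/
lemma east_barrier {w : Walk} {Y : ℤ} {y₀ : ℤ} (he : endPt w = (-1, Y)) (h0 : ((0, Y) : ℤ × ℤ) ∈ visited w)
    (hy : y₀ < Y) (h1 : ((1, y₀) : ℤ × ℤ) ∈ visited w) {r : Walk} (hg : Good (w ++ r))
    (hx : ∀ v ∈ visited (w ++ r), v.1 ≤ 1) :
    ((endPt (w ++ r)).1 = 0 → Y ≤ (endPt (w ++ r)).2) ∧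
      ((endPt (w ++ r)).1 = 1 → Y ≤ (endPt (w ++ r)).2) := by
  induction r using List.reverseRecOn with
  | nil => simp [he]
  | append_singleton r s ih =>
    rw [← List.append_assoc] at *
    obtain ⟨ih0, ih1⟩ := ih hg.of_append fun v hv => hx v (visited_subset_append _ _ hv)
    obtain ⟨-, hc, hs, -⟩ := good_snoc.1 hg
    have hsub : visited w ⊆ visited (w ++ r) := visited_subset_append _ _
    have hsub' : visited w ⊆ visited (w ++ r ++ [s]) := hsub.trans (visited_subset_append _ _)
    have hem := endPt_mem_visited w
    rw [he] at hem
    refine ⟨fun h => ?_, fun h => ?_⟩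
    -- On `x = 0` the endpoint lies strictly between visited nodes at `x = -1` and `x = 1`, so only
    -- the north side is left.
    · rcases hs with hs | hs | hs
      · exact hs _ (hsub' h0)
      · have := hs _ (hsub' h1)
        simp only at this; omega
      · have := hs _ (hsub' hem)
        simp only at this; omega
    · have hxe := hx _ (visited_subset_append _ [s] (endPt_mem_visited (w ++ r)))
      rw [endPt_snoc] at h ⊢
      cases s with
      | north =>
        simp [Step.vec] at h ⊢
        have := ih1 h; omega
      -- The node `(1, y₀)` lies ahead, since the walk on `x = 1` is at height at least `Y > y₀`.
      | south =>
        simp [Step.vec] at h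
        have := clear_south.1 hc _ (hsub h1) (by simp [h])
        have := ih1 h
        simp at *
        omega
      | east =>
        simp [Step.vec] at h ⊢
        exact ih0 h
      | west =>
        simp [Step.vec] at h
        omega

/-- After the first visit to the line `x = -1`, a polygon that has already been to the right of the
origin either goes straight south or cannot be closed from the west. -/
lemma west_barrier {w : Walk} {Y : ℤ} {y₀ : ℤ} {m : ℤ} (he : endPt w = (-1, Y))
    (h0 : ((0, Y) : ℤ × ℤ) ∈ visited w) (hm : 0 < m) (h1 : ((m, y₀) : ℤ × ℤ) ∈ visited w)
    {r : Walk} (hg : Good (w ++ r)) (hx : ∀ v ∈ visited (w ++ r), -1 ≤ v.1) :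
    (∃ j : ℕ, r = List.replicate j Step.south) ∨
      ((∃ v ∈ visited (w ++ r), Y < v.2) ∧
        ((endPt (w ++ r)).1 = -1 → Y < (endPt (w ++ r)).2)) := by
  induction r using List.reverseRecOn with
  | nil => exact Or.inl ⟨0, rfl⟩
  | append_singleton r s ih =>
    rw [← List.append_assoc] at *
    have hx' : ∀ v ∈ visited (w ++ r), -1 ≤ v.1 := fun v hv => hx v (visited_subset_append _ _ hv)
    have ih := ih hg.of_append hx'
    obtain ⟨hg', hc, hs, ht⟩ := good_snoc.1 hg
    have hsub : visited w ⊆ visited (w ++ r) := visited_subset_append _ _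
    have hem := endPt_mem_visited w
    rw [he] at hem
    have hxe := hx _ (endPt_mem_visited _)
    rw [endPt_snoc] at hxe ⊢
    rcases ih with ⟨j, rfl⟩ | ⟨⟨v, hv, hvY⟩, ih⟩
    · have he' : endPt (w ++ List.replicate j Step.south) = (-1, Y - j) := by
        rw [endPt_append, he, endPt_replicate]
        simp [Step.vec]; ring
      cases s with
      | north =>
        have hle := clear_north.1 hc _ (hsub hem) (by simp [he'])
        rw [he'] at hle
        simp at hle
        have hj : j = 0 := by omega
        subst hj
        right
        refine ⟨⟨_, endPt_mem_visited _, ?_⟩, ?_⟩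
        · rw [endPt_snoc, he']; simp [Step.vec]
        · rw [he']; simp [Step.vec]
      | south => exact Or.inl ⟨j + 1, by simp [List.replicate_succ']⟩
      -- Without south steps the node `(0, Y)` is ahead; after a south step the turn rule forbids
      -- going east from the west side of a wide box.
      | east =>
        exfalso
        rcases Nat.eq_zero_or_pos j with rfl | hpos
        · have := clear_east.1 hc _ (hsub h0) (by rw [he']; simp)
          rw [he'] at this
          simp at this
        · obtain ⟨j, rfl⟩ := Nat.exists_eq_add_of_le' hpos
          refine (ht (by rw [List.getLast?_append]; simp [List.replicate_succ'])
            ⟨_, hsub h0, _, hsub h1, by simpa using hm.ne⟩).2 (fun v hv => ?_) rfl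
          rw [he']
          exact hx' v hv
      | west =>
        rw [he'] at hxe
        simp [Step.vec] at hxe
    · right
      refine ⟨⟨v, visited_subset_append _ _ hv, hvY⟩, fun h => ?_⟩
      cases s with
      | north =>
        simp [Step.vec] at h ⊢
        have := ih h; omega
      | south =>
        exfalso
        simp [Step.vec] at h
        have := clear_south.1 hc _ (hsub hem) (by simp [h])
        have := ih h
        simp at *
        omega
      | east =>
        have := hx' _ (endPt_mem_visited _)
        simp [Step.vec] at h
        omega
      -- Before this step the walk is on `x = 0`, strictly inside the range of abscissas, hence on
      -- the north side and above `v`.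
      | west =>
        simp [Step.vec] at h ⊢
        rcases hg'.onSide with hs | hs | hs
        · exact hvY.trans_le (hs v hv)
        · have := hs _ (hsub h1)
          simp at this; omega
        · have := hs _ (hsub hem)
          simp at this; omega

/-- Having been at positive abscissas, the walk first reaches `x = -1` from a node (0,Y) of its top
row, with Y ≥ 1. Its final node, next to the origin, is on some side of the box. The north side
would force a second visit to (0,Y), the east side is excluded by `east_barrier`, and on the west
side `west_barrier` leaves only the straight descent. -/
lemma ccw_of_split {w₁ w₂ : Walk} (hg : Good (w₁ ++ [Step.west] ++ w₂))
    (hc : Walk.IsAlmostClosed (w₁ ++ [Step.west] ++ w₂)) (hx : ∀ v ∈ visited w₁, 0 ≤ v.1)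
    (he : (endPt w₁).1 = 0) (hpos : ∃ v ∈ visited w₁, 0 < v.1) :
    Ccw (w₁ ++ [Step.west] ++ w₂) := by
  obtain ⟨p, h, k, ⟨hr, hw⟩ | ⟨hr, hw⟩⟩ := coded_of_good hg.of_append.of_append hx
  swap
  · exfalso
    obtain ⟨v, hv, hv0⟩ := hpos
    rcases hw with rfl | ⟨hk, rfl⟩
    · have := le_endPt_south h hr k v hv; omega
    · have := le_endPt_north h hr k v hv; omega
  have key : w₁ = p.word ++ List.replicate p.xpos Step.west := by
    rcases hw with ⟨hk, rfl⟩ | ⟨hk, rfl⟩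
    · rw [endPt_word_west h hr] at he
      have : k = p.xpos := by simp at he; omega
      rw [this]
    · rw [endPt_word_east h hr] at he
      have h0 : p.xpos = 0 := by simp at he; omega
      have h1 : k = 0 := by simp at he; omega
      simp [h0, h1]
  have hwid : 0 < p.width := by
    obtain ⟨v, hv, hv0⟩ := hpos
    have hxw := xpos_le_width h
    rw [key] at hv
    rcases (mem_visited_west h hr).1 hv with hv | hv
    · have := h.inv.bounds v hv; omega
    · omega
  have hY := height_pos hr
  have he₁ : endPt w₁ = (0, (p.height : ℤ)) := by
    rw [key, endPt_word_west h hr]; simp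
  have he₂ : endPt (w₁ ++ [Step.west]) = (-1, (p.height : ℤ)) := by
    rw [endPt_snoc, he₁]; simp [Step.vec]
  have h0 : ((0, (p.height : ℤ)) : ℤ × ℤ) ∈ visited (w₁ ++ [Step.west]) :=
    visited_subset_append _ _ (he₁ ▸ endPt_mem_visited w₁)
  obtain ⟨v, hv, hv1, hv2⟩ := h.inv.row_wit hr
  have hv : v ∈ visited (w₁ ++ [Step.west]) := by
    refine visited_subset_append _ _ ?_
    rw [key]
    exact visited_subset_append _ _ hv
  have hv' : v = ((p.width : ℤ), v.2) := by rw [← hv1]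
  rw [isAlmostClosed_iff] at hc
  have hsub : visited (w₁ ++ [Step.west]) ⊆ visited (w₁ ++ [Step.west] ++ w₂) :=
    visited_subset_append _ _
  have habs := hc.2
  have habs1 := abs_nonneg (endPt (w₁ ++ [Step.west] ++ w₂)).1
  have habs2 := abs_nonneg (endPt (w₁ ++ [Step.west] ++ w₂)).2
  rcases hg.onSide with hs | hs | hs
  · exfalso
    have hle := hs _ (hsub h0)
    have h2 := le_abs_self (endPt (w₁ ++ [Step.west] ++ w₂)).2
    simp only at hle
    have h3 : |(endPt (w₁ ++ [Step.west] ++ w₂)).1| = 0 := by omega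
    have h3 := abs_eq_zero.1 h3
    have h4 : (endPt (w₁ ++ [Step.west] ++ w₂)).2 = p.height := by omega
    rcases List.eq_nil_or_concat w₂ with rfl | ⟨r, s, rfl⟩
    · rw [List.append_nil, he₂] at h3
      simp at h3
    · rw [List.concat_eq_append, ← List.append_assoc] at *
      refine (good_snoc.1 hg).2.1.notMem ?_
      rw [← endPt_snoc]
      refine visited_subset_append _ _ ?_
      have : endPt (w₁ ++ [Step.west] ++ r ++ [s]) = (0, (p.height : ℤ)) := Prod.ext h3 h4
      rw [this]
      exact h0
  · exfalso
    have hle := hs v (hsub hv)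
    have h2 := le_abs_self (endPt (w₁ ++ [Step.west] ++ w₂)).1
    have h3 : |(endPt (w₁ ++ [Step.west] ++ w₂)).2| = 0 := by omega
    have h3 := abs_eq_zero.1 h3
    have h4 : (endPt (w₁ ++ [Step.west] ++ w₂)).1 = 1 := by omega
    have h5 : (p.width : ℤ) = 1 := by omega
    rw [hv', h5] at hv
    have := (east_barrier he₂ h0 hv2 hv hg fun v hv => (hs v hv).trans h4.le).2 h4
    omega
  · have hle := hs _ (hsub (endPt_mem_visited _))
    rw [he₂] at hle
    simp only at hle
    have h2 := neg_le_abs (endPt (w₁ ++ [Step.west] ++ w₂)).1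
    have h3 : |(endPt (w₁ ++ [Step.west] ++ w₂)).2| = 0 := by omega
    have h3 := abs_eq_zero.1 h3
    have h4 : (endPt (w₁ ++ [Step.west] ++ w₂)).1 = -1 := by omega
    rw [hv'] at hv
    rcases west_barrier he₂ h0 (by omega) hv hg fun v hv => h4.ge.trans (hs v hv) with
      ⟨j, rfl⟩ | ⟨-, hbad⟩
    · have hj : j = p.height := by
        rw [endPt_append, he₂, endPt_replicate] at h3
        simp [Step.vec] at h3
        omega
      refine Or.inr (Or.inr ⟨p, h, hr, ?_⟩)
      rw [wrap, hj, key, List.replicate_succ']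
      simp
    · have := hbad h4
      omega

lemma ccw_or_mirror {w : Walk} (hg : Good w) (hc : w.IsAlmostClosed) :
    Ccw w ∨ Ccw (mirror w) := by
  by_cases hneg : ∃ v ∈ visited w, v.1 < 0
  swap
  · push Not at hneg
    exact ccw_or_mirror_of_nonneg hg hc hneg
  by_cases hpos : ∃ v ∈ visited w, 0 < v.1
  swap
  · push Not at hpos
    have := ccw_or_mirror_of_nonneg (good_mirror.2 hg) (isAlmostClosed_mirror.2 hc)
      (visited_mirror_forall.2 fun v hv => by have := hpos v hv; simp; omega)
    rw [mirror_mirror] at this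
    exact this.symm
  obtain ⟨w₁, w₂, hw, h1, h2⟩ := exists_split_west hneg
  obtain ⟨u₁, u₂, hu, g1, g2⟩ := exists_split_west (w := mirror w)
    (visited_mirror_exists.2 (by simpa using hpos))
  have hpre : w₁ ++ [Step.west] <+: w := ⟨w₂, hw.symm⟩
  have hpre' : mirror (u₁ ++ [Step.west]) <+: w :=
    ⟨mirror u₂, by rw [← mirror_append, ← hu, mirror_mirror]⟩
  -- The prefixes ending with the first visits to `x = -1` and to `x = 1` are comparable. The longer
  -- one has already been on the other side of the axis, as the split lemma requires.
  rcases List.prefix_or_prefix_of_prefix hpre hpre' with ⟨r, hr⟩ | ⟨r, hr⟩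
  · right
    rw [hu]
    refine ccw_of_split (hu ▸ good_mirror.2 hg) (hu ▸ isAlmostClosed_mirror.2 hc) g1 g2 ?_
    have hm : endPt (w₁ ++ [Step.west]) ∈ visited (mirror (u₁ ++ [Step.west])) := by
      rw [← hr]
      exact visited_subset_append _ _ (endPt_mem_visited _)
    rw [mem_visited_mirror, mem_visited_snoc, endPt_snoc] at hm
    rcases hm with hm | hm
    · exact ⟨_, hm, by simp [h2, Step.vec]⟩
    · have := congrArg Prod.fst hm
      simp [h2, g2, Step.vec] at this
  · left
    rw [hw]
    refine ccw_of_split (hw ▸ hg) (hw ▸ hc) h1 h2 ?_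
    have hm : endPt (mirror (u₁ ++ [Step.west])) ∈ visited (w₁ ++ [Step.west]) := by
      rw [← hr]
      exact visited_subset_append _ _ (endPt_mem_visited _)
    rw [mem_visited_snoc, endPt_mirror, endPt_snoc] at hm
    rcases hm with hm | hm
    · exact ⟨_, hm, by simp [g2, Step.vec]⟩
    · have := congrArg Prod.fst hm
      simp [h2, g2, Step.vec] at this

lemma polygons_eq (n : ℕ) :
    polygons n = {w | Ccw w ∧ w.area = n} ∪ mirror '' {w | Ccw w ∧ w.area = n} := by
  ext w
  constructor
  · rintro ⟨h1, h2, h3, h4⟩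
    rcases ccw_or_mirror ⟨h1, h2⟩ h3 with h | h
    · exact Or.inl ⟨h, h4⟩
    · exact Or.inr ⟨mirror w, ⟨h, (area_mirror w).trans h4⟩, mirror_mirror w⟩
  · rintro (⟨h, h4⟩ | ⟨w, ⟨h, h4⟩, rfl⟩)
    · exact ⟨h.good.1, h.good.2, h.isAlmostClosed, h4⟩
    · have := good_mirror.2 h.good
      exact ⟨this.1, this.2, isAlmostClosed_mirror.2 h.isAlmostClosed, (area_mirror w).trans h4⟩

lemma disjoint_mirror (n : ℕ) :
    Disjoint {w | Ccw w ∧ w.area = n} (mirror '' {w | Ccw w ∧ w.area = n}) := by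
  rw [Set.disjoint_left]
  rintro _ ⟨h, -⟩ ⟨w, ⟨h', -⟩, rfl⟩
  have h1 := h.sarea_pos
  have h2 := h'.sarea_pos
  rw [sarea_mirror] at h1
  omega

open Code

/-! ### Counting codes -/

/-- The codes of area `n` and width `M` that end with a north step. -/
def rowSet (n M : ℕ) : Set Code := {p | p.Valid ∧ p.IsRow ∧ p.acc = n ∧ p.width = M}

/-- The codes of area `n` and width `M` that do not end with a north step. -/
def colSet (n M : ℕ) : Set Code := {p | p.Valid ∧ ¬ p.IsRow ∧ p.acc = n ∧ p.width = M}

/-- The codes of bar graphs of area `n`. -/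
def barSet (n : ℕ) : Set Code := {b | IsBar b ∧ b.acc + b.width = n}

/-- The last letter is removed. The guards keep truncated subtraction from inventing predecessors of
area 0. -/
lemma rowSet_eq (n M : ℕ) : rowSet n M =
    (⋃ x ∈ (Finset.range (M + 1) : Set ℕ),
      (fun p => row p x) '' (if x + 1 ≤ n then rowSet (n - (x + 1)) M else ∅)) ∪
    up '' (if M + 1 ≤ n then colSet (n - (M + 1)) M else ∅) := by
  ext p
  simp only [Set.mem_union, Set.mem_iUnion, Set.mem_image, Finset.coe_range, Set.mem_Iio]
  constructor
  · rintro ⟨h, hr, ha, hw⟩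
    cases p with
    | start => exact hr.elim
    | row p x =>
      obtain ⟨h1, h2, h3⟩ := h
      simp only [acc, width] at ha hw
      refine Or.inl ⟨x, by omega, p, ?_, rfl⟩
      rw [if_pos (by omega)]
      exact ⟨h1, h2, by omega, hw⟩
    | up p =>
      obtain ⟨h1, h2⟩ := h
      simp only [acc, width] at ha hw
      refine Or.inr ⟨p, ?_, rfl⟩
      rw [if_pos (by omega)]
      exact ⟨h1, h2, by omega, hw⟩
    | ext p => exact hr.elim
    | col p c => exact hr.elim
  · rintro (⟨x, hx, p, hp, rfl⟩ | ⟨p, hp, rfl⟩)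
    · split_ifs at hp with hn
      · obtain ⟨h1, h2, h3, h4⟩ := hp
        exact ⟨⟨h1, h2, by omega⟩, trivial, by simp only [acc]; omega, h4⟩
      · exact hp.elim
    · split_ifs at hp with hn
      · obtain ⟨h1, h2, h3, h4⟩ := hp
        exact ⟨⟨h1, h2⟩, trivial, by simp only [acc]; omega, h4⟩
      · exact hp.elim

lemma colSet_zero (n : ℕ) : colSet n 0 = if n = 0 then {start} else ∅ := by
  ext p
  constructor
  · rintro ⟨-, hr, ha, hw⟩
    have := eq_start_of_width hr hw
    subst this
    simp only [acc] at ha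
    simp [← ha]
  · intro hp
    split_ifs at hp with hn
    · rw [Set.mem_singleton_iff.1 hp]
      exact ⟨trivial, id, hn.symm, rfl⟩
    · exact hp.elim

lemma colSet_succ (n M : ℕ) : colSet n (M + 1) =
    ext '' rowSet n M ∪ ⋃ c ∈ (Finset.range (n + 1) : Set ℕ),
      (fun p => col p c) '' colSet (n - c) M := by
  ext p
  simp only [Set.mem_union, Set.mem_iUnion, Set.mem_image, Finset.coe_range, Set.mem_Iio]
  constructor
  · rintro ⟨h, hr, ha, hw⟩
    cases p with
    | start => simp [width] at hw
    | row p x => exact (hr trivial).elim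
    | up p => exact (hr trivial).elim
    | ext p =>
      obtain ⟨h1, h2⟩ := h
      simp only [acc, width] at ha hw
      exact Or.inl ⟨p, ⟨h1, h2, ha, by omega⟩, rfl⟩
    | col p c =>
      obtain ⟨h1, h2⟩ := h
      simp only [acc, width] at ha hw
      exact Or.inr ⟨c, by omega, p, ⟨h1, h2, by omega, by omega⟩, rfl⟩
  · rintro (⟨p, ⟨h1, h2, h3, h4⟩, rfl⟩ | ⟨c, hc, p, ⟨h1, h2, h3, h4⟩, rfl⟩)
    · exact ⟨⟨h1, h2⟩, id, h3, by simp only [width]; omega⟩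
    · exact ⟨⟨h1, h2⟩, id, by simp only [acc]; omega, by simp only [width]; omega⟩

/-- Every letter increases the area or the width, whence the induction on `n + M`. -/
lemma finite_rowSet_colSet (n M : ℕ) : (rowSet n M).Finite ∧ (colSet n M).Finite := by
  induction hN : n + M using Nat.strong_induction_on generalizing n M with
  | _ N ih =>
    subst hN
    constructor
    · rw [rowSet_eq]
      refine Set.Finite.union (Set.Finite.biUnion (Finset.finite_toSet _) fun x _ => ?_) ?_
      · split_ifs with h
        · exact (ih _ (by omega) _ _ rfl).1.image _
        · simp
      · split_ifs with h
        · exact (ih _ (by omega) _ _ rfl).2.image _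
        · simp
    · cases M with
      | zero =>
        rw [colSet_zero]
        split_ifs <;> simp
      | succ M =>
        rw [colSet_succ]
        refine Set.Finite.union ((ih _ (by omega) _ _ rfl).1.image _)
          (Set.Finite.biUnion (Finset.finite_toSet _) fun c hc => ?_)
        have := Finset.mem_range.1 (Finset.mem_coe.1 hc)
        exact (ih _ (by omega) _ _ rfl).2.image _

lemma finite_rowSet (n M : ℕ) : (rowSet n M).Finite := (finite_rowSet_colSet n M).1

lemma finite_colSet (n M : ℕ) : (colSet n M).Finite := (finite_rowSet_colSet n M).2

/-- The number of codes of area `n` and width `M` that end with a north step. -/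
noncomputable def aCount (n M : ℕ) : ℕ := (rowSet n M).ncard

/-- The number of codes of area `n` and width `M` that do not end with a north step. -/
noncomputable def bCount (n M : ℕ) : ℕ := (colSet n M).ncard

/-- The number of bar graphs of area `n`. -/
noncomputable def barCount (n : ℕ) : ℕ := (barSet n).ncard

lemma ncard_biUnion_image {k : ℕ} {g : Code → ℕ → Code} {s : ℕ → Set Code}
    (hg : ∀ p p' x x', g p x = g p' x' → p = p' ∧ x = x') (hs : ∀ x, (s x).Finite) :
    (⋃ x ∈ (Finset.range k : Set ℕ), (fun p => g p x) '' s x).ncard =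
      ∑ x ∈ Finset.range k, (s x).ncard := by
  rw [Set.Finite.ncard_biUnion (Finset.finite_toSet _) (fun x _ => (hs x).image _),
    finsum_mem_coe_finset]
  · exact Finset.sum_congr rfl fun x _ =>
      Set.ncard_image_of_injective _ fun p p' h => (hg _ _ _ _ h).1
  · intro x _ x' _ hne
    rw [Function.onFun, Set.disjoint_left]
    rintro _ ⟨p, -, rfl⟩ ⟨p', -, h⟩
    exact hne (hg _ _ _ _ h).2.symm

lemma aCount_eq (n M : ℕ) : aCount n M =
    ∑ x ∈ Finset.range (M + 1), (if x + 1 ≤ n then aCount (n - (x + 1)) M else 0) +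
      if M + 1 ≤ n then bCount (n - (M + 1)) M else 0 := by
  have h1 : ∀ x, (if x + 1 ≤ n then rowSet (n - (x + 1)) M else ∅ : Set Code).Finite := by
    intro x
    split_ifs
    · exact finite_rowSet _ _
    · simp
  have h2 : (if M + 1 ≤ n then colSet (n - (M + 1)) M else ∅ : Set Code).Finite := by
    split_ifs
    · exact finite_colSet _ _
    · simp
  rw [aCount, rowSet_eq, Set.ncard_union_eq ?_
    (Set.Finite.biUnion (Finset.finite_toSet _) fun x _ => (h1 x).image _) (h2.image _), ncard_biUnion_image (g := row) (by simp) h1,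
    Set.ncard_image_of_injective _ fun p p' h => by simpa using h]
  · simp only [aCount, bCount]
    congr 1
    · refine Finset.sum_congr rfl fun x _ => ?_
      split_ifs <;> simp
    · split_ifs <;> simp
  · rw [Set.disjoint_left]
    intro p hp hp'
    simp only [Set.mem_iUnion] at hp
    obtain ⟨x, -, p', -, rfl⟩ := hp
    obtain ⟨p'', -, h⟩ := hp'
    simp at h

lemma bCount_zero (n : ℕ) : bCount n 0 = if n = 0 then 1 else 0 := by
  rw [bCount, colSet_zero]
  split_ifs <;> simp

lemma bCount_succ (n M : ℕ) : bCount n (M + 1) =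
    aCount n M + ∑ c ∈ Finset.range (n + 1), bCount (n - c) M := by
  rw [bCount, colSet_succ, Set.ncard_union_eq ?_ ((finite_rowSet _ _).image _)
      (Set.Finite.biUnion (Finset.finite_toSet _) fun x _ => (finite_colSet _ _).image _),
    ncard_biUnion_image (g := col) (by simp) fun c => finite_colSet (n - c) M,
    Set.ncard_image_of_injective _ fun p p' h => by simpa using h]
  · rfl
  · rw [Set.disjoint_left]
    rintro _ ⟨p, -, rfl⟩ hp
    simp only [Set.mem_iUnion] at hp
    obtain ⟨x, -, p', -, h⟩ := hp
    simp at h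

lemma barSet_zero : barSet 0 = {start} := by
  ext b
  constructor
  · rintro ⟨⟨-, hr, -⟩, h⟩
    exact eq_start_of_width hr (by omega)
  · rintro rfl
    exact ⟨⟨trivial, id, rfl⟩, rfl⟩

lemma barSet_succ (n : ℕ) : barSet (n + 1) =
    ⋃ c ∈ (Finset.range (n + 1) : Set ℕ), (fun p => col p c) '' barSet (n - c) := by
  ext b
  simp only [Set.mem_iUnion, Set.mem_image, Finset.coe_range, Set.mem_Iio]
  constructor
  · rintro ⟨⟨h, hr, hh⟩, ha⟩
    cases b with
    | start => simp [acc, width] at ha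
    | row p x => exact (hr trivial).elim
    | up p => exact (hr trivial).elim
    | ext p =>
      have := height_pos h.2
      simp only [height] at hh
      omega
    | col p c =>
      simp only [acc, width] at ha
      exact ⟨c, by omega, p, ⟨⟨h.1, h.2, hh⟩, by omega⟩, rfl⟩
  · rintro ⟨c, hc, b, ⟨⟨h, hr, hh⟩, ha⟩, rfl⟩
    exact ⟨⟨⟨h, hr⟩, id, hh⟩, by simp only [acc, width]; omega⟩

lemma finite_barSet (n : ℕ) : (barSet n).Finite := by
  induction n using Nat.strong_induction_on with
  | _ n ih =>
    cases n with
    | zero => simp [barSet_zero]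
    | succ n =>
      rw [barSet_succ]
      exact Set.Finite.biUnion (Finset.finite_toSet _) fun c _ => (ih _ (by omega)).image _

lemma barCount_succ (n : ℕ) :
    barCount (n + 1) = ∑ c ∈ Finset.range (n + 1), barCount (n - c) := by
  rw [barCount, barSet_succ, ncard_biUnion_image (g := col) (by simp) fun c => finite_barSet (n - c)]
  rfl

/-- A bar of depth `c` contributes `c + 1` to the area, so bar graphs are compositions. -/
lemma barCount_eq (n : ℕ) : barCount (n + 1) = 2 ^ n := by
  induction n with
  | zero =>
    rw [barCount_succ]
    simp [barCount, barSet_zero]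
  | succ n ih =>
    rw [barCount_succ, Finset.sum_range_succ', pow_succ, ← ih]
    simp only [Nat.reduceSubDiff, tsub_zero, ← barCount_succ]
    ring

/-! ### Counting polygons -/

/-- The most recent `up` letter contributes `width + 1`, and the `row` letters after it leave the
width unchanged. Hence only widths below the area occur. -/
lemma width_lt_acc {p : Code} (h : p.Valid) (hr : p.IsRow) : p.width < p.acc := by
  induction p with
  | start => exact hr.elim
  | row p x ih =>
    have := ih h.1 h.2.1
    simp only [width, acc]
    omega
  | up p ih =>
    simp only [width, acc]
    omega
  | ext p ih => exact hr.elim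
  | col p c ih => exact hr.elim

lemma run_bar {b : Code} (h : IsBar b) (hw : 1 ≤ b.width) : (run (bar b)).1 = up b := by
  obtain ⟨k, hk⟩ := Nat.exists_eq_add_of_le' hw
  rw [bar, hk, run_west (p := up b) trivial (run_word h.valid_up)]

lemma run_wrap {p : Code} (h : p.Valid) (hr : p.IsRow) : (run (wrap p)).1 = p := by
  have hw := run_west hr (run_word h) p.xpos
  rw [wrap, run_append_south, hw]
  rw [hw]
  exact hr

lemma setOf_ccw_zero : {w | Ccw w ∧ w.area = 0} = ∅ := by
  ext w
  simp only [Set.mem_ofPred_eq, Set.mem_empty_iff_false, iff_false, not_and]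
  intro h ha
  have := h.sarea_pos
  have := h.area
  omega

lemma setOf_ccw_succ (n : ℕ) : {w | Ccw w ∧ w.area = n + 1} =
    ({hook (n + 1)} ∪ bar '' barSet (n + 1)) ∪
      wrap '' ⋃ M ∈ (Finset.range (n + 1) : Set ℕ), rowSet (n + 1) M := by
  ext w
  constructor
  · rintro ⟨h, ha⟩
    have hs := h.area
    rcases h with ⟨m, -, rfl⟩ | ⟨b, hb, -, rfl⟩ | ⟨p, h, hr, rfl⟩
    · rw [sarea_hook] at hs
      left; left
      have : m = n + 1 := by omega
      rw [this]; rfl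
    · rw [sarea_bar hb] at hs
      exact Or.inl (Or.inr ⟨b, ⟨hb, by omega⟩, rfl⟩)
    · rw [sarea_wrap h hr] at hs
      refine Or.inr ⟨p, ?_, rfl⟩
      have := width_lt_acc h hr
      simp only [Set.mem_iUnion, Finset.coe_range, Set.mem_Iio]
      exact ⟨p.width, by omega, h, hr, by omega, rfl⟩
  · rintro ((rfl | ⟨b, ⟨hb, ha⟩, rfl⟩) | ⟨p, hp, rfl⟩)
    · have h : Ccw (hook (n + 1)) := Or.inl ⟨n + 1, by omega, rfl⟩
      have := h.area
      rw [sarea_hook] at this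
      exact ⟨h, by omega⟩
    · have hw : 1 ≤ b.width := by
        by_contra hw
        have := eq_start_of_width hb.2.1 (by omega)
        subst this
        simp [acc, width] at ha
      have h : Ccw (bar b) := Or.inr (Or.inl ⟨b, hb, hw, rfl⟩)
      have := h.area
      rw [sarea_bar hb] at this
      exact ⟨h, by omega⟩
    · simp only [Set.mem_iUnion] at hp
      obtain ⟨M, -, h1, hr, h3, -⟩ := hp
      have h : Ccw (wrap p) := Or.inr (Or.inr ⟨p, h1, hr, rfl⟩)
      have := h.area
      rw [sarea_wrap h1 hr] at this
      exact ⟨h, by omega⟩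

lemma finite_iUnion_rowSet (n : ℕ) :
    (⋃ M ∈ (Finset.range (n + 1) : Set ℕ), rowSet (n + 1) M).Finite :=
  Set.Finite.biUnion (Finset.finite_toSet _) fun _ _ => finite_rowSet _ _

lemma finite_ccw (n : ℕ) : {w | Ccw w ∧ w.area = n}.Finite := by
  cases n with
  | zero => rw [setOf_ccw_zero]; exact Set.finite_empty
  | succ n =>
    rw [setOf_ccw_succ]
    exact ((Set.finite_singleton _).union ((finite_barSet _).image _)).union
      ((finite_iUnion_rowSet n).image _)

/-- The three families end at the distinct nodes (1,0), (0,1) and (-1,0); within the last two, `run`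
recovers the code. -/
lemma ncard_ccw (n : ℕ) : {w | Ccw w ∧ w.area = n + 1}.ncard =
    1 + 2 ^ n + ∑ M ∈ Finset.range (n + 1), aCount (n + 1) M := by
  have hbar : ∀ b ∈ barSet (n + 1), 1 ≤ b.width := by
    rintro b ⟨hb, ha⟩
    by_contra hw
    have := eq_start_of_width hb.2.1 (by omega)
    subst this
    simp [acc, width] at ha
  rw [setOf_ccw_succ, Set.ncard_union_eq ?_
      ((Set.finite_singleton _).union ((finite_barSet _).image _))
      ((finite_iUnion_rowSet n).image _),
    Set.ncard_union_eq ?_ (Set.finite_singleton _) ((finite_barSet _).image _),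
    Set.ncard_singleton, Set.InjOn.ncard_image, Set.InjOn.ncard_image, Set.Finite.ncard_biUnion,
    finsum_mem_coe_finset, ← barCount, barCount_eq]
  · rfl
  · exact Finset.finite_toSet _
  · exact fun M _ => finite_rowSet _ _
  · intro M _ M' _ hne
    rw [Function.onFun, Set.disjoint_left]
    rintro p ⟨-, -, -, h1⟩ ⟨-, -, -, h2⟩
    exact hne (h1.symm.trans h2)
  · intro p hp p' hp' he
    simp only [Set.mem_iUnion] at hp hp'
    obtain ⟨M, -, h1, hr, -⟩ := hp
    obtain ⟨M', -, h1', hr', -⟩ := hp'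
    rw [← run_wrap h1 hr, ← run_wrap h1' hr', he]
  · intro b hb b' hb' he
    have h1 := run_bar hb.1 (hbar b hb)
    have h2 := run_bar hb'.1 (hbar b' hb')
    rw [he, h2] at h1
    simpa using h1.symm
  · rw [Set.disjoint_left]
    rintro _ rfl ⟨b, hb, he⟩
    have := congrArg endPt he
    rw [endPt_bar hb.1, endPt_hook] at this
    simp at this
  · rw [Set.disjoint_left]
    intro w hw hw'
    obtain ⟨p, hp, rfl⟩ := hw'
    simp only [Set.mem_iUnion] at hp
    obtain ⟨M, -, h1, hr, -⟩ := hp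
    rcases hw with hw | ⟨b, hb, hw⟩
    · have := congrArg endPt hw
      rw [endPt_wrap h1 hr, endPt_hook] at this
      simp at this
    · have := congrArg endPt hw
      rw [endPt_wrap h1 hr, endPt_bar hb.1] at this
      simp at this

lemma finite_polygons (n : ℕ) : (polygons n).Finite := by
  rw [polygons_eq]
  exact (finite_ccw n).union ((finite_ccw n).image _)

lemma ncard_polygons (n : ℕ) : (polygons n).ncard = 2 * {w | Ccw w ∧ w.area = n}.ncard := by
  rw [polygons_eq, Set.ncard_union_eq (disjoint_mirror n) (finite_ccw n) ((finite_ccw n).image _),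
    Set.ncard_image_of_injective _ mirror_injective]
  ring

lemma ncard_polygons_zero : (polygons 0).ncard = 0 := by
  rw [ncard_polygons, setOf_ccw_zero]
  simp

lemma ncard_polygons_succ (n : ℕ) : (polygons (n + 1)).ncard =
    2 * (1 + 2 ^ n + ∑ M ∈ Finset.range (n + 1), aCount (n + 1) M) := by
  rw [ncard_polygons, ncard_ccw]

lemma aCount_eq_zero {n M : ℕ} (h : n ≤ M) : aCount n M = 0 := by
  rw [aCount, Set.ncard_eq_zero (finite_rowSet _ _), Set.eq_empty_iff_forall_notMem]
  rintro p ⟨h1, h2, h3, h4⟩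
  have := width_lt_acc h1 h2
  omega

/-! ### Power series expansions -/

lemma hasFPowerSeriesAt_of_hasSum {c : ℕ → ℂ} {g : ℂ → ℂ}
    (h : ∀ᶠ z in 𝓝 (0 : ℂ), HasSum (fun n => c n * z ^ n) (g z)) :
    HasFPowerSeriesAt g (FormalMultilinearSeries.ofScalars ℂ c) 0 := by
  rw [hasFPowerSeriesAt_iff]
  filter_upwards [h] with z hz
  simpa [FormalMultilinearSeries.coeff_ofScalars, mul_comm] using hz

lemma iteratedDeriv_div_factorial {c : ℕ → ℂ} {g : ℂ → ℂ}
    (h : ∀ᶠ z in 𝓝 (0 : ℂ), HasSum (fun n => c n * z ^ n) (g z)) (n : ℕ) :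
    iteratedDeriv n g 0 / (n.factorial : ℂ) = c n := by
  obtain ⟨r, hr⟩ := hasFPowerSeriesAt_of_hasSum h
  have := hr.factorial_smul 1 n
  rw [iteratedDeriv_eq_iteratedFDeriv, div_eq_iff (by exact_mod_cast n.factorial_ne_zero)]
  rw [show (fun _ : Fin n => (1 : ℂ)) = fun _ => 1 from rfl] at this
  rw [← this]
  simp [FormalMultilinearSeries.ofScalars, mul_comm]

/-! ### The infinite `q`-Pochhammer symbol -/

lemma summable_qPoch (x : ℂ) {q : ℂ} (hq : ‖q‖ < 1) : Summable fun j : ℕ => ‖-(x * q ^ j)‖ := by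
  simp only [norm_neg, norm_mul, norm_pow]
  exact (summable_geometric_of_lt_one (norm_nonneg _) hq).mul_left _

lemma multipliable_qPoch (x : ℂ) {q : ℂ} (hq : ‖q‖ < 1) :
    Multipliable fun j : ℕ => 1 - x * q ^ j := by
  simp only [sub_eq_add_neg]
  exact multipliable_one_add_of_summable (summable_qPoch x hq)

lemma qPoch_ne_zero {x q : ℂ} (hq : ‖q‖ < 1) (h : ∀ j : ℕ, x * q ^ j ≠ 1) : qPoch x q ≠ 0 := by
  simp only [qPoch, sub_eq_add_neg]
  refine tprod_one_add_ne_zero_of_summable (fun j => ?_) (summable_qPoch x hq)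
  rw [← sub_eq_add_neg, sub_ne_zero]
  exact (h j).symm

lemma qPoch_ne_zero_of_norm_lt {x q : ℂ} (hq : ‖q‖ < 1) (hx : ‖x‖ < 1) : qPoch x q ≠ 0 := by
  refine qPoch_ne_zero hq fun j h => ?_
  have h1 : ‖x * q ^ j‖ < 1 := by
    rw [norm_mul, norm_pow]
    exact mul_lt_one_of_nonneg_of_lt_one_left (norm_nonneg _) hx
      (pow_le_one₀ (norm_nonneg _) hq.le)
  rw [h, norm_one] at h1
  exact lt_irrefl _ h1

lemma qPoch_eq_mul (x : ℂ) {q : ℂ} (hq : ‖q‖ < 1) :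
    qPoch x q = (1 - x) * qPoch (x * q) q := by
  have e : (fun j : ℕ => 1 - x * q ^ (j + 1)) = fun j : ℕ => 1 - x * q * q ^ j := by
    ext j; rw [pow_succ']; ring
  have h := multipliable_qPoch (x * q) hq
  rw [← e] at h
  have := tprod_eq_zero_mul' (f := fun j : ℕ => 1 - x * q ^ j) h
  rw [e] at this
  simpa [qPoch] using this

lemma differentiableOn_tprod {U : Set ℂ} (hU : IsOpen U) {b : ℕ → ℝ} (hb : Summable b)
    {h : ℕ → ℂ → ℂ} (hd : ∀ j, DifferentiableOn ℂ (h j) U) (hle : ∀ j, ∀ z ∈ U, ‖h j z‖ ≤ b j) :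
    DifferentiableOn ℂ (fun z => ∏' j, (1 + h j z)) U :=
  (hb.hasProdLocallyUniformlyOn_nat_one_add hU (.of_forall hle)
    fun j => (hd j).continuousOn).differentiableOn
    (.of_forall fun _ => by
      simpa [Finset.prod_fn] using DifferentiableOn.finsetProd fun j _ => (hd j).const_add 1) hU

lemma differentiableOn_qPoch {U : Set ℂ} (hU : IsOpen U) {g k : ℂ → ℂ} {B r : ℝ} (hr0 : 0 ≤ r)
    (hr : r < 1) (hg : DifferentiableOn ℂ g U) (hk : DifferentiableOn ℂ k U)
    (hgB : ∀ z ∈ U, ‖g z‖ ≤ B) (hkr : ∀ z ∈ U, ‖k z‖ ≤ r) :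
    DifferentiableOn ℂ (fun z => qPoch (g z) (k z)) U := by
  simp only [qPoch, sub_eq_add_neg]
  refine differentiableOn_tprod hU ((summable_geometric_of_lt_one hr0 hr).mul_left B)
    (fun j => (hg.mul (hk.pow j)).neg) fun j z hz => ?_
  rw [norm_neg, norm_mul, norm_pow]
  have := hgB z hz
  have := (norm_nonneg _).trans this
  gcongr
  exact hkr z hz

lemma continuous_qPoch {q : ℂ} (hq : ‖q‖ < 1) : Continuous fun x => qPoch x q := by
  rw [continuous_iff_continuousAt]
  intro x
  refine (differentiableOn_qPoch (B := ‖x‖ + 1) (U := Metric.ball 0 (‖x‖ + 1)) Metric.isOpen_ball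
    (norm_nonneg q) hq differentiableOn_id (differentiableOn_const q) (fun z hz => ?_)
    fun z _ => le_rfl).continuousOn.continuousAt (Metric.isOpen_ball.mem_nhds ?_)
  · simpa using (mem_ball_zero_iff.1 hz).le
  · simp

/-! ### The coefficients of `1 / Q` -/

/-- The `q`-binomial coefficients in the expansion of `1 / Q`. -/
noncomputable def qCoeff (ν : ℕ) (q : ℂ) : ℂ :=
  ∏ i ∈ Finset.range ν, (v q - u q * q ^ (i + 1)) / (1 - q ^ (i + 1))

lemma qCoeff_zero (q : ℂ) : qCoeff 0 q = 1 := by simp [qCoeff]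

lemma one_sub_norm_le (q : ℂ) : 1 - ‖q‖ ≤ ‖1 - q‖ := by
  simpa using norm_sub_norm_le 1 q

lemma one_sub_ne_zero {q : ℂ} (hq : ‖q‖ < 1) : 1 - q ≠ 0 := by
  intro h
  have := one_sub_norm_le q
  rw [h, norm_zero] at this
  linarith

lemma one_sub_pow_ne_zero {q : ℂ} (hq : ‖q‖ < 1) (n : ℕ) : 1 - q ^ (n + 1) ≠ 0 :=
  one_sub_ne_zero (by rw [norm_pow]; exact pow_lt_one₀ (norm_nonneg _) hq (by omega))

lemma qCoeff_succ {q : ℂ} (hq : ‖q‖ < 1) (ν : ℕ) :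
    qCoeff (ν + 1) q * (1 - q ^ (ν + 1)) = (v q - u q * q ^ (ν + 1)) * qCoeff ν q := by
  have := one_sub_pow_ne_zero hq ν
  rw [qCoeff, Finset.prod_range_succ, ← qCoeff]
  field_simp

lemma v_eq {q : ℂ} (hq : ‖q‖ < 1) : v q = 1 + q ^ 2 / (1 - q) := by
  have := one_sub_ne_zero hq
  rw [v]
  field_simp

lemma norm_u_le {q : ℂ} (hq : ‖q‖ ≤ 55 / 100) : ‖u q‖ ≤ 11 / 9 := by
  have h1 := one_sub_norm_le q
  rw [u, norm_div, div_le_iff₀ (by linarith)]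
  linarith

lemma norm_v_le {q : ℂ} (hq : ‖q‖ ≤ 55 / 100) : ‖v q‖ ≤ 16723 / 10000 := by
  have h1 := one_sub_norm_le q
  have h2 : ‖q ^ 2 / (1 - q)‖ ≤ 6723 / 10000 := by
    rw [norm_div, norm_pow, div_le_iff₀ (by linarith)]
    nlinarith [norm_nonneg q]
  rw [v_eq (by linarith)]
  refine (norm_add_le _ _).trans ?_
  rw [norm_one]
  linarith

lemma norm_factor_le {q : ℂ} (hq : ‖q‖ ≤ 55 / 100) {y b : ℝ} {n : ℕ} (hy : ‖q ^ n‖ ≤ y)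
    (hy1 : y < 1) (hb : 16723 / 10000 + 11 / 9 * y ≤ b * (1 - y)) (hb0 : 0 ≤ b) :
    ‖(v q - u q * q ^ n) / (1 - q ^ n)‖ ≤ b := by
  have h1 := one_sub_norm_le (q ^ n)
  rw [norm_div, div_le_iff₀ (by linarith)]
  have h2 : ‖v q - u q * q ^ n‖ ≤ 16723 / 10000 + 11 / 9 * y := by
    refine (norm_sub_le _ _).trans (add_le_add (norm_v_le hq) ?_)
    rw [norm_mul]
    exact mul_le_mul (norm_u_le hq) hy (norm_nonneg _) (by norm_num)
  refine h2.trans (hb.trans ?_)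
  gcongr
  linarith

lemma norm_qCoeff_le_pow {q : ℂ} (hq : ‖q‖ ≤ 55 / 100) (ν : ℕ) : ‖qCoeff ν q‖ ≤ 6 ^ ν := by
  rw [qCoeff]
  refine (Finset.norm_prod_le _ _).trans ?_
  refine (Finset.prod_le_prod (fun _ _ => norm_nonneg _) (g := fun _ => (6 : ℝ))
    fun i _ => ?_).trans (by simp)
  refine norm_factor_le hq (y := 55 / 100) ?_ (by norm_num) (by norm_num) (by norm_num)
  rw [norm_pow, pow_succ]
  exact (mul_le_of_le_one_left (norm_nonneg _)
    (pow_le_one₀ (norm_nonneg _) (by linarith))).trans hq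

/-- The factors approach `v q`, whose norm is at most 1.6723 < 7/4. The first seven are bounded
crudely by 6, the later ones by 7/4. What matters is 7/4 · 0.55 < 1, and that 1/Q is represented by
its series for |z| < 4/7. -/
lemma norm_qCoeff_le {q : ℂ} (hq : ‖q‖ ≤ 55 / 100) (ν : ℕ) :
    ‖qCoeff ν q‖ ≤ 6 ^ 7 * (7 / 4) ^ ν := by
  rcases le_total ν 7 with h | h
  · calc ‖qCoeff ν q‖ ≤ 6 ^ ν := norm_qCoeff_le_pow hq ν
      _ ≤ 6 ^ 7 * 1 := by
        rw [mul_one]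
        exact pow_le_pow_right₀ (by norm_num) h
      _ ≤ 6 ^ 7 * (7 / 4) ^ ν := by
        gcongr
        exact one_le_pow₀ (by norm_num)
  · obtain ⟨n, rfl⟩ := Nat.exists_eq_add_of_le h
    have key : ∀ n : ℕ, ‖qCoeff (7 + n) q‖ ≤ 6 ^ 7 * (7 / 4) ^ n := by
      intro n
      induction n with
      | zero => simpa using norm_qCoeff_le_pow hq 7
      | succ n ih =>
        rw [← add_assoc, qCoeff, Finset.prod_range_succ, ← qCoeff, norm_mul,
          pow_succ (7 / 4 : ℝ), ← mul_assoc]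
        refine mul_le_mul ih ?_ (norm_nonneg _) (by positivity)
        -- From the eighth factor on, (1.6723 + 11/9 · 0.55^8) / (1 - 0.55^8) < 1.70.
        refine norm_factor_le hq (y := (55 / 100) ^ 8) ?_ (by norm_num) (by norm_num) (by norm_num)
        rw [norm_pow]
        calc ‖q‖ ^ (7 + n + 1) ≤ (55 / 100) ^ (7 + n + 1) := by gcongr
          _ ≤ (55 / 100) ^ 8 := pow_le_pow_of_le_one (by norm_num) (by norm_num) (by omega)
    refine (key n).trans (mul_le_mul_of_nonneg_left ?_ (by norm_num))
    exact pow_le_pow_right₀ (by norm_num) (by omega)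

/-- The power series of `1 / Q`. -/
noncomputable def qSeries (z q : ℂ) : ℂ := ∑' ν : ℕ, qCoeff ν q * z ^ ν

lemma summable_qSeries {z q : ℂ} (hq : ‖q‖ ≤ 55 / 100) (hz : ‖z‖ < 4 / 7) :
    Summable fun ν : ℕ => qCoeff ν q * z ^ ν := by
  refine Summable.of_norm_bounded (g := fun ν : ℕ => 6 ^ 7 * (7 / 4 * ‖z‖) ^ ν) ?_ fun ν => ?_
  · refine (summable_geometric_of_lt_one (by positivity) ?_).mul_left _
    linarith
  · rw [norm_mul, norm_pow, mul_pow, ← mul_assoc]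
    gcongr
    exact norm_qCoeff_le hq ν

lemma hasSum_qSeries {z q : ℂ} (hq : ‖q‖ ≤ 55 / 100) (hz : ‖z‖ < 4 / 7) :
    HasSum (fun ν : ℕ => qCoeff ν q * z ^ ν) (qSeries z q) := (summable_qSeries hq hz).hasSum

lemma norm_mul_lt {z q : ℂ} {n : ℕ} (hq : ‖q‖ ≤ 55 / 100) (hz : ‖z‖ < 4 / 7) :
    ‖z * q ^ n‖ < 4 / 7 := by
  rw [norm_mul, norm_pow]
  exact (mul_le_of_le_one_right (norm_nonneg _)
    (pow_le_one₀ (norm_nonneg _) (by linarith))).trans_lt hz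

/-- Coefficientwise this is `qCoeff_succ`. -/
lemma qSeries_funEq {z q : ℂ} (hq : ‖q‖ ≤ 55 / 100) (hz : ‖z‖ < 4 / 7) :
    (1 - v q * z) * qSeries z q = (1 - q * u q * z) * qSeries (z * q) q := by
  have hs := summable_qSeries hq hz
  have hs' : Summable fun ν : ℕ => qCoeff ν q * (z * q) ^ ν :=
    summable_qSeries hq (by simpa using norm_mul_lt (n := 1) hq hz)
  have e1 : qSeries z q = 1 + ∑' ν : ℕ, qCoeff (ν + 1) q * z ^ (ν + 1) := by
    rw [qSeries, hs.tsum_eq_zero_add]; simp [qCoeff_zero]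
  have e2 : qSeries (z * q) q = 1 + ∑' ν : ℕ, qCoeff (ν + 1) q * (z * q) ^ (ν + 1) := by
    rw [qSeries, hs'.tsum_eq_zero_add]; simp [qCoeff_zero]
  have h1 := (summable_nat_add_iff 1).2 hs
  have h1' := (summable_nat_add_iff 1).2 hs'
  have key : (∑' ν : ℕ, qCoeff (ν + 1) q * z ^ (ν + 1)) - v q * z * qSeries z q =
      (∑' ν : ℕ, qCoeff (ν + 1) q * (z * q) ^ (ν + 1)) - q * u q * z * qSeries (z * q) q := by
    rw [qSeries, qSeries, ← tsum_mul_left, ← tsum_mul_left, ← h1.tsum_sub (hs.mul_left _),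
      ← h1'.tsum_sub (hs'.mul_left _)]
    refine tsum_congr fun ν => ?_
    have := qCoeff_succ (q := q) (by linarith) ν
    linear_combination z ^ (ν + 1) * this
  linear_combination key + (1 : ℂ) * e1 - e2

lemma tendsto_mul_pow {z q : ℂ} (hq : ‖q‖ < 1) :
    Filter.Tendsto (fun n : ℕ => z * q ^ n) Filter.atTop (𝓝 0) := by
  simpa using (tendsto_pow_atTop_nhds_zero_of_norm_lt_one hq).const_mul z

lemma analyticAt_qSeries {q : ℂ} (hq : ‖q‖ ≤ 55 / 100) :
    AnalyticAt ℂ (fun z => qSeries z q) 0 := by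
  refine (hasFPowerSeriesAt_of_hasSum (c := fun ν => qCoeff ν q) ?_).analyticAt
  filter_upwards [Metric.ball_mem_nhds (0 : ℂ) (show (0 : ℝ) < 4 / 7 by norm_num)] with z hz
  exact hasSum_qSeries hq (mem_ball_zero_iff.1 hz)

lemma qSeries_zero (q : ℂ) : qSeries 0 q = 1 := by
  rw [qSeries, tsum_eq_single 0 (by intro n hn; simp [hn])]
  simp [qCoeff_zero]

/-- The `q`-binomial theorem. -/
lemma qSeries_mul_qPoch {z q : ℂ} (hq : ‖q‖ ≤ 55 / 100) (hz : ‖z‖ < 4 / 7) :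
    qPoch (v q * z) q * qSeries z q = qPoch (q * u q * z) q := by
  have hq1 : ‖q‖ < 1 := by linarith
  -- The functional equation is iterated; as `n` grows, `z * q ^ n` tends to 0, where the series
  -- equals 1.
  have step : ∀ n : ℕ, (∏ j ∈ Finset.range n, (1 - v q * z * q ^ j)) * qSeries z q =
      (∏ j ∈ Finset.range n, (1 - q * u q * z * q ^ j)) * qSeries (z * q ^ n) q := by
    intro n
    induction n with
    | zero => simp
    | succ n ih =>
      have := qSeries_funEq hq (norm_mul_lt (n := n) hq hz)
      rw [Finset.prod_range_succ, Finset.prod_range_succ, pow_succ, ← mul_assoc z]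
      linear_combination (1 - v q * z * q ^ n) * ih +
        (∏ j ∈ Finset.range n, (1 - q * u q * z * q ^ j)) * this
  have l1 := ((multipliable_qPoch (v q * z) hq1).hasProd.tendsto_prod_nat).mul_const (qSeries z q)
  have l2 := (multipliable_qPoch (q * u q * z) hq1).hasProd.tendsto_prod_nat.mul
    ((analyticAt_qSeries hq).continuousAt.tendsto.comp (tendsto_mul_pow (z := z) hq1))
  rw [qSeries_zero, mul_one] at l2
  refine tendsto_nhds_unique l1 (l2.congr fun n => ?_)
  exact (step n).symm

lemma norm_v_mul_lt {z q : ℂ} (hq : ‖q‖ ≤ 55 / 100) (hz : ‖z‖ < 4 / 7) : ‖v q * z‖ < 1 := by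
  rw [norm_mul]
  nlinarith [norm_v_le hq, norm_nonneg z, norm_nonneg (v q)]

lemma one_div_Q_eq {z q : ℂ} (hq : ‖q‖ ≤ 55 / 100) (hz : ‖z‖ < 4 / 7) :
    1 / Q z q = qSeries z q := by
  have h := qSeries_mul_qPoch hq hz
  have h0 : qPoch (v q * z) q ≠ 0 :=
    qPoch_ne_zero_of_norm_lt (by linarith) (norm_v_mul_lt hq hz)
  rw [Q, one_div_div, ← h]
  field_simp

lemma d_eq {q : ℂ} (hq : ‖q‖ ≤ 55 / 100) (ν : ℕ) : d ν q = qCoeff ν q := by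
  refine iteratedDeriv_div_factorial (c := fun ν => qCoeff ν q) ?_ ν
  filter_upwards [Metric.ball_mem_nhds (0 : ℂ) (show (0 : ℝ) < 4 / 7 by norm_num)] with z hz
  rw [one_div_Q_eq hq (mem_ball_zero_iff.1 hz)]
  exact hasSum_qSeries hq (mem_ball_zero_iff.1 hz)

/-! ### The roots of `1 - 2 x + x ^ m` -/

/-- The value at `m = 4` is 4 · 0.55^3 < 0.67, and consecutive ratios are at most 0.55 · 5/4 < 1. -/
lemma mul_pow_le {m : ℕ} (hm : 4 ≤ m) : (m : ℝ) * (55 / 100) ^ (m - 1) ≤ 1 := by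
  obtain ⟨k, rfl⟩ := Nat.exists_eq_add_of_le' hm
  have key : ∀ k : ℕ, ((k : ℝ) + 4) * (55 / 100) ^ (k + 3) ≤ 1 := by
    intro k
    induction k with
    | zero => norm_num
    | succ k ih =>
      rw [show k + 1 + 3 = k + 3 + 1 by ring, pow_succ]
      have : (0 : ℝ) < (55 / 100) ^ (k + 3) := by positivity
      push_cast
      nlinarith [(Nat.cast_nonneg k : (0 : ℝ) ≤ k)]
  have := key k
  rw [show k + 4 - 1 = k + 3 by omega]
  push_cast
  exact this

/-- The cofactor of `q - z` in `(1 - 2 q + q ^ m) - (1 - 2 z + z ^ m)`. -/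
noncomputable def cofactor (m : ℕ) (z q : ℂ) : ℂ :=
  -2 + ∑ i ∈ Finset.range m, q ^ i * z ^ (m - 1 - i)

lemma sub_mul_cofactor (m : ℕ) (z q : ℂ) :
    (q - z) * cofactor m z q = (1 - 2 * q + q ^ m) - (1 - 2 * z + z ^ m) := by
  have := geom_sum₂_mul q z m
  rw [cofactor]
  linear_combination this

/-- The sum has norm at most 1 and cannot cancel -2. For distinct arguments this separates roots;
for equal arguments it shows that a root is simple. -/
lemma cofactor_ne_zero {m : ℕ} (hm : 4 ≤ m) {z q : ℂ} (hz : ‖z‖ ≤ 55 / 100)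
    (hq : ‖q‖ ≤ 55 / 100) : cofactor m z q ≠ 0 := by
  have h : ‖∑ i ∈ Finset.range m, q ^ i * z ^ (m - 1 - i)‖ ≤ 1 := by
    refine (norm_sum_le _ _).trans (le_trans ?_ (mul_pow_le hm))
    refine (Finset.sum_le_card_nsmul _ _ ((55 / 100 : ℝ) ^ (m - 1)) fun i hi => ?_).trans
      (by simp)
    rw [norm_mul, norm_pow, norm_pow]
    have : m - 1 = i + (m - 1 - i) := by have := Finset.mem_range.1 hi; omega
    rw [this, pow_add, ← this]
    gcongr
  intro h0
  rw [cofactor, neg_add_eq_zero] at h0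
  rw [← h0] at h
  norm_num at h

lemma root_unique {m : ℕ} (hm : 4 ≤ m) {z q : ℂ} (hz : ‖z‖ ≤ 55 / 100) (hq : ‖q‖ ≤ 55 / 100)
    (h1 : 1 - 2 * z + z ^ m = 0) (h2 : 1 - 2 * q + q ^ m = 0) : q = z := by
  have := sub_mul_cofactor m z q
  rw [h1, h2, sub_zero, mul_eq_zero, sub_eq_zero] at this
  exact this.resolve_right (cofactor_ne_zero hm hz hq)

/-- Together with the root 1, two roots in (0,1) would put three points of the strictly convex graph
of `x ^ m` on the line `2x - 1`. -/
lemma real_root_unique {m : ℕ} (hm : 2 ≤ m) {x y : ℝ} (hx : 0 < x) (hy : y < 1)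
    (h1 : 1 - 2 * x + x ^ m = 0) (h2 : 1 - 2 * y + y ^ m = 0) : ¬ x < y := by
  intro hxy
  have := (strictConvexOn_pow hm).slope_strict_mono_adjacent (x := x) (y := y) (z := 1)
    (Set.mem_Ici.2 hx.le) (Set.mem_Ici.2 zero_le_one) hxy hy
  rw [div_lt_div_iff₀ (by linarith) (by linarith), one_pow] at this
  have e1 : x ^ m = 2 * x - 1 := by linarith
  have e2 : y ^ m = 2 * y - 1 := by linarith
  rw [e1, e2] at this
  nlinarith

lemma exists_root {k : ℕ} (hk : 2 ≤ k) :
    ∃ x : ℝ, 1 / 2 < x ∧ x < 55 / 100 ∧ 1 - 2 * x + x ^ (k + 2) = 0 := by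
  have hcont : ContinuousOn (fun x : ℝ => 1 - 2 * x + x ^ (k + 2)) (Set.Icc (1 / 2) (55 / 100)) := by
    fun_prop
  have h1 : (0 : ℝ) < 1 - 2 * (1 / 2) + (1 / 2) ^ (k + 2) := by
    have : (0 : ℝ) < (1 / 2) ^ (k + 2) := by positivity
    linarith
  -- 0.55^4 < 0.0916 < 0.1. For exponent 3 the sign is opposite, which is why `k` starts at 2.
  have h2 : (1 - 2 * (55 / 100) + (55 / 100) ^ (k + 2) : ℝ) < 0 := by
    have : (55 / 100 : ℝ) ^ (k + 2) ≤ (55 / 100) ^ 4 :=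
      pow_le_pow_of_le_one (by norm_num) (by norm_num) (by omega)
    norm_num at this ⊢
    linarith
  obtain ⟨x, ⟨hx1, hx2⟩, hx⟩ := intermediate_value_Icc' (by norm_num) hcont ⟨h2.le, h1.le⟩
  refine ⟨x, lt_of_le_of_ne hx1 ?_, lt_of_le_of_ne hx2 ?_, hx⟩
  · rintro rfl
    exact h1.ne' hx
  · rintro rfl
    exact h2.ne hx

lemma zbar_spec {k : ℕ} (hk : 2 ≤ k) :
    1 / 2 < zbar k ∧ zbar k < 55 / 100 ∧ 1 - 2 * zbar k + zbar k ^ (k + 2) = 0 := by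
  obtain ⟨x, h1, h2, h3⟩ := exists_root hk
  have : zbar k = x := by
    refine IsLeast.csInf_eq ⟨⟨⟨by linarith, by linarith⟩, h3⟩, ?_⟩
    rintro y ⟨⟨hy0, hy1⟩, hy⟩
    rcases hy0.eq_or_lt with rfl | hy0
    · simp at hy
    · exact not_lt.1 (real_root_unique (by omega) hy0 (by linarith) hy h3)
  rw [this]
  exact ⟨h1, h2, h3⟩

lemma eq_zbar {k : ℕ} (hk : 2 ≤ k) {x : ℝ} (h0 : 0 < x) (h1 : x < 1)
    (h : 1 - 2 * x + x ^ (k + 2) = 0) : x = zbar k := by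
  obtain ⟨z1, z2, z3⟩ := zbar_spec hk
  exact le_antisymm (not_lt.1 (real_root_unique (by omega) (by linarith) h1 z3 h))
    (not_lt.1 (real_root_unique (by omega) h0 (by linarith) h z3))

lemma zbar_root {k : ℕ} (hk : 2 ≤ k) : 1 - 2 * (zbar k : ℂ) + (zbar k : ℂ) ^ (k + 2) = 0 := by
  exact_mod_cast congrArg (fun x : ℝ => (x : ℂ)) (zbar_spec hk).2.2

lemma norm_zbar_lt {k : ℕ} (hk : 2 ≤ k) : ‖(zbar k : ℂ)‖ < 55 / 100 := by
  obtain ⟨z1, z2, -⟩ := zbar_spec hk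
  rw [Complex.norm_real, Real.norm_eq_abs, abs_of_pos (by linarith)]
  exact z2

lemma zbar_ne_half {k : ℕ} (hk : 2 ≤ k) : (zbar k : ℂ) ≠ 1 / 2 := by
  intro h
  have h' : (zbar k : ℂ) = ((1 / 2 : ℝ) : ℂ) := by rw [h]; norm_num
  have := (zbar_spec hk).1
  rw [Complex.ofReal_injective h'] at this
  exact lt_irrefl _ this

lemma zbar_injective {j k : ℕ} (hj : 2 ≤ j) (hk : 2 ≤ k) (h : zbar j = zbar k) : j = k := by
  obtain ⟨z1, z2, z3⟩ := zbar_spec hj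
  obtain ⟨-, -, w3⟩ := zbar_spec hk
  rw [← h] at w3
  have := pow_right_injective₀ (a := zbar j) (by linarith) (by linarith)
    (show zbar j ^ (j + 2) = zbar j ^ (k + 2) by linarith)
  omega

/-- The defining equation reads `zbar k = 1/2 + zbar k ^ (k + 2) / 2`. -/
lemma tendsto_zbar : Filter.Tendsto zbar Filter.atTop (𝓝 (1 / 2)) := by
  have h : Filter.Tendsto (fun k : ℕ => (1 / 2 : ℝ) + (55 / 100) ^ (k + 2)) Filter.atTop
      (𝓝 (1 / 2)) := by
    have := ((Filter.tendsto_add_atTop_iff_nat 2).2 (tendsto_pow_atTop_nhds_zero_of_lt_one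
      (r := (55 / 100 : ℝ)) (by norm_num) (by norm_num))).const_add (1 / 2 : ℝ)
    rwa [add_zero] at this
  refine tendsto_of_tendsto_of_tendsto_of_le_of_le' tendsto_const_nhds h ?_ ?_
  · filter_upwards [Filter.eventually_ge_atTop 2] with k hk using (zbar_spec hk).1.le
  · filter_upwards [Filter.eventually_ge_atTop 2] with k hk
    obtain ⟨z1, z2, z3⟩ := zbar_spec hk
    have h1 : zbar k ^ (k + 2) ≤ (55 / 100) ^ (k + 2) :=
      pow_le_pow_left₀ (by linarith) z2.le _
    have h2 : (0 : ℝ) < (55 / 100) ^ (k + 2) := by positivity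
    linarith

lemma denom_ne_zero {q : ℂ} (hq : ‖q‖ < 55 / 100) {n : ℕ}
    (h : 2 ≤ n + 1 → q ≠ (zbar (n + 1) : ℂ)) : 1 - 2 * q + q ^ (n + 1 + 2) ≠ 0 := by
  cases n with
  | zero =>
    -- The exponent 3 belongs to no `zbar`; its factor `1 - q - q ^ 2` has no zero here because 0.55
    -- + 0.55^2 < 1.
    have e : 1 - 2 * q + q ^ (0 + 1 + 2) = (1 - q) * (1 - (q + q ^ 2)) := by ring
    rw [e]
    refine mul_ne_zero (one_sub_ne_zero (by linarith)) (one_sub_ne_zero ?_)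
    refine (norm_add_le _ _).trans_lt ?_
    rw [norm_pow]
    nlinarith [norm_nonneg q]
  | succ n =>
    intro h0
    exact h (by omega) (root_unique (by omega) (norm_zbar_lt (k := n + 1 + 1) (by omega)).le hq.le
      (zbar_root (by omega)) h0)

/-! ### The analytic continuation of the generating function -/

/-- The terms of the series in the formula for the generating function. -/
noncomputable def fterm (n : ℕ) (q : ℂ) : ℂ :=
  qCoeff (n + 1) q * (q ^ (n + 1 + 2) / (1 - 2 * q + q ^ (n + 1 + 2)))

/-- The factor in front of the series in the formula for the generating function. -/
noncomputable def pref (q : ℂ) : ℂ := A q * (qPoch (v q) q / qPoch (q * u q) q)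

/-- The continuation of the area generating function. -/
noncomputable def PAfun (q : ℂ) : ℂ :=
  C q - pref q * (q ^ 2 / (1 - q) ^ 2 + ∑' n, fterm n q)

lemma isOpen_puncturedDisc : IsOpen puncturedDisc := by
  have : puncturedDisc = Metric.ball (0 : ℂ) (55 / 100) ∩ {1 / 2}ᶜ := by
    ext q
    simp [puncturedDisc]
  rw [this]
  exact Metric.isOpen_ball.inter isOpen_compl_singleton

lemma one_sub_two_mul_ne_zero {q : ℂ} (hq : q ≠ 1 / 2) : 1 - 2 * q ≠ 0 := by
  intro h
  apply hq
  linear_combination -(1 / 2 : ℂ) * h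

lemma norm_q_mul_u_lt {q : ℂ} (hq : ‖q‖ ≤ 55 / 100) : ‖q * u q‖ < 1 := by
  rw [norm_mul]
  nlinarith [norm_u_le hq, norm_nonneg q, norm_nonneg (u q)]

lemma qPoch_qu_ne_zero {q : ℂ} (hq : ‖q‖ ≤ 55 / 100) : qPoch (q * u q) q ≠ 0 :=
  qPoch_ne_zero_of_norm_lt (by linarith) (norm_q_mul_u_lt hq)

lemma analyticAt_u {q : ℂ} (hq : ‖q‖ < 1) : AnalyticAt ℂ u q := by
  have := one_sub_ne_zero hq
  unfold u
  fun_prop (disch := assumption)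

lemma analyticAt_v {q : ℂ} (hq : ‖q‖ < 1) : AnalyticAt ℂ v q := by
  have := one_sub_ne_zero hq
  unfold v
  fun_prop (disch := assumption)

lemma analyticAt_qPoch_v {q : ℂ} (hq : ‖q‖ < 55 / 100) :
    AnalyticAt ℂ (fun q => qPoch (v q) q) q := by
  refine (differentiableOn_qPoch (U := Metric.ball 0 (55 / 100)) Metric.isOpen_ball
    (B := 16723 / 10000) (r := 55 / 100) (by norm_num) (by norm_num) (fun z hz => ?_)
    differentiableOn_id (fun z hz => ?_) (fun z hz => ?_)).analyticAt
    (Metric.isOpen_ball.mem_nhds (mem_ball_zero_iff.2 hq))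
  · have := mem_ball_zero_iff.1 hz
    exact (analyticAt_v (by linarith)).differentiableAt.differentiableWithinAt
  · exact norm_v_le (mem_ball_zero_iff.1 hz).le
  · exact (mem_ball_zero_iff.1 hz).le

lemma analyticAt_qPoch_qu {q : ℂ} (hq : ‖q‖ < 55 / 100) :
    AnalyticAt ℂ (fun q => qPoch (q * u q) q) q := by
  refine (differentiableOn_qPoch (U := Metric.ball 0 (55 / 100)) Metric.isOpen_ball
    (B := 1) (r := 55 / 100) (by norm_num) (by norm_num) (fun z hz => ?_)
    differentiableOn_id (fun z hz => ?_) (fun z hz => ?_)).analyticAt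
    (Metric.isOpen_ball.mem_nhds (mem_ball_zero_iff.2 hq))
  · have := mem_ball_zero_iff.1 hz
    exact (differentiableAt_id.mul
      (analyticAt_u (by linarith)).differentiableAt).differentiableWithinAt
  · exact (norm_q_mul_u_lt (mem_ball_zero_iff.1 hz).le).le
  · exact (mem_ball_zero_iff.1 hz).le

lemma analyticAt_pref {q : ℂ} (hq : q ∈ puncturedDisc) : AnalyticAt ℂ pref q := by
  have h0 := pow_ne_zero 2 (one_sub_two_mul_ne_zero hq.2)
  have hA : AnalyticAt ℂ A q := by
    unfold A
    fun_prop (disch := assumption)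
  exact hA.mul ((analyticAt_qPoch_v hq.1).div (analyticAt_qPoch_qu hq.1)
    (qPoch_qu_ne_zero hq.1.le))

lemma analyticAt_C {q : ℂ} (hq : q ∈ puncturedDisc) : AnalyticAt ℂ C q := by
  have h0 := pow_ne_zero 2 (one_sub_two_mul_ne_zero hq.2)
  have h1 := one_sub_ne_zero (hq.1.trans (by norm_num))
  have h2 := mul_ne_zero h1 h0
  unfold C
  fun_prop (disch := assumption)

lemma analyticAt_rat {q : ℂ} (hq : ‖q‖ < 1) :
    AnalyticAt ℂ (fun q : ℂ => q ^ 2 / (1 - q) ^ 2) q := by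
  have h1 := pow_ne_zero 2 (one_sub_ne_zero hq)
  fun_prop (disch := assumption)

lemma analyticAt_qCoeff (ν : ℕ) {q : ℂ} (hq : ‖q‖ < 1) : AnalyticAt ℂ (qCoeff ν) q := by
  have : qCoeff ν = ∏ i ∈ Finset.range ν,
      fun q : ℂ => (v q - u q * q ^ (i + 1)) / (1 - q ^ (i + 1)) := by
    ext q
    simp [qCoeff]
  rw [this]
  refine Finset.analyticAt_prod _ fun i _ => ?_
  have h1 := one_sub_pow_ne_zero hq i
  have h2 := analyticAt_u hq
  have h3 := analyticAt_v hq
  fun_prop (disch := assumption)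

lemma analyticAt_fterm {n : ℕ} {q : ℂ} (hq : ‖q‖ < 1)
    (h : 1 - 2 * q + q ^ (n + 1 + 2) ≠ 0) : AnalyticAt ℂ (fterm n) q := by
  have h1 := analyticAt_qCoeff (n + 1) hq
  unfold fterm
  fun_prop (disch := assumption)

/-! ### Convergence of the series away from 1/2 -/

lemma norm_fterm_le {q : ℂ} (hq : ‖q‖ ≤ 55 / 100) {δ : ℝ} (hδ : 0 < δ) (h : δ / 2 ≤ ‖1 - 2 * q‖)
    {n : ℕ} (hn : (55 / 100) ^ n ≤ δ / 4) :
    ‖fterm n q‖ ≤ 6 ^ 7 * (7 / 4) * (4 / δ) * (77 / 80) ^ n := by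
  have hp : ‖q ^ (n + 1 + 2)‖ ≤ (55 / 100) ^ n := by
    rw [norm_pow, add_assoc, pow_add]
    calc ‖q‖ ^ n * ‖q‖ ^ (1 + 2) ≤ (55 / 100) ^ n * 1 := by
          gcongr
          exact pow_le_one₀ (norm_nonneg _) (by linarith)
      _ = _ := mul_one _
  have hd : δ / 4 ≤ ‖1 - 2 * q + q ^ (n + 1 + 2)‖ := by
    have := norm_sub_le_norm_add (1 - 2 * q) (q ^ (n + 1 + 2))
    linarith
  rw [fterm, norm_mul, norm_div]
  have h1 := norm_qCoeff_le hq (n + 1)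
  have h2 : ‖q ^ (n + 1 + 2)‖ / ‖1 - 2 * q + q ^ (n + 1 + 2)‖ ≤ (55 / 100) ^ n / (δ / 4) := by
    gcongr
  refine (mul_le_mul h1 h2 (by positivity) (by positivity)).trans (le_of_eq ?_)
  rw [show (77 / 80 : ℝ) = 7 / 4 * (55 / 100) by norm_num, mul_pow, pow_succ (7 / 4 : ℝ)]
  field_simp

/-- Near `q₀ ≠ 1/2` the quantity |1 - 2q| stays above half its value at `q₀`, while `q ^ n` tends to
0 uniformly. All late denominators are therefore bounded away from 0. The bound `N₀` lets any finite
set of terms be split off. -/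
lemma exists_tail {q₀ : ℂ} (hq₀ : q₀ ∈ puncturedDisc) (N₀ : ℕ) :
    ∃ N, N₀ ≤ N ∧ ∃ U : Set ℂ, IsOpen U ∧ q₀ ∈ U ∧ U ⊆ puncturedDisc ∧
      (∀ q ∈ U, Summable fun n => fterm n q) ∧
      AnalyticAt ℂ (fun q => ∑' n, fterm (n + N) q) q₀ := by
  set δ := ‖1 - 2 * q₀‖ with hδ
  have hδ0 : 0 < δ := norm_pos_iff.2 (one_sub_two_mul_ne_zero hq₀.2)
  obtain ⟨N₁, hN₁⟩ := exists_pow_lt_of_lt_one (show (0 : ℝ) < δ / 4 by positivity)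
    (show (55 / 100 : ℝ) < 1 by norm_num)
  have hN : ∀ n, N₁ ≤ n → (55 / 100 : ℝ) ^ n ≤ δ / 4 := fun n hn =>
    (pow_le_pow_of_le_one (by norm_num) (by norm_num) hn).trans hN₁.le
  set U : Set ℂ := puncturedDisc ∩ {q | δ / 2 < ‖1 - 2 * q‖} with hU
  have hUo : IsOpen U := isOpen_puncturedDisc.inter
    (isOpen_lt continuous_const (by fun_prop))
  have hU₀ : q₀ ∈ U := ⟨hq₀, by simp only [Set.mem_ofPred_eq, ← hδ]; linarith⟩
  have hbound : ∀ q ∈ U, ∀ n, ‖fterm (n + max N₀ N₁) q‖ ≤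
      6 ^ 7 * (7 / 4) * (4 / δ) * (77 / 80) ^ (n + max N₀ N₁) := fun q hq n =>
    norm_fterm_le hq.1.1.le hδ0 hq.2.le (hN _ (by omega))
  have hsum : Summable fun n : ℕ =>
      6 ^ 7 * (7 / 4) * (4 / δ) * (77 / 80 : ℝ) ^ (n + max N₀ N₁) :=
    ((summable_nat_add_iff (max N₀ N₁)).2
      (summable_geometric_of_lt_one (by norm_num) (by norm_num))).mul_left _
  refine ⟨max N₀ N₁, le_max_left _ _, U, hUo, hU₀, Set.inter_subset_left, fun q hq => ?_, ?_⟩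
  · exact (summable_nat_add_iff (max N₀ N₁)).1
      (Summable.of_norm_bounded hsum fun n => hbound q hq n)
  · refine (Complex.differentiableOn_tsum_of_summable_norm hsum (fun n q hq => ?_) hUo
      fun n q hq => hbound q hq n).analyticAt (hUo.mem_nhds hU₀)
    refine (analyticAt_fterm (hq.1.1.trans (by norm_num)) ?_).differentiableAt.differentiableWithinAt
    intro h0
    have h1 := norm_sub_le_norm_add (1 - 2 * q) (q ^ (n + max N₀ N₁ + 1 + 2))
    rw [h0, norm_zero] at h1
    have h2 := hN (n + max N₀ N₁) (by omega)
    have h3 : ‖q ^ (n + max N₀ N₁ + 1 + 2)‖ ≤ (55 / 100) ^ (n + max N₀ N₁) := by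
      rw [norm_pow, add_assoc, pow_add]
      calc ‖q‖ ^ (n + max N₀ N₁) * ‖q‖ ^ (1 + 2) ≤ (55 / 100) ^ (n + max N₀ N₁) * 1 := by
            have := hq.1.1.le
            gcongr
            exact pow_le_one₀ (norm_nonneg _) (by linarith)
        _ = _ := mul_one _
    have h4 : δ / 2 < ‖1 - 2 * q‖ := hq.2
    linarith

lemma summable_fterm {q : ℂ} (hq : q ∈ puncturedDisc) : Summable fun n => fterm n q := by
  obtain ⟨N, -, U, -, hU, -, hs, -⟩ := exists_tail hq 0
  exact hs q hU

/-- All terms of the series but one form an analytic function. -/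
lemma exists_analytic_tsum {q₀ : ℂ} (hq₀ : q₀ ∈ puncturedDisc) (s : Finset ℕ)
    (h : ∀ n, n ∉ s → 1 - 2 * q₀ + q₀ ^ (n + 1 + 2) ≠ 0) :
    ∃ g : ℂ → ℂ, AnalyticAt ℂ g q₀ ∧
      ∀ᶠ q in 𝓝 q₀, ∑' n, fterm n q = ∑ n ∈ s, fterm n q + g q := by
  obtain ⟨N, hN, U, hUo, hU₀, -, hs, ha⟩ := exists_tail hq₀ (s.sup id + 1)
  refine ⟨fun q => ∑ n ∈ Finset.range N \ s, fterm n q + ∑' n, fterm (n + N) q, ?_, ?_⟩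
  · refine AnalyticAt.add ?_ ha
    refine Finset.analyticAt_fun_sum _ fun n hn => ?_
    exact analyticAt_fterm (hq₀.1.trans (by norm_num)) (h n (Finset.mem_sdiff.1 hn).2)
  · filter_upwards [hUo.mem_nhds hU₀] with q hq
    have hsub : s ⊆ Finset.range N := fun n hn => Finset.mem_range.2 <| by
      have := Finset.le_sup (f := id) hn
      simp at this
      omega
    rw [← (hs q hq).sum_add_tsum_nat_add N, ← Finset.sum_sdiff hsub]
    ring

lemma analyticAt_PAfun {q : ℂ} (hq : q ∈ puncturedDisc)
    (h : ∀ k : ℕ, 2 ≤ k → q ≠ (zbar k : ℂ)) : AnalyticAt ℂ PAfun q := by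
  obtain ⟨g, hg, he⟩ := exists_analytic_tsum hq ∅ fun n _ => denom_ne_zero hq.1 (h _)
  have : AnalyticAt ℂ (fun q => C q - pref q * (q ^ 2 / (1 - q) ^ 2 + g q)) q :=
    (analyticAt_C hq).sub ((analyticAt_pref hq).mul
      ((analyticAt_rat (hq.1.trans (by norm_num))).add hg))
  refine this.congr ?_
  filter_upwards [he] with z hz
  simp [PAfun, hz]

/-! ### The simple poles -/

lemma zbar_mem_puncturedDisc {k : ℕ} (hk : 2 ≤ k) : (zbar k : ℂ) ∈ puncturedDisc :=
  ⟨norm_zbar_lt hk, zbar_ne_half hk⟩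

/-- After clearing `1 - x`, the numerator is `(1 - x) + (x ^ 2 - x ^ (i + 2))`, which is positive.
-/
lemma qCoeff_ofReal_ne_zero {x : ℝ} (h0 : 0 < x) (h1 : x < 1) (ν : ℕ) : qCoeff ν (x : ℂ) ≠ 0 := by
  rw [qCoeff, Finset.prod_ne_zero_iff]
  intro i _
  have hx1 : x ^ (i + 1) < 1 := pow_lt_one₀ h0.le h1 (by omega)
  have hx2 : x * x ^ (i + 1) ≤ x ^ 2 := by
    rw [← pow_succ']
    exact pow_le_pow_of_le_one h0.le h1.le (by omega)
  have e : (v x - u x * (x : ℂ) ^ (i + 1)) / (1 - (x : ℂ) ^ (i + 1)) =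
      (((1 - x + x ^ 2 - x * x ^ (i + 1)) / (1 - x) / (1 - x ^ (i + 1)) : ℝ) : ℂ) := by
    rw [v, u]
    push_cast
    ring
  rw [e, Complex.ofReal_ne_zero]
  refine div_ne_zero (div_ne_zero ?_ ?_) ?_ <;> nlinarith

/-- The factor `j = 0` is `1 - v = -q ^ 2 / (1 - q)`, not zero; for `j ≥ 1` the norm of `v * q ^ j`
is below 1.6723 · 0.55 < 1. -/
lemma qPoch_v_zbar_ne_zero {k : ℕ} (hk : 2 ≤ k) : qPoch (v (zbar k)) (zbar k) ≠ 0 := by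
  obtain ⟨z1, z2, -⟩ := zbar_spec hk
  have hn := norm_zbar_lt hk
  refine qPoch_ne_zero (by linarith) fun j hj => ?_
  cases j with
  | zero =>
    rw [pow_zero, mul_one, v_eq (by linarith), add_eq_left, div_eq_zero_iff] at hj
    rcases hj with hj | hj
    · have : (zbar k : ℂ) = 0 := by simpa using hj
      rw [Complex.ofReal_eq_zero] at this
      linarith
    · exact one_sub_ne_zero (by linarith) hj
  | succ j =>
    have := congrArg norm hj
    rw [norm_mul, norm_pow, norm_one, pow_succ] at this
    have h1 := norm_v_le hn.le
    have h2 : ‖(zbar k : ℂ)‖ ^ j ≤ 1 := pow_le_one₀ (norm_nonneg _) (by linarith)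
    have h3 : ‖(zbar k : ℂ)‖ ^ j * ‖(zbar k : ℂ)‖ ≤ 1 * (55 / 100) := by gcongr
    have h4 : 0 ≤ ‖(zbar k : ℂ)‖ ^ j * ‖(zbar k : ℂ)‖ := by positivity
    nlinarith [norm_nonneg (v (zbar k))]

lemma pref_zbar_ne_zero {k : ℕ} (hk : 2 ≤ k) : pref (zbar k) ≠ 0 := by
  obtain ⟨z1, z2, -⟩ := zbar_spec hk
  have hn := norm_zbar_lt hk
  have h0 : (zbar k : ℂ) ≠ 0 := by
    rw [Complex.ofReal_ne_zero]
    linarith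
  refine mul_ne_zero (div_ne_zero (mul_ne_zero (mul_ne_zero two_ne_zero h0) ?_) ?_)
    (div_ne_zero (qPoch_v_zbar_ne_zero hk) (qPoch_qu_ne_zero hn.le))
  · exact pow_ne_zero 2 (one_sub_ne_zero (by linarith))
  · exact pow_ne_zero 2 (one_sub_two_mul_ne_zero (zbar_ne_half hk))

/-- The simple poles of the generating function. -/
lemma exists_pole {k : ℕ} (hk : 2 ≤ k) : ∃ g : ℂ → ℂ, AnalyticAt ℂ g (zbar k) ∧ g (zbar k) ≠ 0 ∧
    ∀ᶠ q in 𝓝[≠] (zbar k : ℂ), PAfun q = (q - zbar k) ^ (-1 : ℤ) • g q := by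
  obtain ⟨j, rfl⟩ := Nat.exists_eq_add_of_le' (show 1 ≤ k by omega)
  set z : ℂ := (zbar (j + 1) : ℂ) with hz
  have hzm := zbar_mem_puncturedDisc hk
  have hz1 : ‖z‖ < 1 := hzm.1.trans (by norm_num)
  obtain ⟨g, hg, he⟩ := exists_analytic_tsum hzm {j} fun n hn => denom_ne_zero hzm.1 fun h2 he => by
    have := zbar_injective hk h2 (Complex.ofReal_injective he)
    simp at hn
    omega
  have hcof : AnalyticAt ℂ (cofactor (j + 1 + 2) z) z := by
    unfold cofactor
    refine analyticAt_const.add (Finset.analyticAt_fun_sum _ fun i _ => ?_)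
    fun_prop
  have hcof0 : cofactor (j + 1 + 2) z z ≠ 0 := cofactor_ne_zero (by omega) hzm.1.le hzm.1.le
  -- In the one singular term the denominator is `(q - z)` times `cofactor`; everything else is
  -- analytic at `z` and acquires the factor `q - z`. At `z` only the singular part survives.
  refine ⟨fun q => (q - z) * (C q - pref q * (q ^ 2 / (1 - q) ^ 2 + g q)) -
    pref q * (qCoeff (j + 1) q * (q ^ (j + 1 + 2) / cofactor (j + 1 + 2) z q)), ?_, ?_, ?_⟩
  · refine AnalyticAt.sub (AnalyticAt.mul (by fun_prop) ?_) ?_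
    · exact (analyticAt_C hzm).sub ((analyticAt_pref hzm).mul ((analyticAt_rat hz1).add hg))
    · exact (analyticAt_pref hzm).mul ((analyticAt_qCoeff _ hz1).mul
        (AnalyticAt.div (by fun_prop) hcof hcof0))
  · beta_reduce
    rw [sub_self, zero_mul, zero_sub, neg_ne_zero]
    obtain ⟨z1, z2, -⟩ := zbar_spec hk
    refine mul_ne_zero (pref_zbar_ne_zero hk) (mul_ne_zero
      (qCoeff_ofReal_ne_zero (by linarith) (by linarith) _) (div_ne_zero (pow_ne_zero _ ?_) hcof0))
    rw [hz, Complex.ofReal_ne_zero]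
    linarith
  · filter_upwards [he.filter_mono nhdsWithin_le_nhds, self_mem_nhdsWithin,
      (hcof.continuousAt.eventually_ne hcof0).filter_mono nhdsWithin_le_nhds] with q hq hne hc
    have hne : q - z ≠ 0 := sub_ne_zero.2 hne
    have hden := sub_mul_cofactor (j + 1 + 2) z q
    rw [zbar_root hk, sub_zero] at hden
    rw [PAfun, hq, Finset.sum_singleton, fterm, ← hden, zpow_neg_one, smul_eq_mul]
    field_simp
    ring

lemma slitDisc_subset : slitDisc ⊆ puncturedDisc := by
  rintro q ⟨h1, h2⟩
  refine ⟨h1, fun h => h2 (1 / 2) ⟨le_rfl, by norm_num⟩ ?_⟩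
  rw [h]
  norm_num

lemma ne_zbar_of_mem_slitDisc {q : ℂ} (hq : q ∈ slitDisc) {k : ℕ} (hk : 2 ≤ k) :
    q ≠ (zbar k : ℂ) := by
  obtain ⟨z1, z2, -⟩ := zbar_spec hk
  exact hq.2 _ ⟨z1.le, z2.le⟩

lemma meromorphicAt_zbar {k : ℕ} (hk : 2 ≤ k) : MeromorphicAt PAfun (zbar k) := by
  obtain ⟨g, hg, -, he⟩ := exists_pole hk
  refine MeromorphicAt.congr (f := fun q => (q - (zbar k : ℂ)) ^ (-1 : ℤ) • g q) ?_
    (by filter_upwards [he] with q hq using hq.symm)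
  have := hg.meromorphicAt
  fun_prop

lemma meromorphicOn_PAfun : MeromorphicOn PAfun puncturedDisc := by
  intro q hq
  by_cases h : ∃ k : ℕ, 2 ≤ k ∧ q = (zbar k : ℂ)
  · obtain ⟨k, hk, rfl⟩ := h
    exact meromorphicAt_zbar hk
  · push Not at h
    exact (analyticAt_PAfun hq h).meromorphicAt

lemma meromorphicOrderAt_PAfun {k : ℕ} (hk : 2 ≤ k) :
    meromorphicOrderAt PAfun (zbar k : ℂ) = ((-1 : ℤ) : WithTop ℤ) :=
  (meromorphicOrderAt_eq_int_iff (meromorphicAt_zbar hk)).2 (exists_pole hk)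

/-! ### Evaluation of power series -/

/-- The power series `F` converges at `q` to `s`. -/
def Ev (q : ℂ) (F : ℂ⟦X⟧) (s : ℂ) : Prop :=
  HasSum (fun n => PowerSeries.coeff n F * q ^ n) s

lemma Ev.unique {q : ℂ} {F : ℂ⟦X⟧} {s t : ℂ} (h : Ev q F s) (h' : Ev q F t) : s = t :=
  HasSum.unique h h'

lemma Ev.add {q : ℂ} {F G : ℂ⟦X⟧} {s t : ℂ} (h : Ev q F s) (h' : Ev q G t) :
    Ev q (F + G) (s + t) := by
  simpa [Ev, add_mul] using HasSum.add h h'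

/-- Summability in `ℂ` is absolute, so the Cauchy product converges. Thus identities of counting
sequences can be proved formally and then evaluated. -/
lemma Ev.mul {q : ℂ} {F G : ℂ⟦X⟧} {s t : ℂ} (h : Ev q F s) (h' : Ev q G t) :
    Ev q (F * G) (s * t) := by
  have h1 := summable_norm_iff.2 h.summable
  have h2 := summable_norm_iff.2 h'.summable
  have hs := (summable_norm_sum_mul_antidiagonal_of_summable_norm h1 h2).of_norm
  have ht := tsum_mul_tsum_eq_tsum_sum_antidiagonal_of_summable_norm h1 h2
  rw [h.tsum_eq, h'.tsum_eq] at ht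
  have := hs.hasSum
  rw [← ht] at this
  refine this.congr_fun fun n => ?_
  rw [PowerSeries.coeff_mul, Finset.sum_mul]
  refine Finset.sum_congr rfl fun p hp => ?_
  rw [← Finset.HasAntidiagonal.mem_antidiagonal.1 hp, pow_add]
  ring

lemma Ev.sum {ι : Type*} {q : ℂ} {F : ι → ℂ⟦X⟧} {s : ι → ℂ} {t : Finset ι}
    (h : ∀ i ∈ t, Ev q (F i) (s i)) : Ev q (∑ i ∈ t, F i) (∑ i ∈ t, s i) := by
  simpa [Ev, Finset.sum_mul] using hasSum_sum h

lemma ev_polynomial (q : ℂ) (p : ℂ[X]) : Ev q (p : ℂ⟦X⟧) (p.eval q) := by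
  rw [Polynomial.eval_eq_sum_range, Ev]
  simp only [Polynomial.coeff_coe]
  refine hasSum_sum_of_ne_finset_zero fun n hn => ?_
  rw [Polynomial.coeff_eq_zero_of_natDegree_lt (by simpa using hn), zero_mul]

lemma ev_X_pow (q : ℂ) (k : ℕ) : Ev q (PowerSeries.X ^ k) (q ^ k) := by
  simpa using ev_polynomial q (Polynomial.X ^ k)

lemma ev_one (q : ℂ) : Ev q 1 1 := by
  simpa using ev_X_pow q 0

lemma Ev.pow {q : ℂ} {F : ℂ⟦X⟧} {s : ℂ} (h : Ev q F s) (k : ℕ) : Ev q (F ^ k) (s ^ k) := by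
  induction k with
  | zero => simpa using ev_one q
  | succ k ih => rw [pow_succ, pow_succ]; exact ih.mul h

lemma ev_geometric {q : ℂ} (hq : ‖q‖ < 1) : Ev q (PowerSeries.mk 1) (1 - q)⁻¹ := by
  simpa [Ev] using hasSum_geometric_of_norm_lt_one hq

/-! ### The generating functions of codes -/

lemma sum_fifth_le (k : ℕ) : ∑ x ∈ Finset.range k, (1 / 5 : ℝ) ^ (x + 1) ≤ 1 / 4 := by
  have : ∑ x ∈ Finset.range k, (1 / 5 : ℝ) ^ (x + 1) = 1 / 4 - 1 / 4 * (1 / 5) ^ k := by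
    induction k with
    | zero => simp
    | succ k ih => rw [Finset.sum_range_succ, ih]; ring
  rw [this]
  have : (0 : ℝ) < (1 / 5) ^ k := by positivity
  linarith

lemma five_pow_sub {n m : ℕ} (h : m ≤ n) : (5 : ℝ) ^ (n - m) = 5 ^ n * (1 / 5) ^ m := by
  rw [pow_sub₀ _ (by norm_num) h]
  simp

/-- The constants close the induction because the sums of powers of 1/5 are at most 1/4: for
`aCount` the recurrence gives 1/2 · 1/4 + 1/5 ≤ 1/2, for `bCount` it gives 1/2 + 5/4 ≤ 2. -/
lemma count_le (n M : ℕ) :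
    (aCount n M : ℝ) ≤ 5 ^ n * 2 ^ M / 2 ∧ (bCount n M : ℝ) ≤ 5 ^ n * 2 ^ M := by
  induction hN : n + M using Nat.strong_induction_on generalizing n M with
  | _ N ih =>
    subst hN
    constructor
    · rw [aCount_eq]
      push_cast
      have h1 : ∑ x ∈ Finset.range (M + 1),
          (((if x + 1 ≤ n then aCount (n - (x + 1)) M else 0 : ℕ)) : ℝ) ≤
          5 ^ n * 2 ^ M / 2 * (1 / 4) := by
        refine le_trans (Finset.sum_le_sum fun x _ => ?_) (le_trans
          (Finset.mul_sum _ _ _).ge (mul_le_mul_of_nonneg_left (sum_fifth_le (M + 1))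
            (by positivity)))
        split_ifs with h
        · refine ((ih _ (by omega) (n - (x + 1)) M rfl).1).trans (le_of_eq ?_)
          rw [five_pow_sub h]
          ring
        · simp only [Nat.cast_zero]
          positivity
      have h2 : (((if M + 1 ≤ n then bCount (n - (M + 1)) M else 0 : ℕ)) : ℝ) ≤
          5 ^ n * 2 ^ M * (1 / 5) := by
        split_ifs with h
        · refine ((ih _ (by omega) (n - (M + 1)) M rfl).2).trans ?_
          rw [five_pow_sub h, pow_succ]
          have : (1 / 5 : ℝ) ^ M ≤ 1 := pow_le_one₀ (by norm_num) (by norm_num)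
          have h3 : (0 : ℝ) ≤ 5 ^ n * 2 ^ M := by positivity
          nlinarith
        · simp only [Nat.cast_zero]
          positivity
      have h3 : (0 : ℝ) ≤ 5 ^ n * 2 ^ M := by positivity
      push_cast at h1 h2
      linarith
    · cases M with
      | zero =>
        rw [bCount_zero]
        split_ifs with h
        · simp [h]
        · simp
      | succ M =>
        rw [bCount_succ]
        push_cast
        have h1 := (ih _ (by omega) n M rfl).1
        have h2 : ∑ c ∈ Finset.range (n + 1), (bCount (n - c) M : ℝ) ≤
            5 ^ n * 2 ^ M * 5 * (1 / 4) := by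
          refine le_trans (Finset.sum_le_sum fun c hc => ?_) (le_trans
            (Finset.mul_sum _ _ _).ge (mul_le_mul_of_nonneg_left (sum_fifth_le (n + 1))
              (by positivity)))
          have hc := Finset.mem_range.1 hc
          refine ((ih _ (by omega) (n - c) M rfl).2).trans (le_of_eq ?_)
          rw [five_pow_sub (by omega)]
          ring
        have h3 : (0 : ℝ) ≤ 5 ^ n * 2 ^ M := by positivity
        rw [pow_succ]
        linarith

/-- Since `aCount` vanishes unless `M < n`, the growth `2 ^ M` can be absorbed by the power of `q`.
This yields absolute summability over both indices. -/
lemma norm_aCount_le {q : ℂ} (hq : ‖q‖ ≤ 1 / 40) (n M : ℕ) :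
    ‖(aCount n M : ℂ) * q ^ n‖ ≤ (1 / 2) ^ M * (1 / 2) ^ n := by
  rcases le_or_gt n M with h | h
  · rw [aCount_eq_zero h]
    simp
  · rw [norm_mul, norm_pow, Complex.norm_natCast]
    have h1 : (aCount n M : ℝ) ≤ 5 ^ n * 2 ^ M := by
      have := (count_le n M).1
      have h3 : (0 : ℝ) ≤ 5 ^ n * 2 ^ M := by positivity
      linarith
    calc (aCount n M : ℝ) * ‖q‖ ^ n ≤ (5 ^ n * 2 ^ M) * (1 / 40) ^ n := by gcongr
      _ = (1 / 2) ^ M * (4 ^ M * (1 / 8) ^ n) := by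
        rw [show (1 / 40 : ℝ) = 1 / 8 * (1 / 5) by norm_num, mul_pow,
          show (4 : ℝ) = 2 * 2 by norm_num, mul_pow]
        have e1 : (5 : ℝ) ^ n * (1 / 5) ^ n = 1 := by rw [← mul_pow]; norm_num
        have e2 : (1 / 2 : ℝ) ^ M * 2 ^ M = 1 := by rw [← mul_pow]; norm_num
        linear_combination (2 ^ M * (1 / 8) ^ n) * e1 - (2 ^ M * (1 / 8) ^ n) * e2
      _ ≤ (1 / 2) ^ M * (4 ^ n * (1 / 8) ^ n) := by
        gcongr
        norm_num
      _ = (1 / 2) ^ M * (1 / 2) ^ n := by rw [← mul_pow]; norm_num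

lemma summable_bCount {q : ℂ} (hq : ‖q‖ ≤ 1 / 40) (M : ℕ) :
    Summable fun n => (bCount n M : ℂ) * q ^ n := by
  refine Summable.of_norm_bounded (g := fun n : ℕ => 2 ^ M * (1 / 8 : ℝ) ^ n)
    ((summable_geometric_of_lt_one (by norm_num) (by norm_num)).mul_left _) fun n => ?_
  rw [norm_mul, norm_pow, Complex.norm_natCast]
  calc (bCount n M : ℝ) * ‖q‖ ^ n ≤ (5 ^ n * 2 ^ M) * (1 / 40) ^ n := by
        gcongr
        exact (count_le n M).2
    _ = 2 ^ M * (5 ^ n * (1 / 40) ^ n) := by ring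
    _ = 2 ^ M * (1 / 8 : ℝ) ^ n := by rw [← mul_pow]; norm_num

/-- The generating function of the codes of width `M` that end with a north step. -/
noncomputable def aFun (M : ℕ) (q : ℂ) : ℂ := ∑' n, (aCount n M : ℂ) * q ^ n

/-- The generating function of the codes of width `M` that do not end with a north step. -/
noncomputable def bFun (M : ℕ) (q : ℂ) : ℂ := ∑' n, (bCount n M : ℂ) * q ^ n

lemma summable_prod_aCount {q : ℂ} (hq : ‖q‖ ≤ 1 / 40) :
    Summable fun p : ℕ × ℕ => (aCount p.2 p.1 : ℂ) * q ^ p.2 := by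
  have hg : Summable fun n : ℕ => (1 / 2 : ℝ) ^ n :=
    summable_geometric_of_lt_one (by norm_num) (by norm_num)
  exact Summable.of_norm_bounded (hg.mul_of_nonneg hg (fun _ => by positivity)
    fun _ => by positivity) fun p => norm_aCount_le hq p.2 p.1

lemma ev_aFun {q : ℂ} (hq : ‖q‖ ≤ 1 / 40) (M : ℕ) :
    Ev q (PowerSeries.mk fun n => (aCount n M : ℂ)) (aFun M q) := by
  simpa [Ev, aFun] using ((summable_prod_aCount hq).prod_factor M).hasSum

lemma ev_bFun {q : ℂ} (hq : ‖q‖ ≤ 1 / 40) (M : ℕ) :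
    Ev q (PowerSeries.mk fun n => (bCount n M : ℂ)) (bFun M q) := by
  simpa [Ev, bFun] using (summable_bCount hq M).hasSum

lemma norm_aFun_le {q : ℂ} (hq : ‖q‖ ≤ 1 / 40) (M : ℕ) : ‖aFun M q‖ ≤ 2 * (1 / 2) ^ M := by
  have := tsum_of_norm_bounded ((hasSum_geometric_two).mul_left ((1 / 2 : ℝ) ^ M))
    fun n => norm_aCount_le hq n M
  rw [aFun]
  linarith

/-- Multiplication by `1 - q` sums the geometric series of the `row` letters and creates the
denominator `1 - 2q + q ^ (M + 2)`, the source of all the poles. -/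
lemma aFun_eq {q : ℂ} (hq : ‖q‖ ≤ 1 / 40) (M : ℕ) :
    (1 - 2 * q + q ^ (M + 2)) * aFun M q = (1 - q) * q ^ (M + 1) * bFun M q := by
  have h : (PowerSeries.mk fun n => (aCount n M : ℂ)) =
      (∑ x ∈ Finset.range (M + 1), PowerSeries.X ^ (x + 1)) *
        (PowerSeries.mk fun n => (aCount n M : ℂ)) +
      PowerSeries.X ^ (M + 1) * (PowerSeries.mk fun n => (bCount n M : ℂ)) := by
    ext n
    rw [Finset.sum_mul, map_add, map_sum]
    simp only [PowerSeries.coeff_X_pow_mul', PowerSeries.coeff_mk]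
    rw [aCount_eq]
    push_cast
    rfl
  have h1 := ev_aFun hq M
  rw [h] at h1
  have h2 := ((Ev.sum fun x _ => ev_X_pow q (x + 1)).mul (ev_aFun hq M)).add
    ((ev_X_pow q (M + 1)).mul (ev_bFun hq M)) |>.unique h1
  have h3 : (1 - q) * ∑ x ∈ Finset.range (M + 1), q ^ (x + 1) = q - q ^ (M + 2) := by
    have := mul_neg_geom_sum q (M + 1)
    simp only [pow_succ, ← Finset.sum_mul] at this ⊢
    linear_combination q * this
  linear_combination -(1 - q) * h2 + aFun M q * h3

lemma bFun_zero (q : ℂ) : bFun 0 q = 1 := by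
  rw [bFun, tsum_eq_single 0 (by intro n hn; simp [bCount_zero, hn])]
  simp [bCount_zero]

lemma bFun_succ {q : ℂ} (hq : ‖q‖ ≤ 1 / 40) (M : ℕ) :
    (1 - q) * bFun (M + 1) q = (1 - q) * aFun M q + bFun M q := by
  have h : (PowerSeries.mk fun n => (bCount n (M + 1) : ℂ)) =
      (PowerSeries.mk fun n => (aCount n M : ℂ)) +
      PowerSeries.mk 1 * (PowerSeries.mk fun n => (bCount n M : ℂ)) := by
    ext n
    rw [map_add, PowerSeries.coeff_mul, Finset.Nat.sum_antidiagonal_eq_sum_range_succ_mk]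
    simp [bCount_succ]
  have h1 := ev_bFun hq (M + 1)
  rw [h] at h1
  have h2 := ((ev_aFun hq M).add ((ev_geometric (by linarith)).mul (ev_bFun hq M))).unique h1
  have h0 := one_sub_ne_zero (q := q) (by linarith)
  rw [← h2]
  field_simp

lemma aFun_zero {q : ℂ} (hq : ‖q‖ ≤ 1 / 40) : (1 - q) * aFun 0 q = q := by
  have h := aFun_eq hq 0
  rw [bFun_zero] at h
  have h0 := one_sub_ne_zero (q := q) (by linarith)
  refine mul_left_cancel₀ h0 ?_
  linear_combination h

/-- `bFun` is eliminated between `aFun_eq` for `M`, for `M + 1`, and `bFun_succ`. -/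
lemma aFun_succ {q : ℂ} (hq : ‖q‖ ≤ 1 / 40) (M : ℕ) :
    (1 - q) * (1 - 2 * q + q ^ (M + 3)) * aFun (M + 1) q =
      (q * (1 - 2 * q) + q ^ (M + 2) * (1 - q + q ^ 2)) * aFun M q := by
  have h1 := aFun_eq hq (M + 1)
  have h2 := bFun_succ hq M
  have h3 := aFun_eq hq M
  linear_combination (1 - q) * h1 + (1 - q) * q ^ (M + 2) * h2 - q * h3

/-- The generating function of codes by area and width. -/
noncomputable def gFun (t q : ℂ) : ℂ := ∑' M, aFun M q * t ^ M

lemma summable_gFun {t q : ℂ} (hq : ‖q‖ ≤ 1 / 40) (ht : ‖t‖ ≤ 1) :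
    Summable fun M => aFun M q * t ^ M := by
  refine Summable.of_norm_bounded (g := fun M : ℕ => 2 * (1 / 2 : ℝ) ^ M)
    ((summable_geometric_of_lt_one (by norm_num) (by norm_num)).mul_left _) fun M => ?_
  rw [norm_mul, norm_pow]
  exact (mul_le_of_le_one_right (norm_nonneg _) (pow_le_one₀ (norm_nonneg _) ht)).trans
    (norm_aFun_le hq M)

lemma norm_gFun_le {t q : ℂ} (hq : ‖q‖ ≤ 1 / 40) (ht : ‖t‖ ≤ 1) : ‖gFun t q‖ ≤ 4 := by
  have := tsum_of_norm_bounded (f := fun M => aFun M q * t ^ M)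
    ((hasSum_geometric_two).mul_left (2 : ℝ)) fun M => by
      rw [norm_mul, norm_pow]
      exact (mul_le_of_le_one_right (norm_nonneg _) (pow_le_one₀ (norm_nonneg _) ht)).trans
        (norm_aFun_le hq M)
  rw [gFun]
  linarith

/-- In the recurrence the powers `q ^ M` act as the dilation `t ↦ q t`. -/
lemma gFun_funEq {t q : ℂ} (hq : ‖q‖ ≤ 1 / 40) (ht : ‖t‖ ≤ 1) :
    (1 - 2 * q) * (1 - q - q * t) * gFun t q =
      q * (1 - q) ^ 2 - q ^ 2 * (1 - q - (1 - q + q ^ 2) * t) * gFun (q * t) q := by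
  have ht' : ‖q * t‖ ≤ 1 := by
    rw [norm_mul]
    exact mul_le_one₀ (by linarith) (norm_nonneg _) ht
  have hs := summable_gFun hq ht
  have hs' := summable_gFun hq ht'
  have h1 := (summable_nat_add_iff 1).2 hs
  have h1' := (summable_nat_add_iff 1).2 hs'
  have e1 : gFun t q = aFun 0 q + ∑' M : ℕ, aFun (M + 1) q * t ^ (M + 1) := by
    rw [gFun, hs.tsum_eq_zero_add]; simp
  have e2 : gFun (q * t) q = aFun 0 q + ∑' M : ℕ, aFun (M + 1) q * (q * t) ^ (M + 1) := by
    rw [gFun, hs'.tsum_eq_zero_add]; simp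
  have key : (1 - q) * (1 - 2 * q) * (∑' M : ℕ, aFun (M + 1) q * t ^ (M + 1)) +
      (1 - q) * q ^ 2 * (∑' M : ℕ, aFun (M + 1) q * (q * t) ^ (M + 1)) =
      q * (1 - 2 * q) * t * gFun t q + q ^ 2 * t * (1 - q + q ^ 2) * gFun (q * t) q := by
    rw [gFun, gFun, ← tsum_mul_left, ← tsum_mul_left, ← tsum_mul_left, ← tsum_mul_left,
      ← (h1.mul_left _).tsum_add (h1'.mul_left _), ← (hs.mul_left _).tsum_add (hs'.mul_left _)]
    refine tsum_congr fun M => ?_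
    have := aFun_succ hq M
    rw [mul_pow, mul_pow]
    linear_combination t ^ (M + 1) * this
  have h0 := aFun_zero hq
  linear_combination key + (1 - q) * (1 - 2 * q) * e1 + (1 - q) * q ^ 2 * e2 + (1 - q) ^ 2 * h0

/-! ### Solution of the functional equation -/

/-- The terms of the series that solves the functional equation. -/
noncomputable def sTerm (t q : ℂ) (ν : ℕ) : ℂ :=
  qCoeff ν q * t ^ ν * (q ^ (ν + 2) / (1 - 2 * q + q ^ (ν + 2)))

/-- The series that solves the functional equation. -/
noncomputable def sFun (t q : ℂ) : ℂ := ∑' ν, sTerm t q ν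

lemma half_le_norm_denom {q : ℂ} (hq : ‖q‖ ≤ 1 / 40) (ν : ℕ) :
    1 / 2 ≤ ‖1 - 2 * q + q ^ (ν + 2)‖ := by
  have h1 : ‖q ^ (ν + 2)‖ ≤ 1 / 40 := by
    rw [norm_pow]
    exact (pow_le_of_le_one (norm_nonneg _) (by linarith) (by omega)).trans hq
  have h2 : ‖2 * q - q ^ (ν + 2)‖ ≤ 3 / 40 := by
    refine (norm_sub_le _ _).trans ?_
    rw [norm_mul, Complex.norm_ofNat]
    linarith
  have h3 := one_sub_norm_le (2 * q - q ^ (ν + 2))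
  rw [show 1 - 2 * q + q ^ (ν + 2) = 1 - (2 * q - q ^ (ν + 2)) by ring]
  linarith

lemma norm_sTerm_le {t q : ℂ} (hq : ‖q‖ ≤ 1 / 40) (ht : ‖t‖ ≤ 1) (ν : ℕ) :
    ‖sTerm t q ν‖ ≤ 6 ^ 7 * 2 * (1 / 2) ^ ν := by
  have h1 := half_le_norm_denom hq ν
  have h2 := norm_qCoeff_le (q := q) (by linarith) ν
  have h3 : ‖t ^ ν‖ ≤ 1 := by
    rw [norm_pow]
    exact pow_le_one₀ (norm_nonneg _) ht
  have h4 : ‖q ^ (ν + 2)‖ ≤ (1 / 40) ^ ν := by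
    rw [norm_pow]
    exact (pow_le_pow_of_le_one (norm_nonneg _) (by linarith) (by omega)).trans
      (pow_le_pow_left₀ (norm_nonneg _) hq ν)
  rw [sTerm, norm_mul, norm_mul, norm_div]
  calc ‖qCoeff ν q‖ * ‖t ^ ν‖ * (‖q ^ (ν + 2)‖ / ‖1 - 2 * q + q ^ (ν + 2)‖)
      ≤ 6 ^ 7 * (7 / 4) ^ ν * 1 * ((1 / 40) ^ ν / (1 / 2)) := by gcongr
    _ = 6 ^ 7 * 2 * (7 / 4 * (1 / 40)) ^ ν := by rw [mul_pow]; ring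
    _ ≤ 6 ^ 7 * 2 * (1 / 2) ^ ν := by gcongr; norm_num

lemma summable_sTerm {t q : ℂ} (hq : ‖q‖ ≤ 1 / 40) (ht : ‖t‖ ≤ 1) : Summable (sTerm t q) :=
  Summable.of_norm_bounded (summable_geometric_two.mul_left _) (norm_sTerm_le hq ht)

lemma norm_sFun_le {t q : ℂ} (hq : ‖q‖ ≤ 1 / 40) (ht : ‖t‖ ≤ 1) : ‖sFun t q‖ ≤ 6 ^ 7 * 2 * 2 :=
  tsum_of_norm_bounded (hasSum_geometric_two.mul_left _) (norm_sTerm_le hq ht)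

lemma norm_mul_le_one {t q : ℂ} (hq : ‖q‖ ≤ 1 / 40) (ht : ‖t‖ ≤ 1) : ‖q * t‖ ≤ 1 / 40 := by
  rw [norm_mul]
  exact (mul_le_of_le_one_right (norm_nonneg _) ht).trans hq

/-- On the ν-th term the left side multiplies by `1 - 2q + q ^ (ν + 2)` and cancels the denominator;
what remains is `q ^ 2` times the series of 1/Q at `q t`. -/
lemma sFun_funEq {t q : ℂ} (hq : ‖q‖ ≤ 1 / 40) (ht : ‖t‖ ≤ 1) :
    (1 - 2 * q) * sFun t q + q ^ 2 * sFun (q * t) q = q ^ 2 * qSeries (q * t) q := by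
  have ht' := norm_mul_le_one hq ht
  rw [sFun, sFun, qSeries, ← tsum_mul_left, ← tsum_mul_left, ← tsum_mul_left,
    ← ((summable_sTerm hq ht).mul_left _).tsum_add
      ((summable_sTerm hq (by linarith : ‖q * t‖ ≤ 1)).mul_left _)]
  refine tsum_congr fun ν => ?_
  have h : 1 - 2 * q + q ^ (ν + 2) ≠ 0 := by
    intro h
    have := half_le_norm_denom hq ν
    rw [h, norm_zero] at this
    linarith
  simp only [sTerm]
  field_simp
  ring

lemma norm_qu_mul_lt {t q : ℂ} (hq : ‖q‖ ≤ 55 / 100) (ht : ‖t‖ ≤ 1) : ‖q * u q * t‖ < 1 := by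
  rw [norm_mul]
  exact (mul_le_of_le_one_right (norm_nonneg _) ht).trans_lt (norm_q_mul_u_lt hq)

lemma Q_funEq {t q : ℂ} (hq : ‖q‖ ≤ 55 / 100) (ht : ‖t‖ ≤ 1) :
    (1 - q * u q * t) * Q t q = (1 - v q * t) * Q (q * t) q := by
  have hq1 : ‖q‖ < 1 := by linarith
  have h1 := qPoch_eq_mul (v q * t) hq1
  have h2 := qPoch_eq_mul (q * u q * t) hq1
  have h3 : qPoch (q * u q * t) q ≠ 0 := qPoch_ne_zero_of_norm_lt hq1 (norm_qu_mul_lt hq ht)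
  have h4 := h3
  rw [h2] at h4
  have h5 := left_ne_zero_of_mul h4
  have h6 := right_ne_zero_of_mul h4
  rw [Q, Q, h1, h2, show v q * (q * t) = v q * t * q by ring,
    show q * u q * (q * t) = q * u q * t * q by ring]
  field_simp

lemma Q_mul_qSeries {z q : ℂ} (hq : ‖q‖ ≤ 55 / 100) (hz : ‖z‖ < 4 / 7) :
    Q z q * qSeries z q = 1 := by
  have hq1 : ‖q‖ < 1 := by linarith
  rw [← one_div_Q_eq hq hz, mul_one_div_cancel]
  exact div_ne_zero (qPoch_ne_zero_of_norm_lt hq1 (norm_v_mul_lt hq hz))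
    (qPoch_ne_zero_of_norm_lt hq1 (norm_qu_mul_lt hq (by linarith)))

/-- The defect between `gFun` and the explicit solution of its functional equation. -/
noncomputable def defect (t q : ℂ) : ℂ :=
  (1 - 2 * q) * (1 - q - q * t) * gFun t q - q * (1 - q) ^ 2 * (1 - Q t q * sFun t q)

/-- The inhomogeneous terms cancel because `Q` times its reciprocal series is 1 at `q t`. -/
lemma defect_funEq {t q : ℂ} (hq : ‖q‖ ≤ 1 / 40) (ht : ‖t‖ ≤ 1) :
    (1 - 2 * q) * (1 - q * u q * t) * defect t q = -(q ^ 2 * (1 - v q * t)) * defect (q * t) q := by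
  have ht' := norm_mul_le_one hq ht
  have h0 := one_sub_ne_zero (q := q) (by linarith)
  have hu : (1 - q) * u q = q := by rw [u]; field_simp
  have hv : (1 - q) * v q = 1 - q + q ^ 2 := by rw [v]; field_simp
  have h1 := gFun_funEq hq ht
  have h2 := Q_funEq (q := q) (by linarith) ht
  have h3 := Q_mul_qSeries (z := q * t) (q := q) (by linarith) (by linarith)
  have h4 := sFun_funEq hq ht
  rw [defect, defect]
  linear_combination (1 - 2 * q) * (1 - q * u q * t) * h1 +
    q * (1 - q) ^ 2 * (1 - 2 * q) * sFun t q * h2 +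
    q * (1 - q) ^ 2 * (1 - v q * t) * Q (q * t) q * h4 +
    q * (1 - q) ^ 2 * (1 - v q * t) * q ^ 2 * h3 +
    q ^ 2 * (1 - v q * t) * (1 - 2 * q) * q * t * gFun (q * t) q * hu -
    (1 - 2 * q) * (1 - q * u q * t) * q ^ 2 * t * gFun (q * t) q * hv

/-- The factor `q ^ 2` makes the homogeneous equation a contraction: the ratio is at most (3/1600) /
(19/40), far below 1/2. -/
lemma norm_defect_le {t q : ℂ} (hq : ‖q‖ ≤ 1 / 40) (ht : ‖t‖ ≤ 1) :
    ‖defect t q‖ ≤ 1 / 2 * ‖defect (q * t) q‖ := by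
  have h := congrArg norm (defect_funEq hq ht)
  rw [norm_mul, norm_mul, norm_mul, norm_neg, norm_mul, norm_pow] at h
  have h1 : 19 / 20 ≤ ‖1 - 2 * q‖ := by
    have := one_sub_norm_le (2 * q)
    rw [norm_mul, Complex.norm_ofNat] at this
    linarith
  have h2 : 1 / 2 ≤ ‖1 - q * u q * t‖ := by
    have h3 := one_sub_norm_le (q * u q * t)
    have h4 := norm_u_le (q := q) (by linarith)
    have h5 : ‖q * u q * t‖ ≤ 1 / 40 * (11 / 9) * 1 := by
      rw [norm_mul, norm_mul]
      gcongr
    linarith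
  have h3 : ‖1 - v q * t‖ ≤ 3 := by
    have h4 := norm_v_le (q := q) (by linarith)
    have h5 : ‖v q * t‖ ≤ 16723 / 10000 * 1 := by
      rw [norm_mul]
      gcongr
    have := norm_sub_le 1 (v q * t)
    rw [norm_one] at this
    linarith
  have h4 : 19 / 40 * ‖defect t q‖ ≤ 3 / 1600 * ‖defect (q * t) q‖ :=
    calc 19 / 40 * ‖defect t q‖ = 19 / 20 * (1 / 2) * ‖defect t q‖ := by ring
      _ ≤ ‖1 - 2 * q‖ * ‖1 - q * u q * t‖ * ‖defect t q‖ := by gcongr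
      _ = ‖q‖ ^ 2 * ‖1 - v q * t‖ * ‖defect (q * t) q‖ := h
      _ ≤ (1 / 40) ^ 2 * 3 * ‖defect (q * t) q‖ := by gcongr
      _ = 3 / 1600 * ‖defect (q * t) q‖ := by ring
  linarith [norm_nonneg (defect (q * t) q)]

lemma exists_bound_defect {q : ℂ} (hq : ‖q‖ ≤ 1 / 40) :
    ∃ B, ∀ t : ℂ, ‖t‖ ≤ 1 → ‖defect t q‖ ≤ B := by
  have hq1 : ‖q‖ < 1 := by linarith
  have hc : ContinuousOn (fun t => Q t q) (Metric.closedBall 0 1) := by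
    have h := continuous_qPoch hq1
    refine ContinuousOn.div (h.comp (by fun_prop : Continuous fun t => v q * t)).continuousOn
      (h.comp (by fun_prop : Continuous fun t => q * u q * t)).continuousOn fun t ht => ?_
    exact qPoch_ne_zero_of_norm_lt hq1
      (norm_qu_mul_lt (by linarith) (mem_closedBall_zero_iff.1 ht))
  obtain ⟨K, hK⟩ := (isCompact_closedBall (0 : ℂ) 1).exists_bound_of_continuousOn hc
  refine ⟨‖1 - 2 * q‖ * (‖1 - q‖ + ‖q‖ * 1) * 4 +
    ‖q * (1 - q) ^ 2‖ * (1 + K * (6 ^ 7 * 2 * 2)), fun t ht => ?_⟩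
  have h1 := hK t (mem_closedBall_zero_iff.2 ht)
  have hK0 := (norm_nonneg _).trans h1
  have h2 := norm_sFun_le hq ht
  have h3 := norm_gFun_le hq ht
  rw [defect]
  refine (norm_sub_le _ _).trans (add_le_add ?_ ?_)
  · rw [norm_mul, norm_mul]
    gcongr
    refine (norm_sub_le _ _).trans ?_
    rw [norm_mul]
    gcongr
  · rw [norm_mul]
    gcongr
    refine (norm_sub_le _ _).trans ?_
    rw [norm_mul, norm_one]
    gcongr

/-- The contraction is iterated along 1, q, q², …, where the defect stays bounded. -/
lemma defect_one {q : ℂ} (hq : ‖q‖ ≤ 1 / 40) : defect 1 q = 0 := by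
  obtain ⟨B, hB⟩ := exists_bound_defect hq
  have hn : ∀ n : ℕ, ‖q ^ n‖ ≤ 1 := fun n => by
    rw [norm_pow]
    exact pow_le_one₀ (norm_nonneg _) (by linarith)
  have h : ∀ n : ℕ, ‖defect 1 q‖ ≤ (1 / 2) ^ n * B := by
    have h' : ∀ n : ℕ, ‖defect 1 q‖ ≤ (1 / 2) ^ n * ‖defect (q ^ n) q‖ := by
      intro n
      induction n with
      | zero => simp
      | succ n ih =>
        refine ih.trans ?_
        rw [pow_succ, mul_assoc, pow_succ' q]
        gcongr
        exact norm_defect_le hq (hn n)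
    intro n
    refine (h' n).trans ?_
    gcongr
    exact hB _ (hn n)
  have h0 : Filter.Tendsto (fun n : ℕ => (1 / 2 : ℝ) ^ n * B) Filter.atTop (𝓝 0) := by
    simpa using (tendsto_pow_atTop_nhds_zero_of_lt_one (r := (1 / 2 : ℝ)) (by norm_num)
      (by norm_num)).mul_const B
  exact norm_le_zero_iff.1 (ge_of_tendsto' h0 h)

/-! ### The area generating function near the origin -/

lemma sFun_one {q : ℂ} (hq : ‖q‖ ≤ 1 / 40) :
    sFun 1 q = q ^ 2 / (1 - q) ^ 2 + ∑' n, fterm n q := by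
  rw [sFun, (summable_sTerm hq (by simp)).tsum_eq_zero_add]
  congr 1
  · simp only [sTerm, qCoeff_zero]
    rw [show 1 - 2 * q + q ^ (0 + 2) = (1 - q) ^ 2 by ring]
    ring
  · refine tsum_congr fun n => ?_
    simp [sTerm, fterm]

lemma hasSum_aCount {q : ℂ} (hq : ‖q‖ ≤ 1 / 40) :
    HasSum (fun n : ℕ => ((∑ M ∈ Finset.range n, aCount n M : ℕ) : ℂ) * q ^ n) (gFun 1 q) := by
  have h := summable_prod_aCount hq
  have e : gFun 1 q = ∑' p : ℕ × ℕ, (aCount p.2 p.1 : ℂ) * q ^ p.2 := by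
    rw [h.tsum_prod]
    simp [gFun, aFun]
  have h1 := h.prod_symm.hasSum
  rw [show ∑' p : ℕ × ℕ, (aCount p.swap.2 p.swap.1 : ℂ) * q ^ p.swap.2 = gFun 1 q from
    ((Equiv.prodComm ℕ ℕ).tsum_eq fun p : ℕ × ℕ => (aCount p.2 p.1 : ℂ) * q ^ p.2).trans
      e.symm] at h1
  refine h1.prod_fiberwise fun n => ?_
  rw [Nat.cast_sum, Finset.sum_mul]
  refine hasSum_sum_of_ne_finset_zero fun M hM => ?_
  simp [aCount_eq_zero (show n ≤ M by simpa using hM)]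

lemma ev_PA_of_norm_le {q : ℂ} (hq : ‖q‖ ≤ 1 / 40) : Ev q PA (PAfun q) := by
  have h0 := one_sub_ne_zero (q := q) (by linarith)
  have hq2 : ‖2 * q‖ < 1 := by
    rw [norm_mul, Complex.norm_ofNat]
    linarith
  have h2 := one_sub_ne_zero hq2
  have g1 := (hasSum_geometric_of_norm_lt_one (show ‖q‖ < 1 by linarith)).mul_left q
  have g2 := (hasSum_geometric_of_norm_lt_one hq2).mul_left q
  have g3 := (hasSum_nat_add_iff' 1).2 (hasSum_aCount hq)
  have h3 := ((g1.add g2).add g3).mul_left 2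
  -- The three summands count hooks, bar graphs and wrapped codes; the factor 2 is the reflection.
  have hval : PAfun q = 2 * (q * (1 - q)⁻¹ + q * (1 - 2 * q)⁻¹ + gFun 1 q) := by
    have hd := defect_one hq
    rw [defect, sFun_one hq] at hd
    rw [PAfun, pref, C, A]
    have hQ : Q 1 q = qPoch (v q) q / qPoch (q * u q) q := by simp [Q]
    rw [← hQ]
    generalize q ^ 2 / (1 - q) ^ 2 + ∑' n, fterm n q = S at hd ⊢
    have hg : gFun 1 q = q * (1 - q) ^ 2 * (1 - Q 1 q * S) / (1 - 2 * q) ^ 2 := by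
      rw [eq_div_iff (pow_ne_zero 2 h2)]
      linear_combination hd
    rw [hg]
    field_simp
    ring
  rw [Ev, hval, ← hasSum_nat_add_iff' 1]
  have e0 : ∑ i ∈ Finset.range 1, PowerSeries.coeff i PA * q ^ i = 0 := by
    simp [PA, ncard_polygons_zero]
  rw [e0, sub_zero]
  simp only [Finset.range_one, Finset.sum_singleton, Finset.range_zero, Finset.sum_empty,
    Nat.cast_zero, zero_mul, sub_zero] at h3
  refine h3.congr_fun fun n => ?_
  simp only [PA, PowerSeries.coeff_mk, ncard_polygons_succ]
  push_cast
  rw [mul_pow, pow_succ]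
  ring

/-! ### Convergence of `PA` and its derivatives for |q| < 1/2 -/

lemma mem_slitDisc_of_norm_lt {q : ℂ} (hq : ‖q‖ < 1 / 2) : q ∈ slitDisc := by
  refine ⟨by linarith, fun x hx h => ?_⟩
  rw [h, Complex.norm_real, Real.norm_eq_abs] at hq
  linarith [le_abs_self x, hx.1]

lemma analyticOnNhd_PAfun : AnalyticOnNhd ℂ PAfun slitDisc := fun _ hq =>
  analyticAt_PAfun (slitDisc_subset hq) fun _ hk => ne_zbar_of_mem_slitDisc hq hk

/-- A power series that converges near the origin to a function analytic in a disc converges to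
this function in the whole disc, with all its derivatives. -/
lemma ev_iterate_derivative {F : ℂ⟦X⟧} {f : ℂ → ℂ} {r : ℝ}
    (hf : DifferentiableOn ℂ f (Metric.ball 0 r)) (h : ∀ᶠ q in 𝓝 (0 : ℂ), Ev q F (f q))
    (i : ℕ) {q : ℂ} (hq : q ∈ Metric.ball (0 : ℂ) r) :
    Ev q ((PowerSeries.derivative ℂ)^[i] F) (deriv^[i] f q) := by
  have hd : DifferentiableOn ℂ (deriv^[i] f) (Metric.ball 0 r) := by
    induction i with
    | zero => exact hf
    | succ i ih =>
      rw [Function.iterate_succ_apply']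
      exact ih.deriv Metric.isOpen_ball
  have hr : 0 < r := (norm_nonneg q).trans_lt (mem_ball_zero_iff.1 hq)
  have hs := Complex.hasSum_taylorSeries_on_ball hd hq
  refine hs.congr_fun fun n => ?_
  have hc := iteratedDeriv_div_factorial h (n + i)
  rw [div_eq_iff (by exact_mod_cast (n + i).factorial_ne_zero)] at hc
  have hit : iteratedDeriv n (deriv^[i] f) 0 = iteratedDeriv (n + i) f 0 := by
    rw [iteratedDeriv_eq_iterate, iteratedDeriv_eq_iterate, Function.iterate_add_apply]
  have hn : (n.factorial : ℂ) ≠ 0 := by exact_mod_cast n.factorial_ne_zero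
  rw [hit, hc, PowerSeries.coeff_iterate_derivative, ← Nat.factorial_mul_ascFactorial]
  simp only [sub_zero, smul_eq_mul]
  push_cast
  field_simp

lemma eventually_ev_PA : ∀ᶠ q in 𝓝 (0 : ℂ), Ev q PA (PAfun q) := by
  filter_upwards [Metric.ball_mem_nhds (0 : ℂ) (show (0 : ℝ) < 1 / 40 by norm_num)] with q hq
  exact ev_PA_of_norm_le (mem_ball_zero_iff.1 hq).le

lemma ev_iterate_derivative_PA (i : ℕ) {q : ℂ} (hq : ‖q‖ < 1 / 2) :
    Ev q ((PowerSeries.derivative ℂ)^[i] PA) (deriv^[i] PAfun q) :=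
  ev_iterate_derivative (r := 1 / 2) (fun _ hz => (analyticOnNhd_PAfun _ (mem_slitDisc_of_norm_lt
    (mem_ball_zero_iff.1 hz))).differentiableAt.differentiableWithinAt) eventually_ev_PA i
    (mem_ball_zero_iff.2 hq)

/-! ### Non-holonomicity -/

/-- The slit runs radially out to the rim, so the set is star-shaped about 0. -/
lemma isPreconnected_slitDisc : IsPreconnected slitDisc := by
  have h0 : (0 : ℂ) ∈ slitDisc := mem_slitDisc_of_norm_lt (by simp)
  refine (StarConvex.isPathConnected (a := (0 : ℂ)) ?_ h0).isConnected.isPreconnected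
  rw [starConvex_zero_iff]
  rintro q ⟨h1, h2⟩ a ha0 ha1
  have hn : ‖a • q‖ ≤ ‖q‖ := by
    rw [norm_smul, Real.norm_eq_abs, abs_of_nonneg ha0]
    exact mul_le_of_le_one_left (norm_nonneg _) ha1
  refine ⟨hn.trans_lt h1, fun x hx h => ?_⟩
  have ha : 0 < a := by
    refine ha0.lt_of_ne' fun ha => ?_
    rw [ha, zero_smul] at h
    linarith [hx.1, Complex.ofReal_eq_zero.1 h.symm]
  have hq : q = ((x / a : ℝ) : ℂ) := by
    rw [Complex.ofReal_div, ← h, Complex.real_smul,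
      mul_div_cancel_left₀ _ (Complex.ofReal_ne_zero.2 ha.ne')]
  refine h2 (x / a) ⟨hx.1.trans (le_div_self (by linarith [hx.1]) ha ha1), ?_⟩ hq
  rw [hq, Complex.norm_real] at h1
  exact (le_abs_self _).trans h1.le

/-- The point `x` is approached vertically, through non-real points. This carries an identity on the
slit disc to the poles, which lie on the slit. -/
lemma frequently_mem_slitDisc {x : ℝ} (hx : ‖(x : ℂ)‖ < 55 / 100) :
    ∃ᶠ q in 𝓝[≠] (x : ℂ), q ∈ slitDisc := by
  have ht : Filter.Tendsto (fun n : ℕ => (x : ℂ) + (1 / ((n : ℝ) + 1) : ℝ) * Complex.I)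
      Filter.atTop (𝓝 (x : ℂ)) := by
    have := ((Complex.continuous_ofReal.tendsto 0).comp
      (tendsto_one_div_add_atTop_nhds_zero_nat (𝕜 := ℝ))).mul_const Complex.I |>.const_add (x : ℂ)
    simpa using this
  have him : ∀ (n : ℕ) (y : ℝ), (x : ℂ) + (1 / ((n : ℝ) + 1) : ℝ) * Complex.I ≠ y := by
    intro n y h
    have h := congrArg Complex.im h
    rw [Complex.add_im, Complex.im_ofReal_mul, Complex.ofReal_im, Complex.ofReal_im, Complex.I_im,
      mul_one, zero_add] at h
    exact (by positivity : (1 / ((n : ℝ) + 1)) ≠ 0) h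
  refine Filter.Tendsto.frequently (tendsto_nhdsWithin_iff.2
    ⟨ht, .of_forall fun n => him n x⟩) (Filter.Eventually.frequently ?_)
  filter_upwards [ht.norm.eventually (gt_mem_nhds hx)] with n hn
  exact ⟨hn, fun y _ => him n y⟩

/-- The points `zbar k` are infinitely many, and `p` has finitely many roots. -/
lemma exists_zbar_not_isRoot {p : ℂ[X]} (hp : p ≠ 0) :
    ∃ k, 2 ≤ k ∧ p.eval (zbar k : ℂ) ≠ 0 := by
  by_contra! h
  refine hp (Polynomial.eq_zero_of_infinite_isRoot p ?_)
  refine (Set.infinite_range_of_injective (f := fun k : ℕ => (zbar (k + 2) : ℂ)) ?_).mono ?_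
  · intro i j hij
    have := zbar_injective (by omega) (by omega) (Complex.ofReal_injective hij)
    omega
  · rintro _ ⟨k, rfl⟩
    exact h _ (by omega)

lemma le_meromorphicOrderAt_sum {f : ℕ → ℂ → ℂ} {z : ℂ} {b : WithTop ℤ} {s : Finset ℕ}
    (hf : ∀ i ∈ s, MeromorphicAt (f i) z) (hb : ∀ i ∈ s, b ≤ meromorphicOrderAt (f i) z) :
    b ≤ meromorphicOrderAt (∑ i ∈ s, f i) z := by
  classical
  induction s using Finset.induction_on with
  | empty =>
    rw [Finset.sum_empty, (meromorphicOrderAt_eq_top_iff (f := (0 : ℂ → ℂ))).2 (by simp)]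
    exact le_top
  | insert i s hi ih =>
    rw [Finset.sum_insert hi]
    have h1 := fun j hj => hf j (Finset.mem_insert_of_mem hj)
    exact (le_min (hb i (Finset.mem_insert_self _ _))
      (ih h1 fun j hj => hb j (Finset.mem_insert_of_mem hj))).trans
      (meromorphicOrderAt_add (hf i (Finset.mem_insert_self _ _)) (MeromorphicAt.sum h1))

/-- Power series whose continuations have poles of strictly increasing order at all points
`zbar k` satisfy no linear relation over the polynomials. -/
lemma sum_mul_ne_zero {G : ℕ → ℂ⟦X⟧} {g : ℕ → ℂ → ℂ} {c : ℤ}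
    (hev : ∀ i, ∀ᶠ q in 𝓝 (0 : ℂ), Ev q (G i) (g i q))
    (han : ∀ i, AnalyticOnNhd ℂ (g i) slitDisc)
    (hmer : ∀ i k, 2 ≤ k → MeromorphicAt (g i) (zbar k))
    (hord : ∀ i k, 2 ≤ k → meromorphicOrderAt (g i) (zbar k) = ((c - i : ℤ) : WithTop ℤ))
    {r : ℕ} {p : ℕ → ℂ[X]} (hp : p r ≠ 0) :
    ∑ i ∈ Finset.range (r + 1), (p i : ℂ⟦X⟧) * G i ≠ 0 := by
  intro h
  obtain ⟨k, hk, hpk⟩ := exists_zbar_not_isRoot hp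
  set t : ℕ → ℂ → ℂ := fun i => (fun q => (p i).eval q) * g i with ht
  have hpoly : ∀ i z, AnalyticAt ℂ (fun q => (p i).eval q) z := fun i z =>
    (p i).differentiable.analyticAt z
  have htm : ∀ i, MeromorphicAt (t i) (zbar k) := fun i =>
    (hpoly i _).meromorphicAt.mul (hmer i k hk)
  have hta : AnalyticOnNhd ℂ (∑ i ∈ Finset.range (r + 1), t i) slitDisc :=
    Finset.analyticOnNhd_sum _ fun i _ q hq => (hpoly i q).mul (han i q hq)
  have hz : (∑ i ∈ Finset.range (r + 1), t i) =ᶠ[𝓝 0] 0 := by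
    filter_upwards [Filter.eventually_all_finset (Finset.range (r + 1)) |>.2 fun i _ => hev i]
      with q hq
    have h1 := Ev.sum fun i hi => (ev_polynomial q (p i)).mul (hq i hi)
    rw [h] at h1
    have h0 : Ev q 0 0 := by simpa using ev_polynomial q 0
    simpa [ht] using h1.unique h0
  have hzero := hta.eqOn_zero_of_preconnected_of_eventuallyEq_zero isPreconnected_slitDisc
    (mem_slitDisc_of_norm_lt (by simp)) hz
  have hmD : MeromorphicAt (∑ i ∈ Finset.range (r + 1), t i) (zbar k) :=
    MeromorphicAt.sum fun i _ => htm i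
  -- The sum vanishes on the slit disc by the identity theorem, hence at points accumulating at
  -- `zbar k`; a meromorphic function with this property vanishes near the point.
  have htop : meromorphicOrderAt (∑ i ∈ Finset.range (r + 1), t i) (zbar k) = ⊤ := by
    refine meromorphicOrderAt_eq_top_iff.2 (hmD.eventually_eq_zero_or_eventually_ne_zero.resolve_right
      fun hne => ?_)
    obtain ⟨q, h1, h2⟩ := ((frequently_mem_slitDisc (norm_zbar_lt hk)).and_eventually hne).exists
    exact h2 (hzero h1)
  have hlead : meromorphicOrderAt (t r) (zbar k) = ((c - r : ℤ) : WithTop ℤ) := by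
    rw [ht, meromorphicOrderAt_mul (hpoly r _).meromorphicAt (hmer r k hk), hord r k hk,
      (hpoly r _).meromorphicOrderAt_eq, (hpoly r _).analyticOrderAt_eq_zero.2 hpk]
    simp
  -- Polynomial coefficients can only raise the order, so all earlier terms have order at least `c -
  -- r + 1` and cannot cancel the last one.
  have hrest : ((c - r + 1 : ℤ) : WithTop ℤ) ≤
      meromorphicOrderAt (∑ i ∈ Finset.range r, t i) (zbar k) := by
    refine le_meromorphicOrderAt_sum (fun i _ => htm i) fun i hi => ?_
    rw [ht, meromorphicOrderAt_mul (hpoly i _).meromorphicAt (hmer i k hk), hord i k hk]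
    refine le_trans ?_ (le_add_of_nonneg_left (hpoly i _).meromorphicOrderAt_nonneg)
    have := Finset.mem_range.1 hi
    exact_mod_cast (by omega : c - r + 1 ≤ c - i)
  rw [Finset.sum_range_succ, meromorphicOrderAt_add_eq_right_of_lt
    (MeromorphicAt.sum fun i _ => htm i), hlead] at htop
  · exact WithTop.coe_ne_top htop
  · rw [hlead]
    refine lt_of_lt_of_le ?_ hrest
    exact_mod_cast (by omega : c - r < c - r + 1)

/-- Differentiation lowers a nonzero order by one, and the orders -1 - i are never zero. -/
lemma meromorphicOrderAt_iterate_deriv (i : ℕ) {k : ℕ} (hk : 2 ≤ k) :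
    meromorphicOrderAt (deriv^[i] PAfun) (zbar k) = ((-1 - i : ℤ) : WithTop ℤ) := by
  induction i with
  | zero => simpa using meromorphicOrderAt_PAfun hk
  | succ i ih =>
    rw [Function.iterate_succ_apply', meromorphicOrderAt_deriv_eq_sub_one _ ih]
    · congr 1
      push_cast
      ring
    · exact_mod_cast (by omega : (-1 - i : ℤ) ≠ 0)

lemma not_isHolonomic_PA : ¬ IsHolonomic PA := by
  rintro ⟨r, p, hp, h⟩
  refine sum_mul_ne_zero (c := -1) (g := fun i => deriv^[i] PAfun) (fun i => ?_)
    (fun i => analyticOnNhd_PAfun.iterated_deriv i)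
    (fun i k hk => (meromorphicAt_zbar hk).iterated_deriv)
    (fun i k hk => meromorphicOrderAt_iterate_deriv i hk) hp h
  filter_upwards [Metric.ball_mem_nhds (0 : ℂ) (show (0 : ℝ) < 1 / 2 by norm_num)] with q hq
  exact ev_iterate_derivative_PA i (mem_ball_zero_iff.1 hq)

/-- The powers of `PAfun` have orders 0, -1, -2, … at each `zbar k`, so the argument used for the
derivatives applies with `c = 0`. -/
lemma transcendental_PA : Transcendental ℂ[X] PA := by
  rw [transcendental_iff]
  intro P hP
  by_contra hne
  rw [Polynomial.aeval_eq_sum_range] at hP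
  refine sum_mul_ne_zero (c := 0) (G := fun i => PA ^ i) (g := fun i => PAfun ^ i)
    (fun i => ?_) (fun i => analyticOnNhd_PAfun.pow i)
    (fun i k hk => (meromorphicAt_zbar hk).pow i) (fun i k hk => ?_)
    (p := P.coeff) (r := P.natDegree) (by simpa using hne) ?_
  · filter_upwards [eventually_ev_PA] with q hq
    exact hq.pow i
  · rw [meromorphicOrderAt_pow (meromorphicAt_zbar hk), meromorphicOrderAt_PAfun hk]
    rw [zero_sub, ← mul_neg_one (i : ℤ), WithTop.coe_mul]
    rfl
  · rw [← hP]
    refine Finset.sum_congr rfl fun i _ => ?_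
    rw [Algebra.smul_def]
    rfl

end Prudent

open Prudent in
theorem lemma3p2 :
    -- there are finitely many 3-sided prudent polygons of each area
    (∀ n : ℕ, (polygons n).Finite) ∧
    -- the points `zbar k`, `k ≥ 2`
    (∀ k : ℕ, 2 ≤ k →
      1 / 2 < zbar k ∧ zbar k < 55 / 100 ∧ 1 - 2 * zbar k + zbar k ^ (k + 2) = 0 ∧
      ∀ x : ℝ, 0 < x → x < 1 → 1 - 2 * x + x ^ (k + 2) = 0 → x = zbar k) ∧
    Filter.Tendsto zbar Filter.atTop (𝓝 (1 / 2)) ∧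
    (∃ f : ℂ → ℂ,
      -- `f` continues the sum of the power series `PA`
      (∀ q : ℂ, ‖q‖ < 1 / 2 → HasSum (fun n : ℕ => PowerSeries.coeff n PA * q ^ n) (f q)) ∧
      AnalyticOnNhd ℂ f slitDisc ∧
      -- the series representation, with non-vanishing denominators
      (∀ q ∈ slitDisc,
        qPoch (q * u q) q ≠ 0 ∧
        (∀ ν : ℕ, 1 ≤ ν → 1 - 2 * q + q ^ (ν + 2) ≠ 0) ∧
        ∃ s : ℂ,
          HasSum (fun n : ℕ => d (n + 1) q * (q ^ (n + 1 + 2) / (1 - 2 * q + q ^ (n + 1 + 2)))) s ∧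
          f q = C q - A q * (qPoch (v q) q / qPoch (q * u q) q) * (q ^ 2 / (1 - q) ^ 2 + s)) ∧
      -- meromorphy in the punctured disc, with simple poles exactly at the `zbar k`, `k ≥ 2`
      MeromorphicOn f puncturedDisc ∧
      (∀ k : ℕ, 2 ≤ k → meromorphicOrderAt f (zbar k : ℂ) = ((-1 : ℤ) : WithTop ℤ)) ∧
      (∀ q ∈ puncturedDisc, (∀ k : ℕ, 2 ≤ k → q ≠ (zbar k : ℂ)) → AnalyticAt ℂ f q)) ∧
    ¬ IsHolonomic PA ∧
    Transcendental ℂ[X] PA := by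
  refine ⟨finite_polygons, fun k hk => ?_, tendsto_zbar, ⟨PAfun, fun q hq => ?_,
    analyticOnNhd_PAfun, fun q hq => ?_, meromorphicOn_PAfun, fun k hk => meromorphicOrderAt_PAfun hk,
    fun q hq h => analyticAt_PAfun hq h⟩, not_isHolonomic_PA, transcendental_PA⟩
  · obtain ⟨h1, h2, h3⟩ := zbar_spec hk
    exact ⟨h1, h2, h3, fun x h0 h1 h => eq_zbar hk h0 h1 h⟩
  · exact ev_iterate_derivative_PA 0 hq
  · refine ⟨qPoch_qu_ne_zero hq.1.le, fun ν hν => ?_, ∑' n, fterm n q, ?_, rfl⟩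
    · obtain ⟨n, rfl⟩ := Nat.exists_eq_add_of_le' hν
      exact denom_ne_zero hq.1 fun hk => ne_zbar_of_mem_slitDisc hq hk
    · simp only [d_eq hq.1.le]
      exact (summable_fterm (slitDisc_subset hq)).hasSum
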